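/- An instance of MinCC (minimum changeover cost edge coloring) or MinRC (minimum reload cost edge coloring) consists of a set $\mathcal P$ of simple undirected paths, each with at least one edge, whose union is a graph $G$; a finite set $X$ of at least $\Delta(G)+1$ colors; and a traversal cost function $tc: X^2\to\mathbb{Q}_{\ge 0}$ with $tc(i,j)=tc(j,i)$ and $tc(i,i)=0$ for all $i,j\in X$. A traversal of a path is an unordered pair $\{e,e'\}$ of consecutive edges of the path; under an edge coloring $\chi:E(G)\to X$ its cost is $tc(\chi(e),\chi(e'))$. The reload cost of $\chi$ is the sum, over all $P\in\mathcal P$, of the costs of all traversals of $P$. The changeover cost of $\chi$ is the sum of the costs of all traversals occurring in at least one path of $\mathcal P$, each counted once. MinCC (respectively MinRC) asks for a proper edge coloring $\chi:E(G)\to X$ of minimum changeover (respectively reload) cost. The input is given by listing the vertex sequences of the paths and the table of all traversal costs, with all numbers in binary. Theorem. Both MinCC and MinRC, restricted to the instances in which $G$ is a tree and some vertex $r$ is an endpoint of every path $P\in\mathcal P$, are solvable in polynomial time. That is, for each of the two problems there are an algorithm and a polynomial $p$ such that on every such instance the algorithm outputs an optimal proper edge coloring in at most $p(s)$ steps, where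 $s$ is the binary length of the input. (The algorithm runs on a random access machine with integer registers and an indirectly addressed integer memory, where each instruction costs one step and the only arithmetic is addition, subtraction and halving; polynomial time on this machine is the same as polynomial time on a Turing machine.) The degrees of $G$, the number of colors and the traversal costs are not bounded, and $r$ is not part of the input. -/

import Mathlib

/-! ### Random access machine

Programs for a random access machine with integer registers, an integer memory with indirect
addressing, and a write-only output tape. Every executed instruction and every evaluated test
costs one step. The only arithmetic is addition, subtraction and halving, so that after `t` steps
all numbers have at most `t + O(1)` more bits than the longest number of the input; hence
polynomial time here is polynomial time on a Turing machine. -/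

namespace RAM

/-- Programs. Registers are numbered by `ℕ` (a program mentions only finitely many). -/
inductive Prog : Type
  /-- `R[x] := c` -/
  | const (x : ℕ) (c : ℤ)
  /-- `R[x] := R[y] + R[z]` -/
  | add (x y z : ℕ)
  /-- `R[x] := R[y] - R[z]` -/
  | sub (x y z : ℕ)
  /-- `R[x] := ⌊R[y] / 2⌋` -/
  | half (x y : ℕ)
  /-- `R[x] := M[R[y]]` -/
  | load (x y : ℕ)
  /-- `M[R[x]] := R[y]` -/
  | store (x y : ℕ)
  /-- append `R[x]` to the output -/
  | write (x : ℕ)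
  /-- first `a`, then `b` -/
  | seq (a b : Prog)
  /-- if `R[x] > 0` then `a` else `b` -/
  | cond (x : ℕ) (a b : Prog)
  /-- while `R[x] > 0` do `a` -/
  | loop (x : ℕ) (a : Prog)

/-- Machine states: registers, memory and output tape. -/
structure State where
  reg : ℕ → ℤ
  mem : ℤ → ℤ
  out : List ℤ

/-- `s` with the value `v` in register `x`. -/
def State.setReg (s : State) (x : ℕ) (v : ℤ) : State :=
  { s with reg := Function.update s.reg x v }

/-- `Exec a s t s'`: started in state `s`, the program `a` halts after exactly `t` steps, in
state `s'`. -/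
inductive Exec : Prog → State → ℕ → State → Prop
  | const (x : ℕ) (c : ℤ) (s : State) : Exec (.const x c) s 1 (s.setReg x c)
  | add (x y z : ℕ) (s : State) : Exec (.add x y z) s 1 (s.setReg x (s.reg y + s.reg z))
  | sub (x y z : ℕ) (s : State) : Exec (.sub x y z) s 1 (s.setReg x (s.reg y - s.reg z))
  | half (x y : ℕ) (s : State) : Exec (.half x y) s 1 (s.setReg x (s.reg y / 2))
  | load (x y : ℕ) (s : State) : Exec (.load x y) s 1 (s.setReg x (s.mem (s.reg y)))
  | store (x y : ℕ) (s : State) :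
      Exec (.store x y) s 1 { s with mem := Function.update s.mem (s.reg x) (s.reg y) }
  | write (x : ℕ) (s : State) : Exec (.write x) s 1 { s with out := s.out ++ [s.reg x] }
  | seq {a b : Prog} {s s' s'' : State} {t t' : ℕ} :
      Exec a s t s' → Exec b s' t' s'' → Exec (.seq a b) s (t + t') s''
  | condTrue {x : ℕ} {a b : Prog} {s s' : State} {t : ℕ} :
      0 < s.reg x → Exec a s t s' → Exec (.cond x a b) s (t + 1) s'
  | condFalse {x : ℕ} {a b : Prog} {s s' : State} {t : ℕ} :
      s.reg x ≤ 0 → Exec b s t s' → Exec (.cond x a b) s (t + 1) s'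
  | loopDone {x : ℕ} {a : Prog} {s : State} :
      s.reg x ≤ 0 → Exec (.loop x a) s 1 s
  | loopStep {x : ℕ} {a : Prog} {s s' s'' : State} {t t' : ℕ} :
      0 < s.reg x → Exec a s t s' → Exec (.loop x a) s' t' s'' →
        Exec (.loop x a) s (t + t' + 1) s''

/-- The initial state on input `w`: the input stands in the memory cells `0, …, w.length - 1`, its
length in register `0`; everything else is `0` and the output is empty. -/
def initial (w : List ℤ) : State where
  reg x := if x = 0 then (w.length : ℤ) else 0
  mem a := if 0 ≤ a then w.getD a.toNat 0 else 0
  out := []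

/-- On input `w` the program `a` halts after exactly `t` steps with output `w'`. -/
def Computes (a : Prog) (w : List ℤ) (t : ℕ) (w' : List ℤ) : Prop :=
  ∃ s : State, Exec a (initial w) t s ∧ s.out = w'

/-- The size of an input: its total length in binary (one further bit per number for the sign). -/
def bitLength (w : List ℤ) : ℕ :=
  (w.map fun z => z.natAbs.size + 1).sum

/-- The search problem on the instances `i` with `valid i`, given by their encodings, in which
the outputs `w` with `solution i w` are sought, is solvable in polynomial time: one program
answers every valid instance within a number of steps polynomial in the size of its encoding. -/
def PolyTimeSolvable {ι : Type} (encode : ι → List ℤ) (valid : ι → Prop)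
    (solution : ι → List ℤ → Prop) : Prop :=
  ∃ (a : Prog) (p : Polynomial ℕ), ∀ i : ι, valid i →
    ∃ (t : ℕ) (w : List ℤ),
      Computes a (encode i) t w ∧ t ≤ p.eval (bitLength (encode i)) ∧ solution i w

end RAM

/-! ### Minimum changeover / reload cost edge colouring -/

namespace EdgeColoring

/-- The list of the (unordered) pairs of consecutive entries of a list. -/
def consecutive {α : Type} (l : List α) : List (Sym2 α) :=
  (l.zip l.tail).map fun x => s(x.1, x.2)

/-- The edges, in order, of the path given by its sequence of vertices. -/
def pathEdges {V : Type} (p : List V) : List (Sym2 V) :=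
  consecutive p

/-- The traversals of a path: the pairs of consecutive edges. -/
def traversals {V : Type} (p : List V) : List (Sym2 (Sym2 V)) :=
  consecutive (pathEdges p)

/-- The graph comprised by a collection of paths. -/
def unionGraph {V : Type} (P : List (List V)) : SimpleGraph V :=
  SimpleGraph.fromEdgeSet {e | ∃ p ∈ P, e ∈ pathEdges p}

/-- The common instances of MinCC and MinRC: a set of (undirected) paths comprising a graph `G`, a
set of at least `Δ(G) + 1` colours, and a traversal cost function. Vertices and colours are
numbered, and a path is written down as the sequence of its vertices, in one of its two
directions. -/
structure PathInstance where
  /-- number of vertices -/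
  n : ℕ
  /-- the paths -/
  paths : List (List (Fin n))
  /-- a path does not repeat a vertex -/
  paths_simple : ∀ p ∈ paths, p.Nodup
  /-- a path has at least one edge -/
  paths_length : ∀ p ∈ paths, 2 ≤ p.length
  /-- the paths form a set: none is listed twice, not even in opposite directions -/
  paths_distinct : paths.Pairwise fun p q => p ≠ q ∧ p ≠ q.reverse
  /-- every vertex lies on a path -/
  paths_cover : ∀ v : Fin n, ∃ p ∈ paths, v ∈ p
  /-- number of colours -/
  k : ℕ
  /-- there are at least `Δ(G) + 1` colours -/
  degree_lt : ∀ v : Fin n, ((unionGraph paths).neighborSet v).ncard + 1 ≤ k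
  /-- traversal costs -/
  tc : Fin k → Fin k → ℚ≥0
  tc_symm : ∀ i j, tc i j = tc j i
  tc_self : ∀ i, tc i i = 0

namespace PathInstance

variable (I : PathInstance)

/-- The graph comprised by the paths. -/
def graph : SimpleGraph (Fin I.n) :=
  unionGraph I.paths

/-- Assignments of colours to edges; only the values on the edges of `I.graph` matter. -/
abbrev Coloring : Type :=
  Sym2 (Fin I.n) → Fin I.k

/-- Distinct edges of the graph with a common endpoint get distinct colours. -/
def IsProper (χ : I.Coloring) : Prop :=
  ∀ e ∈ I.graph.edgeSet, ∀ f ∈ I.graph.edgeSet, e ≠ f → (∃ v, v ∈ e ∧ v ∈ f) → χ e ≠ χ f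

/-- The cost `tc (χ e) (χ f)` of the traversal `{e, f}`. -/
def traversalCost (χ : I.Coloring) (t : Sym2 (Sym2 (Fin I.n))) : ℚ≥0 :=
  Sym2.lift ⟨fun e f => I.tc (χ e) (χ f), fun _ _ => I.tc_symm _ _⟩ t

/-- Reload cost: each traversal is paid for once for each path that it occurs in. -/
def reloadCost (χ : I.Coloring) : ℚ≥0 :=
  (I.paths.map fun p => ((traversals p).map (I.traversalCost χ)).sum).sum

/-- Changeover cost: each traversal that occurs in some path is paid for once. -/
def changeoverCost (χ : I.Coloring) : ℚ≥0 :=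
  ∑ t ∈ (I.paths.flatMap traversals).toFinset, I.traversalCost χ t

/-- `χ` is a proper edge colouring of minimum cost. -/
def IsOptimal (cost : I.Coloring → ℚ≥0) (χ : I.Coloring) : Prop :=
  I.IsProper χ ∧ ∀ χ' : I.Coloring, I.IsProper χ' → cost χ ≤ cost χ'

/-- The instance as a list of integers: the numbers of vertices, of colours and of paths; each
path, as its number of vertices followed by these vertices; the matrix of traversal costs, row by
row, each cost as numerator and denominator in lowest terms. -/
def encode : List ℤ :=
  [(I.n : ℤ), (I.k : ℤ), (I.paths.length : ℤ)]
    ++ I.paths.flatMap (fun p => (p.length : ℤ) :: p.map fun v => ((v : ℕ) : ℤ))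
    ++ (List.finRange I.k).flatMap fun i => (List.finRange I.k).flatMap fun j =>
        [((I.tc i j).num : ℤ), ((I.tc i j).den : ℤ)]

/-- A colouring as a list of integers: path by path, in the order of the instance, the colours of
the successive edges. -/
def encodeColoring (χ : I.Coloring) : List ℤ :=
  I.paths.flatMap fun p => (pathEdges p).map fun e => ((χ e : ℕ) : ℤ)

/-- The vertex `r` is an endpoint of every path. -/
def IsCommonEndpoint (r : Fin I.n) : Prop :=
  ∀ p ∈ I.paths, p.head? = some r ∨ p.getLast? = some r

/-- The graph is a tree and some vertex is an endpoint of every path. -/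
def IsSingleSourceTree : Prop :=
  I.graph.IsTree ∧ ∃ r : Fin I.n, I.IsCommonEndpoint r

/-- The list `w` is a solution of `I` for MinCC. -/
def IsMinCCSolution (w : List ℤ) : Prop :=
  ∃ χ : I.Coloring, I.IsOptimal I.changeoverCost χ ∧ w = I.encodeColoring χ

/-- The list `w` is a solution of `I` for MinRC. -/
def IsMinRCSolution (w : List ℤ) : Prop :=
  ∃ χ : I.Coloring, I.IsOptimal I.reloadCost χ ∧ w = I.encodeColoring χ

end PathInstance

end EdgeColoring

/-! Root the tree at the common endpoint `r`. Every path then runs downwards from `r`, so an arc (v,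
c) with v ≠ r is preceded, on every path through it, by the edge that leads to v. Hence the
traversals at v correspond to arcs (v, c). Such a traversal counts once for changeover costs and
once per path through (v, c) for reload costs, so the two problems differ only in the weights of the
arcs (`IsRooted.traversals_perm`, `total_arcs`, `total_edges`).

Let the lower endpoint of an edge stand for the edge. Once the colour i of the edge leading to v is
fixed, the subtrees of the children of v interact only because their edges need distinct colours
other than i. The cheapest cost below v is therefore the value of an assignment problem between
children and colours, with entries weight · tc(i, j) + (cheapest cost below c, given j). The surplus
of colours makes it feasible, and the Hungarian method solves it (`hung_spec`) without any bound on
degrees or on the number of colours. The root gets an extra colour k that conflicts with nothing and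
has traversal costs 0. The table of optimal values satisfies this recursion (`cell_table`). Summed
over all vertices, the recursion telescopes (`sum_cells`): the root entry is a lower bound for every
proper colouring (`le_total`), attained by the colouring read off the table (`Follows.total_eq`).
Rational costs are first brought to a common denominator (`scale_spec`).

The running time is handled by a calculus of functions `FP`. Data live in a heap whose used part is
never overwritten, and each function is compiled to a program whose time is bounded by a polynomial
in one global number B, whatever the argument is. This is possible because every loop makes exactly
B rounds and lists are truncated to B entries (`Bd.cut`); under composition the time bounds merely
add up. With closure lemmas for pairs, branching, iteration and folds, `fun_prop` proves
`fp_algorithm` from the text of the algorithm. In the end B is the size of the input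
(`polyTimeSolvable_of_FP`), and `fits` shows that no truncation takes effect. -/

set_option linter.unusedVariables false

/-! ### Representation of data in the heap, and runs of programs. -/

namespace RAM

/-- `x` represents `a` in the memory `m` below the address `h`; `B` is a global bound. -/
class Rep (α : Type) where
  rep : ℕ → (ℤ → ℤ) → ℤ → α → ℤ → Prop
  mono : ∀ {B m m' h h' a x}, (∀ z < h, m' z = m z) → h ≤ h' → rep B m h a x → rep B m' h' a x

open RAM.Rep

/-- The number of rounds of every loop. -/
structure Bd where
  n : ℕ

variable {α β γ σ : Type}

/-- Every integer represents the bound; the content of the predicate is that `b.n` equals the global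
B. A function that takes a `Bd` argument thus has to be computed correctly only when that argument
is B. -/
instance : Rep Bd where
  rep B _ _ b _ := b.n = B
  mono _ _ h := h

instance : Rep ℤ where
  rep _ _ _ a x := x = a
  mono _ _ h := h

instance : Rep ℕ where
  rep _ _ _ a x := x = (a : ℤ)
  mono _ _ h := h

instance : Rep Bool where
  rep _ _ _ a x := x = if a then 1 else 0
  mono _ _ h := h

/-- A pair is the address of two adjacent cells. Components may be shared between pairs, so copying
a value means copying one register. Addresses are positive, which leaves 0 for the empty list. -/
instance [Rep α] [Rep β] : Rep (α × β) where
  rep B m h a x := 0 < x ∧ x + 1 < h ∧ rep B m h a.1 (m x) ∧ rep B m h a.2 (m (x + 1))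
  mono := by
    rintro B m m' h h' a x hm hh ⟨h1, h2, h3, h4⟩
    refine ⟨h1, by omega, ?_, ?_⟩
    · rw [hm _ (by omega)]; exact mono hm hh h3
    · rw [hm _ (by omega)]; exact mono hm hh h4

/-- Linked lists. -/
def listRep [Rep α] (B : ℕ) (m : ℤ → ℤ) (h : ℤ) : List α → ℤ → Prop
  | [], x => x = 0
  | a :: l, x => 0 < x ∧ x + 1 < h ∧ rep B m h a (m x) ∧ listRep B m h l (m (x + 1))

instance [Rep α] : Rep (List α) where
  rep := listRep
  mono := by
    intro B m m' h h' a x hm hh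
    induction a generalizing x with
    | nil => exact fun h => h
    | cons a l ih =>
      rintro ⟨h1, h2, h3, h4⟩
      refine ⟨h1, by omega, ?_, ?_⟩
      · rw [hm _ (by omega)]; exact mono hm hh h3
      · rw [hm _ (by omega)]; exact ih h4

/-- `c` runs from `s` within `T` steps to a state in `Q`. -/
def Runs (c : Prog) (s : State) (T : ℕ) (Q : State → Prop) : Prop :=
  ∃ t s', Exec c s t s' ∧ t ≤ T ∧ Q s'

theorem Runs.seq {a b : Prog} {s : State} {T T' : ℕ} {Q Q' : State → Prop}
    (h : Runs a s T Q) (h' : ∀ s', Q s' → Runs b s' T' Q') : Runs (.seq a b) s (T + T') Q' := by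
  obtain ⟨t, s', e, ht, q⟩ := h
  obtain ⟨t', s'', e', ht', q'⟩ := h' s' q
  exact ⟨t + t', s'', .seq e e', by omega, q'⟩

theorem Runs.mono {a : Prog} {s : State} {T T' : ℕ} {Q Q' : State → Prop}
    (h : Runs a s T Q) (hT : T ≤ T') (h' : ∀ s', Q s' → Q' s') : Runs a s T' Q' := by
  obtain ⟨t, s', e, ht, q⟩ := h
  exact ⟨t, s', e, by omega, h' _ q⟩

theorem Runs.const {x : ℕ} {c : ℤ} {s : State} {Q : State → Prop}
    (h : Q (s.setReg x c)) : Runs (.const x c) s 1 Q := ⟨_, _, .const .., le_rfl, h⟩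
theorem Runs.add {x y z : ℕ} {s : State} {Q : State → Prop}
    (h : Q (s.setReg x (s.reg y + s.reg z))) : Runs (.add x y z) s 1 Q :=
  ⟨_, _, .add .., le_rfl, h⟩
theorem Runs.sub {x y z : ℕ} {s : State} {Q : State → Prop}
    (h : Q (s.setReg x (s.reg y - s.reg z))) : Runs (.sub x y z) s 1 Q :=
  ⟨_, _, .sub .., le_rfl, h⟩
theorem Runs.half {x y : ℕ} {s : State} {Q : State → Prop}
    (h : Q (s.setReg x (s.reg y / 2))) : Runs (.half x y) s 1 Q :=
  ⟨_, _, .half .., le_rfl, h⟩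
theorem Runs.load {x y : ℕ} {s : State} {Q : State → Prop}
    (h : Q (s.setReg x (s.mem (s.reg y)))) : Runs (.load x y) s 1 Q :=
  ⟨_, _, .load .., le_rfl, h⟩
theorem Runs.store {x y : ℕ} {s : State} {Q : State → Prop}
    (h : Q { s with mem := Function.update s.mem (s.reg x) (s.reg y) }) :
    Runs (.store x y) s 1 Q :=
  ⟨_, _, .store .., le_rfl, h⟩
theorem Runs.write {x : ℕ} {s : State} {Q : State → Prop}
    (h : Q { s with out := s.out ++ [s.reg x] }) : Runs (.write x) s 1 Q :=
  ⟨_, _, .write .., le_rfl, h⟩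
theorem Runs.cond {x : ℕ} {a b : Prog} {s : State} {T : ℕ} {Q : State → Prop}
    (h : 0 < s.reg x → Runs a s T Q) (h' : s.reg x ≤ 0 → Runs b s T Q) :
    Runs (.cond x a b) s (T + 1) Q := by
  rcases lt_or_ge 0 (s.reg x) with hx | hx
  · obtain ⟨t, s', e, ht, q⟩ := h hx
    exact ⟨_, _, .condTrue hx e, by omega, q⟩
  · obtain ⟨t, s', e, ht, q⟩ := h' hx
    exact ⟨_, _, .condFalse hx e, by omega, q⟩

/-- A loop with an invariant indexed by the number of rounds still to go. -/
theorem Runs.loop {x : ℕ} {a : Prog} {T : ℕ} {I : ℕ → State → Prop} {s : State} (n : ℕ)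
    (h0 : ∀ s, I 0 s → s.reg x ≤ 0)
    (hpos : ∀ n s, I (n + 1) s → 0 < s.reg x)
    (hstep : ∀ n s, I (n + 1) s → Runs a s T (I n)) (hs : I n s) :
    Runs (.loop x a) s (n * (T + 1) + 1) (I 0) := by
  induction n generalizing s with
  | zero => exact ⟨1, s, .loopDone (h0 s hs), by omega, hs⟩
  | succ n ih =>
    obtain ⟨t, s', e, ht, q⟩ := hstep n s hs
    obtain ⟨t', s'', e', ht', q'⟩ := ih q
    exact ⟨_, _, .loopStep (hpos n s hs) e e', by ring_nf at *; omega, q'⟩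

@[simp] theorem State.setReg_mem (s : State) (x : ℕ) (v : ℤ) : (s.setReg x v).mem = s.mem := rfl
@[simp] theorem State.setReg_out (s : State) (x : ℕ) (v : ℤ) : (s.setReg x v).out = s.out := rfl
theorem State.setReg_reg (s : State) (x : ℕ) (v : ℤ) (y : ℕ) :
    (s.setReg x v).reg y = if y = x then v else s.reg y := by
  simp [State.setReg, Function.update_apply]
@[simp] theorem State.setReg_same (s : State) (x : ℕ) (v : ℤ) : (s.setReg x v).reg x = v := by
  simp [State.setReg_reg]
theorem State.setReg_ne (s : State) {x : ℕ} (v : ℤ) {y : ℕ} (h : y ≠ x) :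
    (s.setReg x v).reg y = s.reg y := by
  simp [State.setReg_reg, h]

/-- From `s` to `s'` only registers `≥ d` and memory above the heap pointer (register 0) have
changed. -/
structure Frame (d : ℕ) (s s' : State) : Prop where
  reg : ∀ x, 1 ≤ x → x < d → s'.reg x = s.reg x
  mem : ∀ z < s.reg 0, s'.mem z = s.mem z
  le : s.reg 0 ≤ s'.reg 0
  out : s'.out = s.out

theorem Frame.refl (d : ℕ) (s : State) : Frame d s s :=
  ⟨fun _ _ _ => rfl, fun _ _ => rfl, le_rfl, rfl⟩

theorem Frame.trans {d e : ℕ} {s s' s'' : State} (h : Frame d s s') (h' : Frame e s' s'')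
    (hde : d ≤ e) : Frame d s s'' where
  reg x hx hxd := by rw [h'.reg x hx (by omega), h.reg x hx hxd]
  mem z hz := by rw [h'.mem z (lt_of_lt_of_le hz h.le), h.mem z hz]
  le := h.le.trans h'.le
  out := h'.out.trans h.out

theorem Frame.setReg {d x : ℕ} {s s' : State} (h : Frame d s s') (hx : d ≤ x) (hx0 : x ≠ 0) (v : ℤ) :
    Frame d s (s'.setReg x v) where
  reg y hy hyd := by rw [State.setReg_ne _ _ (by omega), h.reg y hy hyd]
  mem := h.mem
  le := by rw [State.setReg_ne _ _ (by omega)]; exact h.le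
  out := h.out

/-- Cells below the heap pointer are never overwritten and the pointer never decreases, so a value
once built stays valid. -/
theorem Frame.rep [Rep α] {d B : ℕ} {s s' : State} (h : Frame d s s') {a : α} {x : ℤ}
    (ha : rep B s.mem (s.reg 0) a x) : rep B s'.mem (s'.reg 0) a x :=
  Rep.mono h.mem h.le ha

/-! ### The calculus of polynomial time functions. -/

/-- `f` is computable in time polynomial in the global bound (held in register 1), on
values represented in the heap. -/
@[fun_prop]
def FP [Rep α] [Rep β] (f : α → β) : Prop :=
  ∀ d, 2 ≤ d → ∃ (c : Prog) (q : Polynomial ℕ), ∀ (B : ℕ) (s : State) (a : α),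
    s.reg 1 = B → 0 < s.reg 0 → rep B s.mem (s.reg 0) a (s.reg d) →
    Runs c s (q.eval B) fun s' =>
      Frame d s s' ∧ rep B s'.mem (s'.reg 0) (f a) (s'.reg d)

/-- Copy register `x` to register `y`. -/
def copyReg (y x : ℕ) : Prog := .seq (.const y 0) (.add y x y)

theorem Runs.copyReg {x y : ℕ} {s : State} {Q : State → Prop} (hxy : x ≠ y)
    (h : Q (s.setReg y (s.reg x))) : Runs (copyReg y x) s 2 Q := by
  refine Runs.seq (T := 1) (T' := 1) (.const rfl) ?_
  rintro s' rfl
  refine .add ?_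
  have : ((s.setReg y 0).setReg y ((s.setReg y 0).reg x + (s.setReg y 0).reg y))
      = s.setReg y (s.reg x) := by
    rw [State.setReg_same, State.setReg_ne _ _ hxy, add_zero]
    simp [State.setReg]
  rwa [this]

/-- Put the pair of the registers `x` and `y` on the heap, its address into register `z`; register
`t` is scratch. -/
def allocPair (z x y t : ℕ) : Prog :=
  .seq (.store 0 x) <| .seq (.const t 1) <| .seq (.add t 0 t) <| .seq (.store t y) <|
    .seq (RAM.copyReg z 0) <| .seq (.const t 2) (.add 0 0 t)

/-- The state after `allocPair`. -/
theorem Runs.allocPair {z x y t : ℕ} {s : State} {Q : State → Prop}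
    (hz : z ≠ 0) (ht : t ≠ 0) (hty : t ≠ y) (htz : t ≠ z)
    (h : ∀ s' : State, s'.reg 0 = s.reg 0 + 2 → s'.reg z = s.reg 0 →
      (∀ w, w ≠ 0 → w ≠ z → w ≠ t → s'.reg w = s.reg w) →
      s'.mem (s.reg 0) = s.reg x → s'.mem (s.reg 0 + 1) = s.reg y →
      (∀ a, a ≠ s.reg 0 → a ≠ s.reg 0 + 1 → s'.mem a = s.mem a) → s'.out = s.out → Q s') :
    Runs (RAM.allocPair z x y t) s 8 Q := by
  refine Runs.seq (T := 1) (T' := 7) (.store rfl) ?_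
  rintro _ rfl
  refine Runs.seq (T := 1) (T' := 6) (.const rfl) ?_
  rintro _ rfl
  refine Runs.seq (T := 1) (T' := 5) (.add rfl) ?_
  rintro _ rfl
  refine Runs.seq (T := 1) (T' := 4) (.store rfl) ?_
  rintro _ rfl
  refine Runs.seq (T := 2) (T' := 2) (.copyReg hz.symm rfl) ?_
  rintro _ rfl
  refine Runs.seq (T := 1) (T' := 1) (.const rfl) ?_
  rintro _ rfl
  refine .add (h _ ?_ ?_ ?_ ?_ ?_ ?_ ?_)
  · simp [State.setReg_reg, ht.symm, hz.symm]
  · simp [State.setReg_reg, ht.symm, hz.symm, hz, htz.symm]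
  · intro w h1 h2 h3
    simp [State.setReg_reg, h1, h2, h3]
  · simp [State.setReg_reg, ht.symm, hz.symm]
  · simp [State.setReg_reg, ht.symm, hz.symm, hty.symm]
  · intro a h1 h2
    simp [State.setReg_reg, ht.symm, hz.symm, h1, h2]
  · rfl

variable [Rep α] [Rep β] [Rep γ] [Rep σ]

@[fun_prop] theorem FP.id : FP (fun a : α => a) := by
  intro d hd
  refine ⟨.const (d + 1) 0, 1, fun B s a h1 h0 ha => ?_⟩
  refine Runs.mono (.const (Q := fun s' => s' = s.setReg (d + 1) 0) rfl) (by simp) ?_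
  rintro _ rfl
  have := (Frame.refl d s).setReg (x := d + 1) (by omega) (by omega) 0
  refine ⟨this, ?_⟩
  rw [State.setReg_ne _ _ (by omega : d ≠ d + 1)]
  exact this.rep ha

-- The time bound refers to B only and not to the size of the argument, so no polynomial has to be
-- substituted into another one.
@[fun_prop] theorem FP.comp {f : β → γ} {g : α → β} (hf : FP f) (hg : FP g) :
    FP (fun a : α => f (g a)) := by
  intro d hd
  obtain ⟨c, q, hc⟩ := hg d hd
  obtain ⟨c', q', hc'⟩ := hf d hd
  refine ⟨.seq c c', q + q', fun B s a h1 h0 ha => ?_⟩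
  rw [Polynomial.eval_add]
  refine (hc B s a h1 h0 ha).seq fun s' ⟨fr, r⟩ => ?_
  refine (hc' B s' _ ?_ (lt_of_lt_of_le h0 fr.le) r).mono le_rfl fun s'' ⟨fr', r'⟩ => ?_
  · rw [fr.reg 1 le_rfl (by omega), h1]
  · exact ⟨fr.trans fr' le_rfl, r'⟩

theorem FP.congr {f g : α → β} (hf : FP f) (h : ∀ a, f a = g a) : FP g := by
  rwa [← funext h]

-- The two programs work from the registers d + 1 and d + 2 upwards, so the second leaves the first
-- result intact and the argument stays in d until both are done.
@[fun_prop] theorem FP.prodMk {f : α → β} {g : α → γ} (hf : FP f) (hg : FP g) :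
    FP (fun a : α => (f a, g a)) := by
  intro d hd
  obtain ⟨c, q, hc⟩ := hf (d + 1) (by omega)
  obtain ⟨c', q', hc'⟩ := hg (d + 2) (by omega)
  refine ⟨.seq (copyReg (d + 1) d) <| .seq c <| .seq (copyReg (d + 2) d) <| .seq c' <|
    allocPair d (d + 1) (d + 2) (d + 3),
    2 + (q + (2 + (q' + 8))), fun B s a h1 h0 ha => ?_⟩
  simp only [Polynomial.eval_add, Polynomial.eval_ofNat]
  refine (Runs.copyReg (by omega) rfl).seq ?_
  rintro s1 rfl
  have f1 := (Frame.refl d s).setReg (x := d + 1) (by omega) (by omega) (s.reg d)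
  set s1 := s.setReg (d + 1) (s.reg d) with hs1
  have e1 : s1.reg d = s.reg d := State.setReg_ne _ _ (by omega)
  have e1' : s1.reg (d + 1) = s.reg d := State.setReg_same ..
  have r1 : s1.reg 1 = B := by rw [f1.reg 1 le_rfl (by omega), h1]
  refine (hc B s1 a r1 (lt_of_lt_of_le h0 f1.le) (by rw [e1']; exact f1.rep ha)).seq ?_
  rintro s2 ⟨f2, v2⟩
  have e2 : s2.reg d = s.reg d := by rw [f2.reg d (by omega) (by omega), e1]
  refine (Runs.copyReg (by omega) rfl).seq ?_
  rintro s3 rfl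
  have f3 := (Frame.refl (d + 2) s2).setReg (x := d + 2) le_rfl (by omega) (s2.reg d)
  set s3 := s2.setReg (d + 2) (s2.reg d) with hs3
  have e3 : s3.reg (d + 2) = s.reg d := by rw [hs3, State.setReg_same, e2]
  have f13 : Frame d s s3 := (f1.trans f2 (by omega)).trans f3 (by omega)
  refine (hc' B s3 a ?_ (lt_of_lt_of_le h0 f13.le) (by rw [e3]; exact f13.rep ha)).seq ?_
  · rw [f13.reg 1 le_rfl (by omega), h1]
  rintro s4 ⟨f4, v4⟩
  have f24 := f3.trans f4 (by omega)
  have v2' := f24.rep v2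
  rw [← f24.reg (d + 1) (by omega) (by omega)] at v2'
  have f14 := f13.trans f4 (by omega)
  have p4 : 0 < s4.reg 0 := lt_of_lt_of_le h0 f14.le
  refine Runs.allocPair (by omega) (by omega) (by omega) (by omega) ?_
  intro s5 k1 k2 k3 k4 k5 k6 k7
  have f5 : Frame d s4 s5 :=
    ⟨fun x hx hxd => k3 x (by omega) (by omega) (by omega),
      fun z hz => k6 z (by omega) (by omega), by omega, k7⟩
  refine ⟨f14.trans f5 (by omega), ?_⟩
  rw [k2]
  refine ⟨p4, by omega, ?_, ?_⟩
  · rw [k4]; exact f5.rep v2'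
  · rw [k5]; exact f5.rep v4

theorem FP.fst_prim : FP (fun a : α × β => a.1) := by
  intro d hd
  refine ⟨.load d d, 1, fun B s a h1 h0 ha => ?_⟩
  obtain ⟨h2, h3, h4, h5⟩ := ha
  refine Runs.mono (.load (Q := fun s' => s' = s.setReg d (s.mem (s.reg d))) rfl) (by simp) ?_
  rintro _ rfl
  have := (Frame.refl d s).setReg le_rfl (by omega) (s.mem (s.reg d))
  refine ⟨this, ?_⟩
  rw [State.setReg_same]
  exact this.rep h4

/-- Load the second component. -/
def loadSnd (y x t : ℕ) : Prog :=
  .seq (.const t 1) <| .seq (.add t x t) (.load y t)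

theorem Runs.loadSnd {y x t : ℕ} {s : State} {Q : State → Prop} (hxt : x ≠ t)
    (h : ∀ v, Q ((s.setReg t v).setReg y (s.mem (s.reg x + 1)))) :
    Runs (loadSnd y x t) s 3 Q := by
  refine Runs.seq (T := 1) (T' := 2) (.const rfl) ?_
  rintro _ rfl
  refine Runs.seq (T := 1) (T' := 1) (.add rfl) ?_
  rintro _ rfl
  refine .load ?_
  convert h (s.reg x + 1) using 2
  · simp [State.setReg, hxt]
  · simp [State.setReg_reg, hxt]

theorem FP.snd_prim : FP (fun a : α × β => a.2) := by
  intro d hd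
  refine ⟨RAM.loadSnd d d (d + 1), 3, fun B s a h1 h0 ha => ?_⟩
  obtain ⟨h2, h3, h4, h5⟩ := ha
  refine Runs.mono (.loadSnd (by omega) (Q := fun s' => ∃ v, s' = (s.setReg (d + 1) v).setReg d
    (s.mem (s.reg d + 1))) (fun v => ⟨v, rfl⟩)) (by simp) ?_
  rintro _ ⟨v, rfl⟩
  have := ((Frame.refl d s).setReg (x := d + 1) (by omega) (by omega) v).setReg le_rfl (by omega)
    (s.mem (s.reg d + 1))
  refine ⟨this, ?_⟩
  rw [State.setReg_same]
  exact this.rep h5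

@[fun_prop] theorem FP.fst {f : α → β × γ} (hf : FP f) : FP (fun a => (f a).1) :=
  FP.comp FP.fst_prim hf
@[fun_prop] theorem FP.snd {f : α → β × γ} (hf : FP f) : FP (fun a => (f a).2) :=
  FP.comp FP.snd_prim hf

/-- Types all of whose values are available as constants. -/
class RepConst (α : Type) [Rep α] : Prop where
  const (γ : Type) [Rep γ] (a : α) : FP fun _ : γ => a

@[fun_prop] theorem FP.const [RepConst β] (b : β) : FP (fun _ : α => b) := RepConst.const α b

/-- A function whose values are represented by an integer that does not depend on the memory. -/
theorem FP.of_const {b : β} (z : ℤ) (h : ∀ B m h, Rep.rep B m h b z) : FP (fun _ : α => b) := by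
  intro d hd
  refine ⟨.const d z, 1, fun B s a h1 h0 ha => ?_⟩
  refine Runs.mono (.const (Q := fun s' => s' = s.setReg d z) rfl) (by simp) ?_
  rintro _ rfl
  refine ⟨(Frame.refl d s).setReg le_rfl (by omega) z, ?_⟩
  rw [State.setReg_same]
  exact h ..

instance : RepConst ℤ := ⟨fun _ _ a => FP.of_const a fun _ _ _ => rfl⟩
instance : RepConst ℕ := ⟨fun _ _ a => FP.of_const (a : ℤ) fun _ _ _ => rfl⟩
instance : RepConst Bool := ⟨fun _ _ a => FP.of_const (if a then 1 else 0) fun _ _ _ => rfl⟩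
instance [RepConst α] [RepConst β] : RepConst (α × β) :=
  ⟨fun _ _ a => FP.prodMk (.const a.1) (.const a.2)⟩

/-- A list cell has the same layout as the pair of its head and its tail, so the program of the
identity does it. -/
theorem FP.cons_prim : FP (fun a : α × List α => a.1 :: a.2) := by
  intro d hd
  obtain ⟨c, q, hc⟩ := FP.id (α := α × List α) d hd
  exact ⟨c, q, hc⟩

@[fun_prop] theorem FP.cons {f : α → β} {g : α → List β} (hf : FP f) (hg : FP g) :
    FP fun a => f a :: g a := FP.comp FP.cons_prim (hf.prodMk hg)

instance [RepConst α] : RepConst (List α) where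
  const _ _ a := by
    induction a with
    | nil => exact FP.of_const 0 fun _ _ _ => rfl
    | cons a l ih => exact FP.cons (.const a) ih

theorem FP.ite_bool {p : α → Bool} {f g : α → β} (hp : FP p) (hf : FP f) (hg : FP g) :
    FP fun a => if p a = true then f a else g a := by
  intro d hd
  obtain ⟨c, q, hc⟩ := hp (d + 1) (by omega)
  obtain ⟨c₁, q₁, hc₁⟩ := hf d hd
  obtain ⟨c₂, q₂, hc₂⟩ := hg d hd
  refine ⟨.seq (copyReg (d + 1) d) <| .seq c <| .cond (d + 1) c₁ c₂,
    2 + (q + (q₁ + q₂ + 1)), fun B s a h1 h0 ha => ?_⟩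
  simp only [Polynomial.eval_add, Polynomial.eval_ofNat, Polynomial.eval_one]
  refine (Runs.copyReg (by omega) rfl).seq ?_
  rintro s1 rfl
  have f1 := (Frame.refl d s).setReg (x := d + 1) (by omega) (by omega) (s.reg d)
  set s1 := s.setReg (d + 1) (s.reg d) with hs1
  have e1 : s1.reg d = s.reg d := State.setReg_ne _ _ (by omega)
  have e1' : s1.reg (d + 1) = s.reg d := State.setReg_same ..
  have r1 : s1.reg 1 = B := by rw [f1.reg 1 le_rfl (by omega), h1]
  refine (hc B s1 a r1 (lt_of_lt_of_le h0 f1.le) (by rw [e1']; exact f1.rep ha)).seq ?_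
  rintro s2 ⟨f2, v2⟩
  have f12 : Frame d s s2 := f1.trans f2 (by omega)
  have e2 : s2.reg d = s.reg d := by rw [f2.reg d (by omega) (by omega), e1]
  have v2' : s2.reg (d + 1) = if p a then 1 else 0 := v2
  have r2 : s2.reg 1 = B := by rw [f12.reg 1 le_rfl (by omega), h1]
  have p2 := lt_of_lt_of_le h0 f12.le
  have a2 : Rep.rep B s2.mem (s2.reg 0) a (s2.reg d) := by rw [e2]; exact f12.rep ha
  refine Runs.cond (fun hx => ?_) fun hx => ?_
  · have : p a = true := by
      by_contra hh
      rw [v2', if_neg hh] at hx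
      omega
    refine (hc₁ B s2 a r2 p2 a2).mono (by omega) ?_
    rintro s3 ⟨f3, v3⟩
    rw [if_pos this]
    exact ⟨f12.trans f3 le_rfl, v3⟩
  · have : ¬ p a = true := by
      intro hh
      rw [v2', if_pos hh] at hx
      omega
    refine (hc₂ B s2 a r2 p2 a2).mono (by omega) ?_
    rintro s3 ⟨f3, v3⟩
    rw [if_neg this]
    exact ⟨f12.trans f3 le_rfl, v3⟩

@[fun_prop] theorem FP.ite {p : α → Prop} [hd : ∀ a, Decidable (p a)] {f g : α → β}
    (hp : FP fun a => decide (p a)) (hf : FP f) (hg : FP g) :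
    FP fun a => if p a then f a else g a :=
  (FP.ite_bool hp hf hg).congr fun a => by simp

/-- Conditional execution on the sign of the integer in register `d`. -/
theorem FP.pos : FP fun a : ℤ => decide (0 < a) := by
  intro d hd
  refine ⟨.cond d (.const d 1) (.const d 0), 2, fun B s a h1 h0 ha => ?_⟩
  have ha' : s.reg d = a := ha
  simp only [Polynomial.eval_ofNat]
  refine Runs.cond (T := 1) (fun hx => .const ?_) fun hx => .const ?_
  · refine ⟨(Frame.refl d s).setReg le_rfl (by omega) _, ?_⟩
    rw [State.setReg_same, decide_eq_true (by omega)]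
    rfl
  · refine ⟨(Frame.refl d s).setReg le_rfl (by omega) _, ?_⟩
    rw [State.setReg_same, decide_eq_false (by omega)]
    rfl

theorem FP.isEmpty_prim : FP fun l : List α => l.isEmpty := by
  intro d hd
  refine ⟨.cond d (.const d 0) (.const d 1), 2, fun B s a h1 h0 ha => ?_⟩
  simp only [Polynomial.eval_ofNat]
  refine Runs.cond (T := 1) (fun hx => .const ?_) fun hx => .const ?_
  · refine ⟨(Frame.refl d s).setReg le_rfl (by omega) _, ?_⟩
    rw [State.setReg_same]
    cases a with
    | nil => have : s.reg d = 0 := ha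
             omega
    | cons a l => rfl
  · refine ⟨(Frame.refl d s).setReg le_rfl (by omega) _, ?_⟩
    rw [State.setReg_same]
    cases a with
    | nil => rfl
    | cons a l => have := ha.1
                  omega

@[fun_prop] theorem FP.isEmpty {f : α → List β} (hf : FP f) : FP fun a => (f a).isEmpty :=
  FP.comp FP.isEmpty_prim hf

theorem FP.tail_prim : FP fun l : List α => l.tail := by
  intro d hd
  refine ⟨.cond d (RAM.loadSnd d d (d + 1)) (.const d 0), 4, fun B s a h1 h0 ha => ?_⟩
  simp only [Polynomial.eval_ofNat]
  refine Runs.cond (T := 3) (fun hx => .loadSnd (by omega) fun v => ?_) fun hx =>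
    (Runs.const ?_).mono (by omega) fun _ h => h
  · have := ((Frame.refl d s).setReg (x := d + 1) (by omega) (by omega) v).setReg le_rfl (by omega)
      (s.mem (s.reg d + 1))
    refine ⟨this, ?_⟩
    rw [State.setReg_same]
    cases a with
    | nil => have : s.reg d = 0 := ha
             omega
    | cons a l => exact this.rep (a := l) ha.2.2.2
  · refine ⟨(Frame.refl d s).setReg le_rfl (by omega) _, ?_⟩
    rw [State.setReg_same]
    cases a with
    | nil => rfl
    | cons a l => have := ha.1
                  omega

@[fun_prop] theorem FP.tail {f : α → List β} (hf : FP f) : FP fun a => (f a).tail :=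
  FP.comp FP.tail_prim hf

theorem FP.headD_prim : FP fun a : List α × α => a.1.headD a.2 := by
  intro d hd
  refine ⟨.seq (.load (d + 1) d) <| .cond (d + 1) (.load d (d + 1)) (RAM.loadSnd d d (d + 2)), 5,
    fun B s a h1 h0 ha => ?_⟩
  simp only [Polynomial.eval_ofNat]
  obtain ⟨l, a⟩ := a
  obtain ⟨h2, h3, h4, h5⟩ := ha
  refine Runs.seq (T := 1) (T' := 4) (.load rfl) ?_
  rintro _ rfl
  have f1 := (Frame.refl d s).setReg (x := d + 1) (by omega) (by omega) (s.mem (s.reg d))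
  refine Runs.cond (T := 3) (fun hx => ?_) fun hx => .loadSnd (by omega) fun v => ?_
  · refine Runs.mono (T := 1) (.load ?_) (by omega) fun _ h => h
    refine ⟨f1.setReg le_rfl (by omega) _, ?_⟩
    rw [State.setReg_same] at *
    rw [State.setReg_same]
    cases l with
    | nil => have : s.mem (s.reg d) = 0 := h4
             omega
    | cons b l => exact (f1.setReg le_rfl (by omega) _).rep h4.2.2.1
  · have f2 := (f1.setReg (x := d + 2) (by omega) (by omega) v).setReg le_rfl (by omega)
      ((s.setReg (d + 1) (s.mem (s.reg d))).mem ((s.setReg (d + 1) (s.mem (s.reg d))).reg d + 1))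
    refine ⟨f2, ?_⟩
    rw [State.setReg_same] at *
    cases l with
    | nil =>
      have e := State.setReg_ne s (s.mem (s.reg d)) (by omega : d ≠ d + 1)
      rw [e] at f2 ⊢
      exact f2.rep h5
    | cons b l => have := h4.1
                  omega

@[fun_prop] theorem FP.headD {f : α → List β} {g : α → β} (hf : FP f) (hg : FP g) :
    FP fun a => (f a).headD (g a) :=
  FP.comp (f := fun a : List β × β => a.1.headD a.2) FP.headD_prim (hf.prodMk hg)

/-- A binary operation on integers given by a single instruction. -/
theorem FP.of_instr {f : ℤ → ℤ → ℤ} (c : ℕ → ℕ → ℕ → Prog)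
    (hc : ∀ x y z s, Exec (c x y z) s 1 (s.setReg x (f (s.reg y) (s.reg z)))) :
    FP fun a : ℤ × ℤ => f a.1 a.2 := by
  intro d hd
  refine ⟨.seq (.load (d + 1) d) <| .seq (RAM.loadSnd (d + 2) d (d + 3)) (c d (d + 1) (d + 2)), 5,
    fun B s a h1 h0 ha => ?_⟩
  simp only [Polynomial.eval_ofNat]
  obtain ⟨a, b⟩ := a
  obtain ⟨h2, h3, h4, h5⟩ := ha
  have h4' : s.mem (s.reg d) = a := h4
  have h5' : s.mem (s.reg d + 1) = b := h5
  refine Runs.seq (T := 1) (T' := 4) (.load rfl) ?_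
  rintro _ rfl
  have f1 := (Frame.refl d s).setReg (x := d + 1) (by omega) (by omega) (s.mem (s.reg d))
  refine Runs.seq (T := 3) (T' := 1) (Q := fun s' => ∃ v, s' =
    ((s.setReg (d + 1) (s.mem (s.reg d))).setReg (d + 3) v).setReg (d + 2)
      ((s.setReg (d + 1) (s.mem (s.reg d))).mem
        ((s.setReg (d + 1) (s.mem (s.reg d))).reg d + 1)))
    (.loadSnd (by omega) fun v => ⟨v, rfl⟩) ?_
  rintro _ ⟨v, rfl⟩
  refine ⟨1, _, hc .., le_rfl, ?_⟩
  refine ⟨((f1.setReg (by omega) (by omega) _).setReg (by omega) (by omega) _).setReg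
    le_rfl (by omega) _, ?_⟩
  rw [State.setReg_same]
  show _ = f a b
  rw [State.setReg_same, State.setReg_mem, State.setReg_ne _ _ (by omega : d + 1 ≠ d + 2),
    State.setReg_ne _ _ (by omega : d + 1 ≠ d + 3), State.setReg_same,
    State.setReg_ne _ _ (by omega : d ≠ d + 1), h4', h5']

@[fun_prop] theorem FP.add_int {f g : α → ℤ} (hf : FP f) (hg : FP g) : FP fun a => f a + g a :=
  FP.comp (f := fun a : ℤ × ℤ => a.1 + a.2)
    (FP.of_instr (f := fun x y => x + y) .add fun _ _ _ _ => .add ..) (hf.prodMk hg)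
@[fun_prop] theorem FP.sub_int {f g : α → ℤ} (hf : FP f) (hg : FP g) : FP fun a => f a - g a :=
  FP.comp (f := fun a : ℤ × ℤ => a.1 - a.2)
    (FP.of_instr (f := fun x y => x - y) .sub fun _ _ _ _ => .sub ..) (hf.prodMk hg)
@[fun_prop] theorem FP.half_int {f : α → ℤ} (hf : FP f) : FP fun a => f a / 2 :=
  FP.comp (f := fun a : ℤ × ℤ => a.1 / 2)
    (FP.of_instr (f := fun x _ => x / 2) (fun x y _ => .half x y) fun _ _ _ _ => .half ..)
    (hf.prodMk hf)

/-- Natural numbers are represented like the corresponding integers. -/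
theorem FP.of_natCast {f : α → ℕ} (hf : FP fun a => (f a : ℤ)) : FP f := hf
@[fun_prop] theorem FP.natCast {f : α → ℕ} (hf : FP f) : FP fun a => (f a : ℤ) := hf

-- The one place where a loop is compiled; folds and all list operations come from here. The number
-- of rounds is the value of register 1.
@[fun_prop] theorem FP.iterate {b : α → Bd} {h : α → σ → σ} {g : α → σ} (hb : FP b)
    (hh : FP fun x : α × σ => h x.1 x.2) (hg : FP g) :
    FP fun a => (h a)^[(b a).n] (g a) := by
  intro d hd
  obtain ⟨cb, qb, hcb⟩ := hb (d + 1) (by omega)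
  obtain ⟨c, q, hc⟩ := hg (d + 1) (by omega)
  obtain ⟨c', q', hc'⟩ := hh (d + 3) (by omega)
  refine ⟨.seq (copyReg (d + 1) d) <| .seq c <| .seq (copyReg (d + 2) 1) <|
    .seq (.loop (d + 2) <| .seq (allocPair (d + 3) d (d + 1) (d + 4)) <|
      .seq c' <| .seq (copyReg (d + 1) (d + 3)) <| .seq (.const (d + 3) 1)
        (.sub (d + 2) (d + 2) (d + 3))) <| copyReg d (d + 1),
    2 + (q + (2 + (Polynomial.X * (8 + (q' + 4) + 1) + 1 + 2))), fun B s a h1 h0 ha => ?_⟩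
  simp only [Polynomial.eval_add, Polynomial.eval_ofNat, Polynomial.eval_mul, Polynomial.eval_X,
    Polynomial.eval_one]
  have f1 := (Frame.refl d s).setReg (x := d + 1) (by omega) (by omega) (s.reg d)
  have e1' : (s.setReg (d + 1) (s.reg d)).reg (d + 1) = s.reg d := State.setReg_same ..
  have r1 : (s.setReg (d + 1) (s.reg d)).reg 1 = B := by rw [f1.reg 1 le_rfl (by omega), h1]
  -- The program for `b` is not part of the compiled program. That it would end with a
  -- representation of `b a` already says `(b a).n = B`.
  have hB : (b a).n = B := by
    obtain ⟨_, _, _, _, _, hr⟩ := hcb B _ a r1 (lt_of_lt_of_le h0 f1.le)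
      (by rw [e1']; exact f1.rep ha)
    exact hr
  rw [hB]
  refine (Runs.copyReg (by omega) rfl).seq ?_
  rintro s1 rfl
  have e1 : (s.setReg (d + 1) (s.reg d)).reg d = s.reg d := State.setReg_ne _ _ (by omega)
  refine (hc B _ a r1 (lt_of_lt_of_le h0 f1.le) (by rw [e1']; exact f1.rep ha)).seq ?_
  rintro s2 ⟨f2, v2⟩
  refine (Runs.copyReg (by omega) rfl).seq ?_
  rintro s3 rfl
  have f12 := f1.trans f2 (by omega)
  have r2 : s2.reg 1 = B := by rw [f12.reg 1 le_rfl (by omega), h1]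
  -- With n rounds to go, register d + 2 holds n, register d still holds the argument, and register
  -- d + 1 holds the iterate number B - n.
  let I : ℕ → State → Prop := fun n s' => Frame d s s' ∧ s'.reg d = s.reg d ∧ s'.reg (d + 2) = n ∧
    n ≤ B ∧ Rep.rep B s'.mem (s'.reg 0) ((h a)^[B - n] (g a)) (s'.reg (d + 1))
  refine Runs.seq (Q := I 0) (Runs.loop (I := I) (T := 8 + (q'.eval B + 4)) B ?_ ?_ ?_ ?_) ?_
  · rintro s ⟨_, _, h, _⟩
    rw [h]; simp
  · rintro n s ⟨_, _, h, _⟩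
    rw [h]; positivity
  · rintro n s4 ⟨f4, e4, n4, nB, v4⟩
    refine (Runs.allocPair (by omega) (by omega) (by omega) (by omega) fun s5 => ?_).seq
      (Q := fun s5 => Frame (d + 3) s4 s5 ∧
        Rep.rep B s5.mem (s5.reg 0) (a, (h a)^[B - (n + 1)] (g a)) (s5.reg (d + 3))) ?_
    · intro k1 k2 k3 k4 k5 k6 k7
      have f5 : Frame (d + 3) s4 s5 :=
        ⟨fun x hx hxd => k3 x (by omega) (by omega) (by omega),
          fun z hz => k6 z (by omega) (by omega), by omega, k7⟩
      refine ⟨f5, ?_⟩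
      rw [k2]
      refine ⟨lt_of_lt_of_le h0 f4.le, by omega, ?_, ?_⟩
      · rw [k4, e4]; exact (f4.trans f5 (by omega)).rep ha
      · rw [k5]; exact f5.rep v4
    rintro s5 ⟨f5, v5⟩
    have f45 := f4.trans f5 (by omega)
    refine (hc' B s5 _ (by rw [f45.reg 1 le_rfl (by omega), h1]) (lt_of_lt_of_le h0 f45.le)
      v5).seq ?_
    rintro s6 ⟨f6, v6⟩
    have f46 := f5.trans f6 (by omega)
    refine Runs.seq (T := 2) (T' := 2) (Runs.copyReg (by omega) rfl) ?_
    rintro _ rfl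
    refine Runs.seq (T := 1) (T' := 1) (Runs.const rfl) ?_
    rintro _ rfl
    refine Runs.sub ?_
    have fr := (((Frame.refl (d + 1) s6).setReg (x := d + 1) le_rfl (by omega)
      (s6.reg (d + 3))).setReg (x := d + 3) (by omega) (by omega) 1)
    have fr' := fr.setReg (x := d + 2) (by omega) (by omega)
      (((s6.setReg (d + 1) (s6.reg (d + 3))).setReg (d + 3) 1).reg (d + 2) -
      ((s6.setReg (d + 1) (s6.reg (d + 3))).setReg (d + 3) 1).reg (d + 3))
    refine ⟨(f4.trans f46 (by omega)).trans fr' (by omega), ?_, ?_, by omega, ?_⟩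
    · rw [fr'.reg d (by omega) (by omega), f46.reg d (by omega) (by omega), e4]
    · rw [State.setReg_same, State.setReg_same, State.setReg_ne _ _ (by omega),
        State.setReg_ne _ _ (by omega), f46.reg (d + 2) (by omega) (by omega), n4]
      push_cast; ring
    · rw [show B - n = B - (n + 1) + 1 by omega, Function.iterate_succ_apply']
      convert fr'.rep (a := h a _) v6 using 1
      simp [State.setReg_reg]
  · have fr := (Frame.refl (d + 2) s2).setReg (x := d + 2) le_rfl (by omega) (s2.reg 1)
    refine ⟨f12.trans fr (by omega), ?_, ?_, le_rfl, ?_⟩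
    · rw [fr.reg d (by omega) (by omega), f2.reg d (by omega) (by omega), e1]
    · rw [State.setReg_same, r2]
    · rw [Nat.sub_self, fr.reg (d + 1) (by omega) (by omega)]
      exact fr.rep v2
  · rintro s4 ⟨f4, e4, n4, nB, v4⟩
    have fr := (Frame.refl d s4).setReg (x := d) le_rfl (by omega) (s4.reg (d + 1))
    refine Runs.copyReg (by omega) ⟨f4.trans fr le_rfl, ?_⟩
    rw [State.setReg_same]
    exact fr.rep v4

end RAM

/-! ### Reading the input, measuring its size, writing the output. -/

namespace RAM

theorem size_half {m : ℕ} (h : 0 < m) : Nat.size m = Nat.size (m / 2) + 1 := by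
  have h2 := Nat.size_bit (b := m.bodd) (n := m / 2) (by
    rw [← Nat.div2_val, Nat.bit_bodd_div2]; omega)
  rwa [← Nat.div2_val, Nat.bit_bodd_div2] at h2

/-- `R[1] := R[1] + Nat.size R[6]`, using the registers `4` and `6`. -/
theorem Runs.addSize (s : State) (m T : ℕ) (h : s.reg 6 = m) (hT : m.size ≤ T) :
    Runs (.loop 6 (.seq (.half 6 6) (.seq (.const 4 1) (.add 1 1 4)))) s (T * 4 + 1) fun s' =>
      s'.mem = s.mem ∧ s'.out = s.out ∧ s'.reg 1 = s.reg 1 + m.size ∧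
        ∀ x, x ≠ 1 → x ≠ 4 → x ≠ 6 → s'.reg x = s.reg x := by
  let I : ℕ → State → Prop := fun n s' => s'.mem = s.mem ∧ s'.out = s.out ∧
    (∃ m' : ℕ, s'.reg 6 = m' ∧ m'.size = n) ∧ s'.reg 1 + n = s.reg 1 + m.size ∧
    ∀ x, x ≠ 1 → x ≠ 4 → x ≠ 6 → s'.reg x = s.reg x
  refine (Runs.loop (I := I) (T := 3) m.size ?_ ?_ ?_ ?_).mono (by omega) ?_
  · rintro s' ⟨_, _, ⟨m', h1, h2⟩, _⟩
    rw [Nat.size_eq_zero] at h2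
    simp [h1, h2]
  · rintro n s' ⟨_, _, ⟨m', h1, h2⟩, _⟩
    rcases Nat.eq_zero_or_pos m' with h0 | h0
    · subst h0; simp at h2
    · rw [h1]; exact_mod_cast h0
  · rintro n s' ⟨h3, h4, ⟨m', h1, h2⟩, h5, h6⟩
    refine Runs.seq (T := 1) (T' := 2) (Runs.half rfl) ?_
    rintro _ rfl
    refine Runs.seq (T := 1) (T' := 1) (Runs.const rfl) ?_
    rintro _ rfl
    refine Runs.add ⟨h3, h4, ⟨m' / 2, ?_, ?_⟩, ?_, ?_⟩
    · simp [State.setReg_reg, h1]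
    · rcases Nat.eq_zero_or_pos m' with h0 | h0
      · subst h0; simp at h2
      · rw [size_half h0] at h2; omega
    · simp [State.setReg_reg]; push_cast at h5; omega
    · intro x h7 h8 h9
      simp [State.setReg_reg, h7, h8, h9, h6]
  · exact ⟨rfl, rfl, ⟨m, h, rfl⟩, rfl, fun _ _ _ _ => rfl⟩
  · rintro s' ⟨h3, h4, _, h5, h6⟩
    exact ⟨h3, h4, by simpa using h5, h6⟩

/-- One round of reading the input: the number at the address `R[2] - 1` is prepended to the list
in register `3`, and its size is added to register `1`. -/
def readRound : Prog :=
  .seq (.const 4 1) <| .seq (.sub 2 2 4) <| .seq (.load 5 2) <| .seq (.add 1 1 4) <|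
    .seq (copyReg 6 5) <|
    .seq (.loop 6 (.seq (.half 6 6) (.seq (.const 4 1) (.add 1 1 4)))) <|
    .seq (allocPair 7 5 3 4) (copyReg 3 7)

/-- Turn the input into a list on the heap; then register `1` holds the size of the input. -/
def readInput : Prog :=
  .seq (.const 1 0) <| .seq (copyReg 2 0) <| .seq (.const 3 0) (.loop 2 readRound)

/-- Write the list in register `2`. -/
def writeOutput : Prog :=
  .loop 2 (.seq (.load 3 2) <| .seq (.write 3) (loadSnd 2 2 4))

/-- The input is read from its last cell to its first, so that prepending keeps the order. Initially
register 0 holds the input length, hence it already is a heap pointer to the first cell behind the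
input; `hw` makes it positive. Each number adds one plus its binary length to register 1, which ends
up as `bitLength`. -/
theorem Runs.readInput (w : List ℕ) (hw : w ≠ []) (B : ℕ)
    (hB : bitLength (w.map Nat.cast) = B) :
    Runs RAM.readInput (initial (w.map Nat.cast)) (B * (B * 4 + 20) + 10) fun s =>
      s.reg 1 = B ∧ 0 < s.reg 0 ∧ Rep.rep B s.mem (s.reg 0) w (s.reg 3) ∧ s.out = [] := by
  have hbl : ∀ l : List ℕ, bitLength (l.map Nat.cast) = (l.map fun z => z.size + 1).sum := by
    intro l
    simp [bitLength, Function.comp_def]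
  rw [hbl] at hB
  have hlen : w.length ≤ B := by
    rw [← hB]
    simp
  let I : ℕ → State → Prop := fun n s => n ≤ w.length ∧ s.reg 2 = n ∧
    s.reg 1 = (((w.drop n).map fun z => z.size + 1).sum : ℕ) ∧
    Rep.rep B s.mem (s.reg 0) (w.drop n) (s.reg 3) ∧ (w.length : ℤ) ≤ s.reg 0 ∧
    (∀ i : ℕ, ∀ h : i < w.length, s.mem i = w[i]) ∧ s.out = []
  refine Runs.mono (T := 1 + (2 + (1 + (w.length * ((B * 4 + 1) + 16 + 1) + 1)))) (Q := I 0)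
    ?_ (by nlinarith) ?_
  swap
  · rintro s ⟨h1, h2, h3, h4, h5, h6, h7⟩
    refine ⟨?_, ?_, h4, h7⟩
    · simpa [hB] using h3
    · have := List.length_pos_iff.2 hw
      omega
  refine Runs.seq (Runs.const rfl) ?_
  rintro _ rfl
  refine Runs.seq (Runs.copyReg (by omega) rfl) ?_
  rintro _ rfl
  refine Runs.seq (Runs.const rfl) ?_
  rintro _ rfl
  refine Runs.loop (I := I) w.length ?_ ?_ ?_ ?_
  · rintro s ⟨_, h, _⟩
    rw [h]; simp
  · rintro n s ⟨_, h, _⟩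
    rw [h]; positivity
  · rintro n s ⟨h1, h2, h3, h4, h5, h6, h7⟩
    have hn : n < w.length := by omega
    have hd : w.drop n = w[n] :: w.drop (n + 1) := List.drop_eq_getElem_cons hn
    have hsz : w[n].size ≤ B := by
      have : w[n].size + 1 ≤ B := by
        rw [← hB]
        exact List.le_sum_of_mem (List.mem_map.2 ⟨w[n], List.getElem_mem hn, rfl⟩)
      omega
    refine Runs.mono (T := 1 + (1 + (1 + (1 + (2 + ((B * 4 + 1) + (8 + 2))))))) ?_
      (by omega) fun _ h => h
    refine Runs.seq (Runs.const rfl) ?_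
    rintro _ rfl
    refine Runs.seq (Runs.sub rfl) ?_
    rintro _ rfl
    refine Runs.seq (Runs.load rfl) ?_
    rintro _ rfl
    refine Runs.seq (Runs.add rfl) ?_
    rintro _ rfl
    refine Runs.seq (Runs.copyReg (by omega) rfl) ?_
    rintro _ rfl
    refine Runs.seq (Runs.addSize _ w[n] B ?_ hsz) ?_
    · simp [State.setReg_reg, h2, h6 n hn]
    rintro s1 ⟨m1, o1, r1, k1⟩
    simp [State.setReg_reg] at m1 o1 r1 k1
    have e2 : s1.reg 2 = n := by rw [k1 2 (by omega) (by omega) (by omega)]; simp [h2]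
    have e0 : s1.reg 0 = s.reg 0 := by rw [k1 0 (by omega) (by omega) (by omega)]; simp
    have e3 : s1.reg 3 = s.reg 3 := by rw [k1 3 (by omega) (by omega) (by omega)]; simp
    have e5 : s1.reg 5 = w[n] := by
      rw [k1 5 (by omega) (by omega) (by omega)]; simp [h2, h6 n hn]
    refine Runs.seq (Runs.allocPair (Q := fun s' => s'.reg 0 = s1.reg 0 + 2 ∧
      s'.reg 7 = s1.reg 0 ∧ (∀ w, w ≠ 0 → w ≠ 7 → w ≠ 4 → s'.reg w = s1.reg w) ∧
      s'.mem (s1.reg 0) = s1.reg 5 ∧ s'.mem (s1.reg 0 + 1) = s1.reg 3 ∧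
      (∀ a, a ≠ s1.reg 0 → a ≠ s1.reg 0 + 1 → s'.mem a = s1.mem a) ∧ s'.out = s1.out)
      (by omega) (by omega) (by omega) (by omega) fun s' a b c d e f g =>
        ⟨a, b, c, d, e, f, g⟩) ?_
    rintro s2 ⟨a1, a2, a3, a4, a5, a6, a7⟩
    refine Runs.copyReg (by omega) ⟨by omega, ?_, ?_, ?_, ?_, ?_, ?_⟩
    · rw [State.setReg_ne _ _ (by omega), a3 2 (by omega) (by omega) (by omega), e2]
    · rw [State.setReg_ne _ _ (by omega), a3 1 (by omega) (by omega) (by omega), r1, h3, hd]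
      simp only [List.map_cons, List.sum_cons]
      push_cast; ring
    · rw [State.setReg_same, a2, hd, State.setReg_ne _ _ (by omega), State.setReg_mem, e0]
      refine ⟨by omega, by omega, ?_, ?_⟩
      · rw [← e0, a4, e5]; rfl
      · rw [← e0, a5, e3]
        refine Rep.mono (fun z hz => ?_) (by omega) h4
        rw [a6 z (by omega) (by omega), m1]
    · rw [State.setReg_ne _ _ (by omega)]; omega
    · intro i hi
      rw [State.setReg_mem, a6 _ (by omega) (by omega), m1, h6 i hi]
    · rw [State.setReg_out, a7, o1, h7]
  · refine ⟨le_rfl, ?_, ?_, ?_, ?_, ?_, rfl⟩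
    · simp [State.setReg_reg, initial]
    · simp [State.setReg_reg]
    · simp [State.setReg_reg]; rfl
    · simp [State.setReg_reg, initial]
    · intro i hi
      simp [initial, hi]

theorem Runs.writeOutput (l : List ℕ) (B : ℕ) (s : State)
    (h : Rep.rep B s.mem (s.reg 0) l (s.reg 2)) :
    Runs RAM.writeOutput s (l.length * 6 + 1) fun s' => s'.out = s.out ++ l.map Nat.cast := by
  let I : ℕ → State → Prop := fun n s' => ∃ l' : List ℕ, l'.length = n ∧
    Rep.rep B s'.mem (s'.reg 0) l' (s'.reg 2) ∧ s'.out ++ l'.map Nat.cast = s.out ++ l.map Nat.cast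
  refine (Runs.loop (I := I) (T := 5) l.length ?_ ?_ ?_ ⟨l, rfl, h, rfl⟩).mono le_rfl ?_
  · rintro s ⟨l', h1, h2, h3⟩
    obtain rfl := List.length_eq_zero_iff.1 h1
    exact le_of_eq h2
  · rintro n s ⟨l', h1, h2, h3⟩
    cases l' with
    | nil => simp at h1
    | cons a l' => exact h2.1
  · rintro n s ⟨l', h1, h2, h3⟩
    cases l' with
    | nil => simp at h1
    | cons a l' =>
    obtain ⟨h4, h5, h6, h7⟩ := h2
    have h6' : s.mem (s.reg 2) = a := h6
    refine Runs.seq (T := 1) (T' := 4) (Runs.load rfl) ?_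
    rintro _ rfl
    refine Runs.seq (T := 1) (T' := 3) (Runs.write rfl) ?_
    rintro _ rfl
    refine Runs.loadSnd (by omega) fun v => ⟨l', by simpa using h1, ?_, ?_⟩
    · simp [State.setReg_reg]
      exact h7
    · rw [← h3]
      simp [State.setReg_reg, h6']
  · rintro s' ⟨l', h1, h2, h3⟩
    obtain rfl := List.length_eq_zero_iff.1 h1
    simpa using h3

/-- The size of the input serves as the global bound. The hypothesis on the length of the result
pays for writing it out, which `FP` does not cover. -/
theorem polyTimeSolvable_of_FP {ι : Type} {encode : ι → List ℤ} {valid : ι → Prop}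
    {solution : ι → List ℤ → Prop} {f : Bd × List ℕ → List ℕ} (hf : FP f)
    (h : ∀ i, valid i → ∃ w : List ℕ, w ≠ [] ∧ encode i = w.map Nat.cast ∧
      (f (⟨bitLength (encode i)⟩, w)).length ≤ bitLength (encode i) ∧
      solution i ((f (⟨bitLength (encode i)⟩, w)).map Nat.cast)) :
    PolyTimeSolvable encode valid solution := by
  obtain ⟨c, q, hc⟩ := hf 2 le_rfl
  -- Any integer represents the bound, so register 3 may also serve as the first component of the
  -- argument pair.
  refine ⟨.seq readInput <| .seq (allocPair 2 3 3 4) <| .seq c writeOutput,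
    (Polynomial.X * (Polynomial.X * 4 + 20) + 10) + (8 + (q + (Polynomial.X * 6 + 1))),
    fun i hi => ?_⟩
  obtain ⟨w, hw, he, hl, hs⟩ := h i hi
  set B := bitLength (encode i) with hB
  have key : Runs (.seq readInput <| .seq (allocPair 2 3 3 4) <| .seq c writeOutput)
      (initial (w.map Nat.cast)) ((B * (B * 4 + 20) + 10) + (8 + (q.eval B + (B * 6 + 1))))
      fun s => s.out = (f (⟨B⟩, w)).map Nat.cast := by
    refine Runs.seq (Runs.readInput w hw B (by rw [hB, he])) ?_
    rintro s1 ⟨a1, a2, a3, a4⟩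
    refine Runs.seq (Q := fun s2 => s2.reg 1 = B ∧ 0 < s2.reg 0 ∧
      Rep.rep B s2.mem (s2.reg 0) ((⟨B⟩, w) : Bd × List ℕ) (s2.reg 2) ∧ s2.out = [])
      (Runs.allocPair (by omega) (by omega) (by omega) (by omega) ?_) ?_
    · intro s2 b1 b2 b3 b4 b5 b6 b7
      refine ⟨by rw [b3 1 (by omega) (by omega) (by omega), a1], by omega, ?_, by rw [b7, a4]⟩
      rw [b2]
      refine ⟨a2, by omega, rfl, ?_⟩
      rw [b5]
      exact Rep.mono (fun z hz => b6 z (by omega) (by omega)) (by omega) a3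
    rintro s2 ⟨b1, b2, b3, b4⟩
    refine Runs.seq (hc B s2 _ b1 b2 b3) ?_
    rintro s3 ⟨c1, c2⟩
    refine (Runs.writeOutput _ B s3 c2).mono (by omega) ?_
    intro s4 h4
    rw [h4, c1.out, b4, List.nil_append]
  obtain ⟨t, s, e, ht, ho⟩ := key
  refine ⟨t, _, ⟨s, he ▸ e, ho⟩, ?_, hs⟩
  simpa using ht

end RAM

namespace RAM

variable {α β γ σ : Type} [Rep α] [Rep β] [Rep γ] [Rep σ]

/-! ### Booleans and numbers -/

@[fun_prop] theorem FP.decide_true {p : α → Bool} (hp : FP p) : FP fun a => decide (p a = true) :=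
  hp.congr fun a => by simp

@[fun_prop] theorem FP.decide_not {p : α → Prop} [∀ a, Decidable (p a)]
    (hp : FP fun a => decide (p a)) : FP fun a => decide (¬ p a) :=
  (FP.ite_bool hp (FP.const false) (FP.const true)).congr fun a => by
    by_cases h : p a <;> simp [h]

@[fun_prop] theorem FP.decide_and {p q : α → Prop} [∀ a, Decidable (p a)] [∀ a, Decidable (q a)]
    (hp : FP fun a => decide (p a)) (hq : FP fun a => decide (q a)) :
    FP fun a => decide (p a ∧ q a) :=
  (FP.ite_bool hp hq (FP.const false)).congr fun a => by
    by_cases h : p a <;> simp [h]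

@[fun_prop] theorem FP.decide_lt_int {f g : α → ℤ} (hf : FP f) (hg : FP g) :
    FP fun a => decide (f a < g a) :=
  (FP.comp FP.pos (hg.sub_int hf)).congr fun a => by simp

@[fun_prop] theorem FP.decide_lt {f g : α → ℕ} (hf : FP f) (hg : FP g) :
    FP fun a => decide (f a < g a) :=
  (FP.decide_lt_int hf.natCast hg.natCast).congr fun a => by simp

@[fun_prop] theorem FP.decide_eq {f g : α → ℕ} (hf : FP f) (hg : FP g) :
    FP fun a => decide (f a = g a) :=
  ((hf.decide_lt hg).decide_not.decide_and (hg.decide_lt hf).decide_not).congr fun a => by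
    simp only [decide_eq_decide]; omega

@[fun_prop] theorem FP.decide_eq_prod {f g : α → ℕ × ℕ} (hf : FP f) (hg : FP g) :
    FP fun a => decide (f a = g a) :=
  ((hf.fst.decide_eq hg.fst).decide_and (hf.snd.decide_eq hg.snd)).congr fun a => by
    simp only [decide_eq_decide]; exact Prod.ext_iff.symm

@[fun_prop] theorem FP.add {f g : α → ℕ} (hf : FP f) (hg : FP g) : FP fun a => f a + g a :=
  FP.of_natCast ((hf.natCast.add_int hg.natCast).congr fun a => by simp)

@[fun_prop] theorem FP.half {f : α → ℕ} (hf : FP f) : FP fun a => f a / 2 :=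
  FP.of_natCast (hf.natCast.half_int.congr fun a => by simp)

@[fun_prop] theorem FP.sub {f g : α → ℕ} (hf : FP f) (hg : FP g) : FP fun a => f a - g a :=
  FP.of_natCast ((FP.ite (hf.decide_lt hg) (FP.const 0) (hf.natCast.sub_int hg.natCast)).congr
    fun a => by split <;> omega)

/-! ### Bounded loops over lists -/

/-- The part of a list that the loops can handle. -/
def Bd.cut {α : Type} (b : Bd) (l : List α) : List α := l.take b.n

theorem Bd.cut_eq {α : Type} {b : Bd} {l : List α} (h : l.length ≤ b.n) : b.cut l = l :=
  List.take_of_length_le h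

-- Iterate on the pair of the remaining list and the accumulator. A round with empty remainder
-- changes nothing, so B rounds fold exactly the first `b.n` entries.
@[fun_prop] theorem FP.foldl {b : α → Bd} {h : α → σ → β → σ} {g : α → σ} {l : α → List β}
    (hb : FP b) (hh : FP fun x : α × σ × β => h x.1 x.2.1 x.2.2) (hg : FP g) (hl : FP l) :
    FP fun a => ((b a).cut (l a)).foldl (h a) (g a) := by
  have key : FP fun a => ((fun s : List β × σ => if s.1.isEmpty = true then s else
      (s.1.tail, (s.1.take 1).foldl (h a) s.2))^[(b a).n] (l a, g a)).2 := by
    refine FP.snd (FP.iterate hb ?_ (hl.prodMk hg))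
    refine FP.ite_bool (by fun_prop) (by fun_prop) ?_
    refine FP.prodMk (by fun_prop) ?_
    have h1 : FP fun x : α × List β × σ => (x.1, x.2.2, x.2.1) := by fun_prop
    -- Folding over `take 1` applies `h` to the head without needing a default entry. This is
    -- compiled by hand: test the list, load its head, assemble the argument (a, t, y) and run the
    -- program for `h`.
    refine FP.comp (f := fun x : α × σ × List β => (x.2.2.take 1).foldl (h x.1) x.2.1) ?_ h1
    intro d hd
    obtain ⟨c, q, hc⟩ := hh d hd
    obtain ⟨c', q', hc'⟩ := FP.fst (FP.snd (FP.id (α := α × σ × List β))) d hd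
    obtain ⟨ct, qt, hct⟩ := FP.snd (FP.snd (FP.id (α := α × σ × List β))) (d + 1) (by omega)
    obtain ⟨ca, qa, hca⟩ := FP.fst (FP.id (α := α × σ × List β)) (d + 2) (by omega)
    obtain ⟨cs, qs, hcs⟩ := FP.fst (FP.snd (FP.id (α := α × σ × List β))) (d + 3) (by omega)
    refine ⟨.seq (copyReg (d + 1) d) <| .seq ct <| .cond (d + 1)
      (.seq (copyReg (d + 2) d) <| .seq ca <| .seq (copyReg (d + 3) d) <| .seq cs <|
        .seq (.load (d + 4) (d + 1)) <| .seq (allocPair (d + 5) (d + 3) (d + 4) (d + 6)) <|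
        .seq (allocPair d (d + 2) (d + 5) (d + 6)) c) c',
      2 + (qt + ((2 + (qa + (2 + (qs + (1 + (8 + (8 + q))))))) + q' + 1)),
      fun B s x h1 h0 hx => ?_⟩
    obtain ⟨a, t, l⟩ := x
    simp only [Polynomial.eval_add, Polynomial.eval_ofNat, Polynomial.eval_one]
    refine (Runs.copyReg (by omega) rfl).seq ?_
    rintro s1 rfl
    have f1 := (Frame.refl (d + 1) s).setReg (x := d + 1) (by omega) (by omega) (s.reg d)
    have e1' : (s.setReg (d + 1) (s.reg d)).reg (d + 1) = s.reg d := State.setReg_same ..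
    refine (hct B _ _ (by rw [f1.reg 1 le_rfl (by omega), h1]) (lt_of_lt_of_le h0 f1.le)
      (by rw [e1']; exact f1.rep hx)).seq ?_
    rintro s2 ⟨f2, v2⟩
    have f02 := f1.trans f2 (by omega)
    have h02 : 0 < s2.reg 0 := lt_of_lt_of_le h0 f02.le
    refine Runs.cond (fun hp => ?_) fun hp => ?_
    · cases l with
      | nil => have : s2.reg (d + 1) = 0 := v2
               omega
      | cons y l =>
      obtain ⟨w1, w2, w3, w4⟩ := v2
      refine Runs.mono (Q := _) (T := (2 + (qa.eval B + (2 + (qs.eval B +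
        (1 + (8 + (8 + q.eval B)))))))) ?_ (by omega) fun _ h => h
      refine (Runs.copyReg (by omega) rfl).seq ?_
      rintro s3 rfl
      have f3 := (Frame.refl (d + 2) s2).setReg (x := d + 2) (by omega) (by omega) (s2.reg d)
      have e3 : (s2.setReg (d + 2) (s2.reg d)).reg (d + 2) = s.reg d := by
        rw [State.setReg_same, f02.reg d (by omega) (by omega)]
      have f03 := f02.trans f3 (by omega)
      refine (hca B _ (a, t, y :: l) (by rw [f03.reg 1 le_rfl (by omega), h1])
        (lt_of_lt_of_le h0 f03.le) (by rw [e3]; exact f03.rep hx)).seq ?_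
      rintro s4 ⟨f4, v4⟩
      have f04 := f03.trans f4 (by omega)
      refine (Runs.copyReg (by omega) rfl).seq ?_
      rintro s5 rfl
      have f5 := (Frame.refl (d + 3) s4).setReg (x := d + 3) (by omega) (by omega) (s4.reg d)
      have e5 : (s4.setReg (d + 3) (s4.reg d)).reg (d + 3) = s.reg d := by
        rw [State.setReg_same, f04.reg d (by omega) (by omega)]
      have f05 := f04.trans f5 (by omega)
      refine (hcs B _ (a, t, y :: l) (by rw [f05.reg 1 le_rfl (by omega), h1])
        (lt_of_lt_of_le h0 f05.le) (by rw [e5]; exact f05.rep hx)).seq ?_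
      rintro s6 ⟨f6, v6⟩
      refine (Runs.load rfl).seq ?_
      rintro s7 rfl
      have f7 := (Frame.refl (d + 4) s6).setReg (x := d + 4) (by omega) (by omega)
        (s6.mem (s6.reg (d + 1)))
      have f67 := f6.trans f7 (by omega)
      have f47 := f5.trans f67 (by omega)
      have f27 := (f3.trans f4 (by omega)).trans f47 (by omega)
      have f07 := f02.trans f27 (by omega)
      have h07 := lt_of_lt_of_le h0 f07.le
      have e6 : s6.reg (d + 1) = s2.reg (d + 1) := by
        rw [← f27.reg (d + 1) (by omega) (by omega), State.setReg_ne _ _ (by omega)]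
      have v7 : Rep.rep B (s6.setReg (d + 4) (s6.mem (s6.reg (d + 1)))).mem
          ((s6.setReg (d + 4) (s6.mem (s6.reg (d + 1)))).reg 0) y
          ((s6.setReg (d + 4) (s6.mem (s6.reg (d + 1)))).reg (d + 4)) := by
        rw [State.setReg_same, e6, show s6.mem (s2.reg (d + 1)) = s2.mem (s2.reg (d + 1)) from
          f27.mem _ (by omega)]
        exact f27.rep w3
      have v6' := f7.rep v6
      rw [← f7.reg (d + 3) (by omega) (by omega)] at v6'
      have v4' := f47.rep v4
      rw [← f47.reg (d + 2) (by omega) (by omega)] at v4'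
      generalize s6.setReg (d + 4) (s6.mem (s6.reg (d + 1))) = s7 at *
      refine Runs.seq (Q := fun s8 => Frame (d + 3) s7 s8 ∧
        Rep.rep B s8.mem (s8.reg 0) (t, y) (s8.reg (d + 5))) (Runs.allocPair (by omega) (by omega)
          (by omega) (by omega) ?_) ?_
      · intro s8 k1 k2 k3 k4 k5 k6 k7
        have f8 : Frame (d + 3) s7 s8 :=
          ⟨fun x hx hxd => k3 x (by omega) (by omega) (by omega),
            fun z hz => k6 z (by omega) (by omega), by omega, k7⟩
        refine ⟨f8, ?_⟩
        rw [k2]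
        refine ⟨h07, by omega, ?_, ?_⟩
        · rw [k4]; exact f8.rep v6'
        · rw [k5]; exact f8.rep v7
      rintro s8 ⟨f8, v8⟩
      have v4'' := f8.rep v4'
      rw [← f8.reg (d + 2) (by omega) (by omega)] at v4''
      have f08 := f07.trans f8 (by omega)
      have h08 := lt_of_lt_of_le h0 f08.le
      refine Runs.seq (Q := fun s9 => Frame d s8 s9 ∧
        Rep.rep B s9.mem (s9.reg 0) (a, t, y) (s9.reg d)) (Runs.allocPair (by omega) (by omega)
          (by omega) (by omega) ?_) ?_
      · intro s9 k1 k2 k3 k4 k5 k6 k7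
        have f9 : Frame d s8 s9 :=
          ⟨fun x hx hxd => k3 x (by omega) (by omega) (by omega),
            fun z hz => k6 z (by omega) (by omega), by omega, k7⟩
        refine ⟨f9, ?_⟩
        rw [k2]
        refine ⟨h08, by omega, ?_, ?_⟩
        · rw [k4]; exact f9.rep v4''
        · rw [k5]; exact f9.rep v8
      rintro s9 ⟨f9, v9⟩
      have f09 : Frame d s s9 := (Frame.trans
        ⟨fun x hx hxd => f08.reg x hx (by omega), f08.mem, f08.le, f08.out⟩ f9 le_rfl)
      refine (hc B s9 (a, t, y) (by rw [f09.reg 1 le_rfl (by omega), h1])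
        (lt_of_lt_of_le h0 f09.le) v9).mono le_rfl ?_
      rintro s' ⟨f', v'⟩
      exact ⟨f09.trans f' le_rfl, v'⟩
    · have f02' : Frame d s s2 := ⟨fun x hx hxd => f02.reg x hx (by omega), f02.mem, f02.le, f02.out⟩
      refine (hc' B s2 (a, t, l) (by rw [f02.reg 1 le_rfl (by omega), h1]) h02
        (by rw [f02.reg d (by omega) (by omega)]; exact f02.rep hx)).mono (by omega) ?_
      rintro s' ⟨f', v'⟩
      refine ⟨f02'.trans f' le_rfl, ?_⟩
      cases l with
      | nil => exact v'
      | cons y l => have := v2.1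
                    omega
  refine key.congr fun a => ?_
  suffices H : ∀ (n : ℕ) (l : List β) (t : σ), ((fun s : List β × σ => if s.1.isEmpty = true then s
      else (s.1.tail, (s.1.take 1).foldl (h a) s.2))^[n] (l, t)).2 = (l.take n).foldl (h a) t from
    H ..
  intro n
  induction n with
  | zero => simp
  | succ n ih =>
    intro l t
    rw [Function.iterate_succ_apply]
    cases l with
    | nil => simpa using ih [] t
    | cons y l => simpa using ih l (h a t y)

theorem Bd.cut_reverse_cut {α : Type} {b : Bd} {l : List α} :
    b.cut (b.cut l).reverse = (b.cut l).reverse :=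
  Bd.cut_eq (by simp [Bd.cut])

@[fun_prop] theorem FP.reverse {b : α → Bd} {l : α → List β} (hb : FP b) (hl : FP l) :
    FP fun a => ((b a).cut (l a)).reverse :=
  (FP.foldl (h := fun a s x => x :: s) (g := fun _ => []) hb (by fun_prop)
    (FP.of_const 0 fun _ _ _ => rfl) hl).congr fun a => by
      rw [← List.foldr_reverse, List.foldr_cons_nil]

-- A left fold over the reversed list; the list is truncated before it is reversed, so the second
-- truncation is void.
@[fun_prop] theorem FP.foldr {b : α → Bd} {h : α → β → σ → σ} {g : α → σ} {l : α → List β}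
    (hb : FP b) (hh : FP fun x : α × β × σ => h x.1 x.2.1 x.2.2) (hg : FP g) (hl : FP l) :
    FP fun a => ((b a).cut (l a)).foldr (h a) (g a) :=
  (FP.foldl (h := fun a s x => h a x s) hb
    (FP.comp (f := fun x : α × β × σ => h x.1 x.2.1 x.2.2)
      (g := fun x : α × σ × β => (x.1, x.2.2, x.2.1)) hh (by fun_prop)) hg
    (FP.reverse hb hl)).congr fun a => by
      rw [Bd.cut_reverse_cut, List.foldl_reverse]

@[fun_prop] theorem FP.nil : FP fun _ : α => ([] : List β) := FP.of_const 0 fun _ _ _ => rfl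

@[fun_prop] theorem FP.cut {b : α → Bd} {l : α → List β} (hb : FP b) (hl : FP l) :
    FP fun a => (b a).cut (l a) :=
  (FP.foldr (h := fun a x s => x :: s) (g := fun _ => []) hb (by fun_prop) (by fun_prop)
    hl).congr fun a => by simp

@[fun_prop] theorem FP.map {b : α → Bd} {h : α → β → γ} {l : α → List β}
    (hb : FP b) (hh : FP fun x : α × β => h x.1 x.2) (hl : FP l) :
    FP fun a => ((b a).cut (l a)).map (h a) :=
  (FP.foldr (h := fun a x s => h a x :: s) (g := fun _ => []) hb (FP.cons (FP.comp
    (f := fun x : α × β => h x.1 x.2) (g := fun x : α × β × List γ => (x.1, x.2.1)) hh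
    (by fun_prop)) (by fun_prop)) (by fun_prop) hl).congr fun a => by
      rw [List.map_eq_foldr]

@[fun_prop] theorem FP.filter {b : α → Bd} {p : α → β → Bool} {l : α → List β}
    (hb : FP b) (hp : FP fun x : α × β => p x.1 x.2) (hl : FP l) :
    FP fun a => ((b a).cut (l a)).filter (p a) :=
  (FP.foldr (h := fun a x s => if p a x = true then x :: s else s) (g := fun _ => []) hb
    (FP.ite_bool (FP.comp (f := fun x : α × β => p x.1 x.2)
      (g := fun x : α × β × List β => (x.1, x.2.1)) hp (by fun_prop)) (by fun_prop)
      (by fun_prop)) (by fun_prop) hl).congr fun a => by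
      induction (b a).cut (l a) with
      | nil => rfl
      | cons x l ih => rw [List.foldr_cons, ih, List.filter_cons]

@[fun_prop] theorem FP.append {b : α → Bd} {l m : α → List β} (hb : FP b) (hl : FP l)
    (hm : FP m) : FP fun a => (b a).cut (l a) ++ m a :=
  (FP.foldr (h := fun a x s => x :: s) hb (by fun_prop) hm hl).congr fun a => by simp

-- Appending copies the left operand in a bounded loop, whence the truncation of every piece.
@[fun_prop] theorem FP.flatMap {b : α → Bd} {h : α → β → List γ} {l : α → List β}
    (hb : FP b) (hh : FP fun x : α × β => h x.1 x.2) (hl : FP l) :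
    FP fun a => ((b a).cut (l a)).flatMap fun x => (b a).cut (h a x) :=
  (FP.foldr (h := fun a x s => (b a).cut (h a x) ++ s) (g := fun _ => []) hb (FP.append
    (b := fun x : α × β × List γ => b x.1) (by fun_prop) (FP.comp
    (f := fun x : α × β => h x.1 x.2) (g := fun x : α × β × List γ => (x.1, x.2.1)) hh
    (by fun_prop)) (by fun_prop)) (by fun_prop) hl).congr fun a => by
      induction (b a).cut (l a) with
      | nil => rfl
      | cons x l ih => rw [List.foldr_cons, ih, List.flatMap_cons]

@[fun_prop] theorem FP.any {b : α → Bd} {p : α → β → Bool} {l : α → List β}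
    (hb : FP b) (hp : FP fun x : α × β => p x.1 x.2) (hl : FP l) :
    FP fun a => ((b a).cut (l a)).any (p a) :=
  (FP.ite_bool (FP.isEmpty (FP.filter hb hp hl)) (FP.const false) (FP.const true)).congr
    fun a => by
      rw [Bool.eq_iff_iff]
      simp [List.any_eq_true]

@[fun_prop] theorem FP.all {b : α → Bd} {p : α → β → Bool} {l : α → List β}
    (hb : FP b) (hp : FP fun x : α × β => p x.1 x.2) (hl : FP l) :
    FP fun a => ((b a).cut (l a)).all (p a) := by
  refine (FP.ite_bool (FP.any hb (p := fun a x => decide (¬ p a x = true)) ?_ hl)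
    (FP.const false) (FP.const true)).congr fun a => ?_
  · fun_prop
  · rw [Bool.eq_iff_iff]
    simp [List.any_eq_true]

/-! ### Further list operations with bounded loops -/

@[fun_prop] theorem FP.count {b : α → Bd} {e : α → ℕ × ℕ} {l : α → List (ℕ × ℕ)} (hb : FP b)
    (he : FP e) (hl : FP l) : FP fun a => ((b a).cut (l a)).count (e a) :=
  (FP.foldr (h := fun a x s => if x = e a then s + 1 else s) (g := fun _ => 0) hb (by fun_prop)
    (by fun_prop) hl).congr fun a => by
      induction (b a).cut (l a) with
      | nil => rfl
      | cons x l ih => simp only [List.foldr_cons, ih, List.count_cons, beq_iff_eq]; split <;> rfl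

@[fun_prop] theorem FP.sum {b : α → Bd} {l : α → List ℕ} (hb : FP b)
    (hl : FP l) : FP fun a => ((b a).cut (l a)).sum :=
  (FP.foldr (h := fun a x s => x + s) (g := fun _ => 0) hb (by fun_prop)
    (by fun_prop) hl).congr fun a => rfl

/-- `l.drop m`, for `m ≤ b.n`. -/
def Bd.drop {α : Type} (b : Bd) (m : ℕ) (l : List α) : List α :=
  ((fun s : ℕ × List α => if 0 < s.1 then (s.1 - 1, s.2.tail) else s)^[b.n] (m, l)).2

theorem Bd.drop_eq {α : Type} {b : Bd} {m : ℕ} {l : List α} (h : m ≤ b.n) :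
    b.drop m l = l.drop m := by
  have H : ∀ (n m : ℕ) (l : List α), m ≤ n → ((fun s : ℕ × List α =>
      if 0 < s.1 then (s.1 - 1, s.2.tail) else s)^[n] (m, l)).2 = l.drop m := by
    intro n
    induction n with
    | zero => intro m l h; obtain rfl := Nat.le_zero.1 h; rfl
    | succ n ih =>
      intro m l h
      rw [Function.iterate_succ_apply]
      cases m with
      | zero => simpa using ih 0 l (by omega)
      | succ m => simpa using ih m l.tail (by omega)
  exact H _ _ _ h

@[fun_prop] theorem FP.drop {b : α → Bd} {m : α → ℕ} {l : α → List β} (hb : FP b) (hm : FP m)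
    (hl : FP l) : FP fun a => (b a).drop (m a) (l a) := by
  unfold Bd.drop
  fun_prop

/-- `l.take m`, for `m ≤ b.n`. -/
def Bd.take {α : Type} (b : Bd) (m : ℕ) (l : List α) : List α :=
  b.cut ((b.cut l).foldl (fun s x => if 0 < s.1 then (s.1 - 1, x :: s.2) else s)
    (m, ([] : List α))).2 |>.reverse

theorem Bd.take_eq {α : Type} {b : Bd} {m : ℕ} {l : List α} (h : m ≤ b.n) :
    b.take m l = l.take m := by
  have H : ∀ (l : List α) (m : ℕ) (r : List α), (l.foldl (fun s x =>
      if 0 < s.1 then (s.1 - 1, x :: s.2) else s) (m, r)).2 = (l.take m).reverse ++ r := by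
    intro l
    induction l with
    | nil => simp
    | cons x l ih =>
      intro m r
      cases m with
      | zero => simpa using ih 0 r
      | succ m => simpa using ih m (x :: r)
  rw [Bd.take, H, List.append_nil, Bd.cut_eq (by simp; omega), List.reverse_reverse, Bd.cut,
    List.take_take, min_eq_left h]

@[fun_prop] theorem FP.take {b : α → Bd} {m : α → ℕ} {l : α → List β} (hb : FP b) (hm : FP m)
    (hl : FP l) : FP fun a => (b a).take (m a) (l a) := by
  unfold Bd.take
  fun_prop

/-- `List.range m`, for `m ≤ b.n`. -/
def Bd.range (b : Bd) (m : ℕ) : List ℕ :=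
  ((fun s : ℕ × List ℕ => if 0 < s.1 then (s.1 - 1, (s.1 - 1) :: s.2) else s)^[b.n] (m, [])).2

theorem Bd.range_eq {b : Bd} {m : ℕ} (h : m ≤ b.n) : b.range m = List.range m := by
  have H : ∀ (n m : ℕ) (l : List ℕ), m ≤ n → ((fun s : ℕ × List ℕ =>
      if 0 < s.1 then (s.1 - 1, (s.1 - 1) :: s.2) else s)^[n] (m, l)).2 = List.range m ++ l := by
    intro n
    induction n with
    | zero => intro m l h; obtain rfl := Nat.le_zero.1 h; rfl
    | succ n ih =>
      intro m l h
      rw [Function.iterate_succ_apply]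
      cases m with
      | zero => simpa using ih 0 l (by omega)
      | succ m => simpa [List.range_succ] using ih m (m :: l) (by omega)
  exact (H _ _ [] h).trans (List.append_nil _)

@[fun_prop] theorem FP.range {b : α → Bd} {m : α → ℕ} (hb : FP b) (hm : FP m) :
    FP fun a => (b a).range (m a) := by
  unfold Bd.range
  fun_prop

/-- The product, if `y < 2 ^ b.n`. -/
def Bd.mul (b : Bd) (x y : ℕ) : ℕ :=
  ((fun s : ℕ × ℕ × ℕ => (if s.2.2 = s.2.2 / 2 + s.2.2 / 2 then s.1 else s.1 + s.2.1,
    s.2.1 + s.2.1, s.2.2 / 2))^[b.n] (0, x, y)).1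

/-- Multiplication by doubling and halving. Each round preserves the accumulator plus the product of
the two factors; the condition in the definition tests whether the second factor is even. Only this
factor must vanish after `b.n` halvings, so the first may be arbitrarily large. -/
theorem Bd.mul_eq {b : Bd} {x y : ℕ} (h : y < 2 ^ b.n) : b.mul x y = x * y := by
  have H : ∀ (n x y z : ℕ), y < 2 ^ n → ((fun s : ℕ × ℕ × ℕ =>
      (if s.2.2 = s.2.2 / 2 + s.2.2 / 2 then s.1 else s.1 + s.2.1,
      s.2.1 + s.2.1, s.2.2 / 2))^[n] (z, x, y)).1 = z + x * y := by
    intro n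
    induction n with
    | zero => intro x y z h; simp at h; simp [h]
    | succ n ih =>
      intro x y z h
      rw [Function.iterate_succ_apply, ih _ _ _ (by dsimp only; rw [pow_succ] at h; omega)]
      rcases Nat.even_or_odd' y with ⟨c, rfl | rfl⟩
      · rw [if_pos (by dsimp only; omega), Nat.mul_div_cancel_left _ (by omega)]
        ring
      · rw [if_neg (by dsimp only; omega), show (2 * c + 1) / 2 = c by omega]
        ring
  exact (H _ x y 0 h).trans (Nat.zero_add _)

@[fun_prop] theorem FP.mul {b : α → Bd} {f g : α → ℕ} (hb : FP b) (hf : FP f) (hg : FP g) :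
    FP fun a => (b a).mul (f a) (g a) := by
  unfold Bd.mul
  fun_prop

/-- Element at a position. -/
def Bd.getD {α : Type} (b : Bd) (l : List α) (m : ℕ) (d : α) : α := (b.drop m l).headD d

theorem Bd.getD_eq {α : Type} {b : Bd} {l : List α} {m : ℕ} {d : α} (h : m ≤ b.n) :
    b.getD l m d = l.getD m d := by
  rw [Bd.getD, Bd.drop_eq h, List.getD_eq_getElem?_getD, List.headD_eq_head?_getD, List.head?_drop]

@[fun_prop] theorem FP.getD {b : α → Bd} {m : α → ℕ} {l : α → List β} {d : α → β} (hb : FP b)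
    (hl : FP l) (hm : FP m) (hd : FP d) : FP fun a => (b a).getD (l a) (m a) (d a) := by
  unfold Bd.getD
  fun_prop

/-- Value of an association list, `0` by default. -/
def lookup (M : List (ℕ × ℕ)) (x : ℕ) : ℕ := ((M.filter fun e => e.1 = x).headD (0, 0)).2

@[fun_prop] theorem FP.lookup {b : α → Bd} {M : α → List (ℕ × ℕ)} {x : α → ℕ} (hb : FP b)
    (hM : FP M) (hx : FP x) : FP fun a => lookup ((b a).cut (M a)) (x a) := by
  unfold RAM.lookup
  fun_prop

/-- The pairs of consecutive elements, in order. -/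
def pairs : List ℕ → List (ℕ × ℕ) := fun l => l.zip l.tail

@[fun_prop] theorem FP.pairs {b : α → Bd} {l : α → List ℕ} (hb : FP b) (hl : FP l) :
    FP fun a => pairs ((b a).cut (l a)) := by
  -- The first component of the accumulator rebuilds the suffix already processed; its head is the
  -- successor of the current entry.
  refine (FP.snd (FP.foldr (h := fun a x s => (x :: s.1, if s.1.isEmpty = true then s.2 else
    (x, s.1.headD 0) :: s.2)) (g := fun _ => (([] : List ℕ), ([] : List (ℕ × ℕ)))) hb (by fun_prop)
    (by fun_prop) hl)).congr fun a => ?_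
  suffices H : ∀ l : List ℕ, (l.foldr (fun x s => (x :: s.1, if s.1.isEmpty = true then s.2 else
      (x, s.1.headD 0) :: s.2)) (([] : List ℕ), ([] : List (ℕ × ℕ)))) = (l, RAM.pairs l) by
    rw [H]
  intro l
  induction l with
  | nil => rfl
  | cons x l ih =>
    rw [List.foldr_cons, ih]
    cases l <;> simp [RAM.pairs]

end RAM

/-! ### The Hungarian method -/

namespace Hungarian

open RAM

/-- An entry of smallest value. -/
def argmin (l : List (ℕ × ℕ × ℤ)) : ℕ × ℕ × ℤ :=
  l.foldr (fun x m => if x.2.2 < m.2.2 then x else m) (l.headD (0, 0, 0))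

theorem foldr_min_spec (l : List (ℕ × ℕ × ℤ)) (d : ℕ × ℕ × ℤ) :
    (l.foldr (fun x m => if x.2.2 < m.2.2 then x else m) d = d ∨
      l.foldr (fun x m => if x.2.2 < m.2.2 then x else m) d ∈ l) ∧
    (l.foldr (fun x m => if x.2.2 < m.2.2 then x else m) d).2.2 ≤ d.2.2 ∧
    ∀ x ∈ l, (l.foldr (fun x m => if x.2.2 < m.2.2 then x else m) d).2.2 ≤ x.2.2 := by
  induction l with
  | nil => simp
  | cons x l ih =>
    rw [List.foldr_cons]
    generalize l.foldr (fun x m => if x.2.2 < m.2.2 then x else m) d = m at ih ⊢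
    obtain ⟨h1, h2, h3⟩ := ih
    split
    · rename_i h
      refine ⟨.inr List.mem_cons_self, h.le.trans h2, fun y hy => ?_⟩
      rcases List.mem_cons.1 hy with rfl | hy
      · exact le_rfl
      · exact h.le.trans (h3 y hy)
    · rename_i h
      refine ⟨h1.imp_right (List.mem_cons_of_mem _), h2, fun y hy => ?_⟩
      rcases List.mem_cons.1 hy with rfl | hy
      · exact not_lt.1 h
      · exact h3 y hy

theorem argmin_spec {l : List (ℕ × ℕ × ℤ)} (hl : l ≠ []) :
    argmin l ∈ l ∧ ∀ x ∈ l, (argmin l).2.2 ≤ x.2.2 := by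
  obtain ⟨h1, -, h3⟩ := foldr_min_spec l (l.headD (0, 0, 0))
  refine ⟨?_, h3⟩
  rcases h1 with h1 | h1
  · rw [argmin, h1]
    cases l with
    | nil => exact absurd rfl hl
    | cons x l => exact List.mem_cons_self
  · exact h1

/-- Rows of the alternating tree. -/
def isKey (b : Bd) (T : List (ℕ × List (ℕ × ℕ))) (i : ℕ) : Bool :=
  (b.cut T).any fun e => decide (e.1 = i)

/-- Membership. -/
def isMem (b : Bd) (S : List ℕ) (j : ℕ) : Bool :=
  (b.cut S).any fun x => decide (x = j)

/-- The smallest entry in a row of the tree and a column outside. -/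
def pivot (b : Bd) (A : List (ℕ × ℕ × ℤ)) (T : List (ℕ × List (ℕ × ℕ))) (S : List ℕ) :
    ℕ × ℕ × ℤ :=
  argmin (b.cut ((b.cut A).filter fun e => decide (isKey b T e.1 = true ∧ ¬ isMem b S e.2.1 = true)))

/-- Subtract `δ` in the rows of the tree, add it in its columns. -/
def adjust (b : Bd) (A : List (ℕ × ℕ × ℤ)) (T : List (ℕ × List (ℕ × ℕ))) (S : List ℕ) (δ : ℤ) :
    List (ℕ × ℕ × ℤ) :=
  (b.cut A).map fun e => (e.1, e.2.1, e.2.2 - (if isKey b T e.1 = true then δ else 0) +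
    (if isMem b S e.2.1 = true then δ else 0))

/-- Extend the tree along the row `i` and the column `j`, or augment the matching. `M` is the
matching that leaves the row `i` free, and `Q` consists of its pairs in the column `j`. -/
def grow (b : Bd) (T : List (ℕ × List (ℕ × ℕ))) (S : List ℕ) (i j : ℕ) (M Q : List (ℕ × ℕ)) :
    List (ℕ × List (ℕ × ℕ)) × List ℕ × List (List (ℕ × ℕ)) :=
  if Q.isEmpty = true then (T, S, [(i, j) :: M]) else
    (((Q.headD (0, 0)).1, (i, j) :: (b.cut M).filter fun x => decide (¬ x.1 = (Q.headD (0, 0)).1))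
      :: T, j :: S, [])

/-- The matching stored in the tree that leaves the row `i` free. -/
def freeing (b : Bd) (T : List (ℕ × List (ℕ × ℕ))) (i : ℕ) : List (ℕ × ℕ) :=
  (((b.cut T).filter fun e => decide (e.1 = i)).headD (0, [])).2

/-- The state of a phase: the reduced costs, the rows of the tree together with a matching that
leaves the row free, the columns of the tree, and the augmented matching once it is found. -/
abbrev St : Type :=
  List (ℕ × ℕ × ℤ) × List (ℕ × List (ℕ × ℕ)) × List ℕ × List (List (ℕ × ℕ))

/-- Extend the tree with the pivot `e`. -/
def step' (b : Bd) (s : St) (e : ℕ × ℕ × ℤ) : St :=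
  (adjust b s.1 s.2.1 s.2.2.1 e.2.2, grow b s.2.1 s.2.2.1 e.1 e.2.1 (freeing b s.2.1 e.1)
    ((b.cut (freeing b s.2.1 e.1)).filter fun x => decide (x.2 = e.2.1)))

/-- One step of a phase. -/
def step (b : Bd) (s : St) : St :=
  if s.2.2.2.isEmpty = true then step' b s (pivot b s.1 s.2.1 s.2.2.1) else s

/-- Add the row `i` to the matching. -/
def phase (b : Bd) (s : List (ℕ × ℕ × ℤ) × List (ℕ × ℕ)) (i : ℕ) :
    List (ℕ × ℕ × ℤ) × List (ℕ × ℕ) :=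
  (fun t : St => (t.1, t.2.2.2.headD [])) ((step b)^[b.n] (s.1, [(i, s.2)], [], []))

/-- A matching of the rows of smallest cost. -/
def hung (b : Bd) (rows : List ℕ) (A : List (ℕ × ℕ × ℤ)) : List (ℕ × ℕ) :=
  ((b.cut rows).foldl (phase b) (A, [])).2

section

variable {α : Type} [Rep α] {b : α → Bd}

@[fun_prop] theorem fp_argmin {l : α → List (ℕ × ℕ × ℤ)} (hb : FP b) (hl : FP l) :
    FP fun a => argmin ((b a).cut (l a)) := by
  unfold argmin; fun_prop

@[fun_prop] theorem fp_isKey {T : α → List (ℕ × List (ℕ × ℕ))} {i : α → ℕ} (hb : FP b) (hT : FP T)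
    (hi : FP i) : FP fun a => isKey (b a) (T a) (i a) := by
  unfold isKey; fun_prop

@[fun_prop] theorem fp_isMem {S : α → List ℕ} {i : α → ℕ} (hb : FP b) (hS : FP S)
    (hi : FP i) : FP fun a => isMem (b a) (S a) (i a) := by
  unfold isMem; fun_prop

@[fun_prop] theorem fp_pivot {A : α → List (ℕ × ℕ × ℤ)} {T : α → List (ℕ × List (ℕ × ℕ))}
    {S : α → List ℕ} (hb : FP b) (hA : FP A) (hT : FP T) (hS : FP S) :
    FP fun a => pivot (b a) (A a) (T a) (S a) := by
  unfold pivot; fun_prop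

@[fun_prop] theorem fp_adjust {A : α → List (ℕ × ℕ × ℤ)} {T : α → List (ℕ × List (ℕ × ℕ))}
    {S : α → List ℕ} {δ : α → ℤ} (hb : FP b) (hA : FP A) (hT : FP T) (hS : FP S) (hδ : FP δ) :
    FP fun a => adjust (b a) (A a) (T a) (S a) (δ a) := by
  unfold adjust; fun_prop

@[fun_prop] theorem fp_freeing {T : α → List (ℕ × List (ℕ × ℕ))} {i : α → ℕ} (hb : FP b)
    (hT : FP T) (hi : FP i) : FP fun a => freeing (b a) (T a) (i a) := by
  unfold freeing; fun_prop

@[fun_prop] theorem fp_grow {T : α → List (ℕ × List (ℕ × ℕ))} {S : α → List ℕ} {i j : α → ℕ}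
    {M Q : α → List (ℕ × ℕ)} (hb : FP b) (hT : FP T) (hS : FP S) (hi : FP i) (hj : FP j)
    (hM : FP M) (hQ : FP Q) : FP fun a => grow (b a) (T a) (S a) (i a) (j a) (M a) (Q a) := by
  unfold grow; fun_prop

@[fun_prop] theorem fp_step' {s : α → St} {e : α → ℕ × ℕ × ℤ} (hb : FP b) (hs : FP s)
    (he : FP e) : FP fun a => step' (b a) (s a) (e a) := by
  unfold step'; fun_prop

@[fun_prop] theorem fp_step {s : α → St} (hb : FP b) (hs : FP s) :
    FP fun a => step (b a) (s a) := by
  unfold step; fun_prop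

@[fun_prop] theorem fp_phase {s : α → List (ℕ × ℕ × ℤ) × List (ℕ × ℕ)} {i : α → ℕ} (hb : FP b)
    (hs : FP s) (hi : FP i) : FP fun a => phase (b a) (s a) (i a) := by
  unfold phase; fun_prop

@[fun_prop] theorem fp_hung {rows : α → List ℕ} {A : α → List (ℕ × ℕ × ℤ)} (hb : FP b)
    (hr : FP rows) (hA : FP A) : FP fun a => hung (b a) (rows a) (A a) := by
  unfold hung; fun_prop

end

/-! ### Correctness of the Hungarian method. -/

/-- The list of the entries of a matrix. -/
def entries (rows cols : List ℕ) (a : ℕ → ℕ → ℤ) : List (ℕ × ℕ × ℤ) :=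
  rows.flatMap fun i => cols.map fun j => (i, j, a i j)

theorem mem_entries {rows cols : List ℕ} {a : ℕ → ℕ → ℤ} {e : ℕ × ℕ × ℤ} :
    e ∈ entries rows cols a ↔ e.1 ∈ rows ∧ e.2.1 ∈ cols ∧ e.2.2 = a e.1 e.2.1 := by
  obtain ⟨i, j, x⟩ := e
  simp only [entries, List.mem_flatMap, List.mem_map, Prod.mk.injEq]
  constructor
  · rintro ⟨i', h1, j', h2, rfl, rfl, rfl⟩; exact ⟨h1, h2, rfl⟩
  · rintro ⟨h1, h2, rfl⟩; exact ⟨i, h1, j, h2, rfl, rfl, rfl⟩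

theorem map_entries {rows cols : List ℕ} {a : ℕ → ℕ → ℤ} (f : ℕ → ℕ → ℤ → ℤ) :
    (entries rows cols a).map (fun e => (e.1, e.2.1, f e.1 e.2.1 e.2.2)) =
      entries rows cols fun i j => f i j (a i j) := by
  simp [entries, List.map_flatMap, Function.comp_def]

@[simp] theorem length_entries {rows cols : List ℕ} {a : ℕ → ℕ → ℤ} :
    (entries rows cols a).length = rows.length * cols.length := by
  simp [entries, List.length_flatMap]

/-- `a` arises from `c` by subtracting potentials of the rows and columns; those of the columns are
non-positive and vanish on `free`. -/
def Reduced (rows cols : List ℕ) (c a : ℕ → ℕ → ℤ) (free : ℕ → Prop) : Prop :=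
  (∀ i ∈ rows, ∀ j ∈ cols, 0 ≤ a i j) ∧ ∃ u v : ℕ → ℤ,
    (∀ i ∈ rows, ∀ j ∈ cols, a i j = c i j - u i - v j) ∧ (∀ j, v j ≤ 0) ∧ ∀ j, free j → v j = 0

/-- A matching of the rows `R` using entries `0`. -/
structure Matching (R cols : List ℕ) (a : ℕ → ℕ → ℤ) (M : List (ℕ × ℕ)) : Prop where
  rows : (M.map Prod.fst).Perm R
  nodup : (M.map Prod.snd).Nodup
  cols : ∀ j ∈ M.map Prod.snd, j ∈ cols
  tight : ∀ e ∈ M, a e.1 e.2 = 0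

/-- The invariant of a phase that adds the row `i₀` to the matching `M₀`. -/
structure Tree (M₀ : List (ℕ × ℕ)) (i₀ : ℕ) (a : ℕ → ℕ → ℤ)
    (T : List (ℕ × List (ℕ × ℕ))) (S : List ℕ) : Prop where
  nodup : (T.map Prod.fst).Nodup
  length : S.length + 1 = T.length
  sub : ∀ i ∈ T.map Prod.fst, i ∈ i₀ :: M₀.map Prod.fst
  subS : ∀ j ∈ S, j ∈ M₀.map Prod.snd
  rows : ∀ t ∈ T, (t.1 :: t.2.map Prod.fst).Perm (i₀ :: M₀.map Prod.fst)
  cols : ∀ t ∈ T, (t.2.map Prod.snd).Perm (M₀.map Prod.snd)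
  tight : ∀ t ∈ T, ∀ e ∈ t.2, a e.1 e.2 = 0
  mem_iff : ∀ t ∈ T, ∀ e ∈ t.2, (e.1 ∈ T.map Prod.fst ↔ e.2 ∈ S)
  same : ∀ t ∈ T, ∀ e ∈ t.2, e.1 ∉ T.map Prod.fst → e ∈ M₀

theorem eq_of_nodup_map {α β : Type} {f : α → β} {l : List α} (h : (l.map f).Nodup) {x y : α}
    (hx : x ∈ l) (hy : y ∈ l) (hxy : f x = f y) : x = y :=
  List.inj_on_of_nodup_map h hx hy hxy

theorem perm_cons_filter {M : List (ℕ × ℕ)} (h : (M.map Prod.fst).Nodup) {e : ℕ × ℕ} (he : e ∈ M) :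
    M.Perm (e :: M.filter fun x => decide (¬ x.1 = e.1)) := by
  have hM : M.Nodup := List.Nodup.of_map _ h
  refine (List.perm_ext_iff_of_nodup hM ?_).2 fun x => ?_
  · refine List.nodup_cons.2 ⟨by simp, hM.filter _⟩
  · simp only [List.mem_cons, List.mem_filter, decide_eq_true_eq]
    constructor
    · intro hx
      by_cases hxe : x.1 = e.1
      · exact .inl (eq_of_nodup_map h hx he hxe)
      · exact .inr ⟨hx, hxe⟩
    · rintro (rfl | h) <;> tauto

variable {b : Bd} {rows cols R : List ℕ} {c a : ℕ → ℕ → ℤ} {M₀ : List (ℕ × ℕ)} {i₀ : ℕ}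
  {T : List (ℕ × List (ℕ × ℕ))} {S : List ℕ}

theorem isKey_iff (h : T.length ≤ b.n) {i : ℕ} : isKey b T i = true ↔ i ∈ T.map Prod.fst := by
  simp [isKey, Bd.cut_eq h]

theorem isMem_iff (h : S.length ≤ b.n) {j : ℕ} : isMem b S j = true ↔ j ∈ S := by
  simp [isMem, Bd.cut_eq h]

theorem freeing_spec (h : T.length ≤ b.n) {i : ℕ} (hi : i ∈ T.map Prod.fst) :
    (i, freeing b T i) ∈ T := by
  have hne : (T.filter fun e => decide (e.1 = i)) ≠ [] := by
    obtain ⟨t, ht, rfl⟩ := List.mem_map.1 hi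
    exact List.ne_nil_of_mem (List.mem_filter.2 ⟨ht, by simp⟩)
  rw [freeing, Bd.cut_eq h]
  obtain ⟨t, l, htl⟩ := List.exists_cons_of_ne_nil hne
  have ht : t ∈ T.filter fun e => decide (e.1 = i) := by rw [htl]; simp
  rw [htl]
  simp only [List.mem_filter, decide_eq_true_eq] at ht
  obtain ⟨h1, rfl⟩ := ht
  exact h1

/-- The effect of `adjust` on the matrix. -/
def adjusted (a : ℕ → ℕ → ℤ) (T : List (ℕ × List (ℕ × ℕ))) (S : List ℕ) (δ : ℤ) (i j : ℕ) : ℤ :=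
  a i j - (if i ∈ T.map Prod.fst then δ else 0) + (if j ∈ S then δ else 0)

theorem adjust_entries (hA : rows.length * cols.length ≤ b.n) (hT : T.length ≤ b.n)
    (hS : S.length ≤ b.n) (δ : ℤ) :
    adjust b (entries rows cols a) T S δ = entries rows cols (adjusted a T S δ) := by
  rw [adjust, Bd.cut_eq (by simpa using hA)]
  simp only [isKey_iff hT, isMem_iff hS]
  exact map_entries fun i j x => x - (if i ∈ T.map Prod.fst then δ else 0) + (if j ∈ S then δ else 0)

theorem pivot_spec (hA : rows.length * cols.length ≤ b.n) (hT : T.length ≤ b.n)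
    (hS : S.length ≤ b.n) (hc : cols.Nodup) (hT0 : T ≠ []) (hTr : ∀ i ∈ T.map Prod.fst, i ∈ rows)
    (hlt : S.length < cols.length) :
    let e := pivot b (entries rows cols a) T S
    e.1 ∈ T.map Prod.fst ∧ e.2.1 ∈ cols ∧ e.2.1 ∉ S ∧ e.2.2 = a e.1 e.2.1 ∧
      ∀ i ∈ T.map Prod.fst, ∀ j ∈ cols, j ∉ S → e.2.2 ≤ a i j := by
  have hne : ((entries rows cols a).filter fun e =>
      decide (isKey b T e.1 = true ∧ ¬ isMem b S e.2.1 = true)) ≠ [] := by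
    obtain ⟨t, T', rfl⟩ := List.exists_cons_of_ne_nil hT0
    obtain ⟨j, hj, hjS⟩ : ∃ j ∈ cols, j ∉ S := by
      by_contra! h
      exact absurd (List.Subperm.length_le (List.subperm_of_subset hc h)) (by omega)
    refine List.ne_nil_of_mem (a := (t.1, j, a t.1 j)) (List.mem_filter.2 ⟨mem_entries.2
      ⟨hTr _ (by simp), hj, rfl⟩, ?_⟩)
    simp only [isKey_iff hT, isMem_iff hS]
    simp [hjS]
  have := argmin_spec hne
  intro e
  have he : e = argmin ((entries rows cols a).filter fun e =>
      decide (isKey b T e.1 = true ∧ ¬ isMem b S e.2.1 = true)) := by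
    simp only [e, pivot]
    rw [Bd.cut_eq (l := entries rows cols a) (by simpa using hA)]
    exact congrArg _ (Bd.cut_eq ((List.length_filter_le _ _).trans (by simpa using hA)))
  rw [← he] at this
  simp only [List.mem_filter, isKey_iff hT, isMem_iff hS, decide_eq_true_eq, mem_entries] at this
  obtain ⟨⟨⟨h1, h2, h3⟩, h4, h5⟩, h6⟩ := this
  exact ⟨h4, h2, h5, h3, fun i hi j hj hjS => h6 (i, j, a i j) ⟨⟨hTr i hi, hj, rfl⟩, hi, hjS⟩⟩

/-- The amount δ is added to the potentials of the tree rows and taken off those of the tree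
columns. An entry decreases only if its row is in the tree and its column is not, and such entries
are at least δ. Column potentials only go down, and only in `S`, which contains no free column. -/
theorem Reduced.adjusted {free : ℕ → Prop} {δ : ℤ} (h : Reduced rows cols c a free) (hδ : 0 ≤ δ)
    (hmin : ∀ i ∈ T.map Prod.fst, ∀ j ∈ cols, j ∉ S → δ ≤ a i j) (hS : ∀ j ∈ S, ¬ free j) :
    Reduced rows cols c (adjusted a T S δ) free := by
  obtain ⟨h0, u, v, h1, h2, h3⟩ := h
  refine ⟨fun i hi j hj => ?_, fun i => u i + if i ∈ T.map Prod.fst then δ else 0,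
    fun j => v j - if j ∈ S then δ else 0, fun i hi j hj => ?_, fun j => ?_, fun j hj => ?_⟩
  · have := h0 i hi j hj
    unfold Hungarian.adjusted
    split_ifs with hT hS' hS'
    · omega
    · have := hmin i hT j hj hS'
      omega
    · omega
    · omega
  · rw [Hungarian.adjusted, h1 i hi j hj]; ring
  · have := h2 j
    dsimp only
    split_ifs <;> omega
  · have : j ∉ S := fun hjS => hS j hjS hj
    simp [this, h3 j hj]

/-- By `mem_iff`, a pair in a stored matching has both its row and its column in the tree or
neither; in both cases its entry stays 0. -/
theorem Tree.adjusted {δ : ℤ} (h : Tree M₀ i₀ a T S) : Tree M₀ i₀ (adjusted a T S δ) T S :=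
  { h with
    tight := fun t ht e he => by
      have h1 := h.mem_iff t ht e he
      have h2 := h.tight t ht e he
      unfold Hungarian.adjusted
      rw [h2]
      by_cases h3 : e.2 ∈ S
      · rw [if_pos h3, if_pos (h1.2 h3)]; ring
      · rw [if_neg h3, if_neg (mt h1.1 h3)]; ring }

/-- Replacing the pair (i', j) by (i, j) turns the matching that frees i into one that frees i', on
the same columns. As i' was outside the tree, (i', j) is a pair of `M₀`, so row i' and column j may
enter the tree together. Storing whole matchings makes it unnecessary to trace alternating paths. -/
theorem Tree.extend (h : Tree M₀ i₀ a T S) (h₀ : (i₀ :: M₀.map Prod.fst).Nodup)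
    (h₀' : (M₀.map Prod.snd).Nodup) {i j i' : ℕ} {M : List (ℕ × ℕ)} (hM : (i, M) ∈ T)
    (hj : j ∉ S) (ha : a i j = 0) (hi' : (i', j) ∈ M) :
    Tree M₀ i₀ a ((i', (i, j) :: M.filter fun x => decide (¬ x.1 = i')) :: T) (j :: S) := by
  have hMn : (M.map Prod.fst).Nodup := by
    have := (h.rows _ hM).nodup_iff.2 h₀
    exact (List.nodup_cons.1 this).2
  have hMn' : (M.map Prod.snd).Nodup := (h.cols _ hM).nodup_iff.2 h₀'
  have hp := perm_cons_filter hMn hi'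
  have hi'T : i' ∉ T.map Prod.fst := fun hc => hj ((h.mem_iff _ hM _ hi').1 hc)
  have hi0 : (i', j) ∈ M₀ := h.same _ hM _ hi' hi'T
  have hiT : i ∈ T.map Prod.fst := List.mem_map.2 ⟨_, hM, rfl⟩
  refine ⟨?_, ?_, ?_, ?_, ?_, ?_, ?_, ?_, ?_⟩
  · exact List.nodup_cons.2 ⟨hi'T, h.nodup⟩
  · simpa using h.length
  · intro x hx
    simp only [List.map_cons, List.mem_cons] at hx
    rcases hx with rfl | hx
    · exact List.mem_cons_of_mem _ (List.mem_map.2 ⟨_, hi0, rfl⟩)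
    · exact h.sub x hx
  · intro x hx
    simp only [List.mem_cons] at hx
    rcases hx with rfl | hx
    · exact List.mem_map.2 ⟨_, hi0, rfl⟩
    · exact h.subS x hx
  · intro t ht
    rcases List.mem_cons.1 ht with rfl | ht
    · refine List.Perm.trans ?_ (h.rows _ hM)
      simp only [List.map_cons]
      refine (List.Perm.swap ..).trans (.cons _ ?_)
      exact (hp.map Prod.fst).symm
    · exact h.rows t ht
  · intro t ht
    rcases List.mem_cons.1 ht with rfl | ht
    · exact ((hp.map Prod.snd).symm).trans (h.cols _ hM)
    · exact h.cols t ht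
  · intro t ht e he
    rcases List.mem_cons.1 ht with rfl | ht
    · rcases List.mem_cons.1 he with rfl | he
      · exact ha
      · exact h.tight _ hM e (List.mem_of_mem_filter he)
    · exact h.tight t ht e he
  · intro t ht e he
    simp only [List.map_cons, List.mem_cons]
    rcases List.mem_cons.1 ht with rfl | ht
    · rcases List.mem_cons.1 he with rfl | he
      · simp only [true_or, iff_true]; exact .inr hiT
      · simp only [List.mem_filter, decide_eq_true_eq] at he
        have h1 : e.2 ≠ j := fun hc => he.2 (congrArg Prod.fst (eq_of_nodup_map hMn' he.1 hi' hc))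
        have := h.mem_iff _ hM e he.1
        tauto
    · have h1 := h.mem_iff t ht e he
      have h2 := h.same t ht e he
      -- A pair outside the old tree is one of `M₀`, where row i' and column j determine each other;
      -- hence `mem_iff` survives.
      have h3 : e ∈ M₀ → (e.1 = i' ↔ e.2 = j) := fun hc =>
        ⟨fun hx => congrArg Prod.snd (eq_of_nodup_map (List.nodup_cons.1 h₀).2 hc hi0 hx),
          fun hx => congrArg Prod.fst (eq_of_nodup_map h₀' hc hi0 hx)⟩
      by_cases h4 : e.1 ∈ T.map Prod.fst
      · simp [h4, h1.1 h4]
      · have := h3 (h2 h4)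
        tauto
  · intro t ht e he
    simp only [List.map_cons, List.mem_cons, not_or]
    rintro ⟨h1, h2⟩
    rcases List.mem_cons.1 ht with rfl | ht
    · rcases List.mem_cons.1 he with rfl | he
      · exact absurd hiT h2
      · exact h.same _ hM e (List.mem_of_mem_filter he) h2
    · exact h.same t ht e he h2

/-- The adjustment makes the pivot (i, j) tight. If the matching that frees i leaves column j
unused, adding (i, j) augments it; otherwise the partner of j becomes a new tree row. -/
theorem step_spec (hA : rows.length * cols.length ≤ b.n) (hr : rows.length ≤ b.n)
    (hcols : cols.Nodup) (hrc : rows.length ≤ cols.length)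
    (hT : Tree M₀ i₀ a T S) (h₀ : (i₀ :: M₀.map Prod.fst).Nodup)
    (h₀r : ∀ i ∈ i₀ :: M₀.map Prod.fst, i ∈ rows)
    (h₀' : (M₀.map Prod.snd).Nodup) (h₀c : ∀ j ∈ M₀.map Prod.snd, j ∈ cols)
    (hred : Reduced rows cols c a fun j => j ∉ M₀.map Prod.snd) :
    ∃ a', (∃ T' S', step b (entries rows cols a, T, S, []) = (entries rows cols a', T', S', []) ∧
        Tree M₀ i₀ a' T' S' ∧ T'.length = T.length + 1 ∧
        Reduced rows cols c a' fun j => j ∉ M₀.map Prod.snd) ∨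
      ∃ T' S' M, step b (entries rows cols a, T, S, []) = (entries rows cols a', T', S', [M]) ∧
        Matching (i₀ :: M₀.map Prod.fst) cols a' M ∧
        Reduced rows cols c a' fun j => j ∉ M.map Prod.snd := by
  have hTr : ∀ i ∈ T.map Prod.fst, i ∈ rows := fun i hi => h₀r i (hT.sub i hi)
  have hTlen : T.length ≤ rows.length := by
    have := List.Subperm.length_le (List.subperm_of_subset hT.nodup hTr)
    simpa using this
  have hlen := hT.length
  have hTb : T.length ≤ b.n := hTlen.trans hr
  have hSb : S.length ≤ b.n := by omega
  -- A column outside `S` exists, because `S` has one element fewer than `T`, and `T` has at most as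
  -- many rows as there are columns.
  have hpiv := pivot_spec (a := a) hA hTb hSb hcols (by rintro rfl; simp at hlen) hTr (by omega)
  simp only [step, List.isEmpty_nil, if_true]
  generalize pivot b (entries rows cols a) T S = e at hpiv ⊢
  obtain ⟨i, j, δ⟩ := e
  obtain ⟨h1, h2, h3, h4, h5⟩ := hpiv
  dsimp only at h1 h2 h3 h4 h5
  have hδ : 0 ≤ δ := by rw [h4]; exact hred.1 i (hTr i h1) j h2
  have hM := freeing_spec hTb h1
  simp only [step', adjust_entries hA hTb hSb]
  generalize freeing b T i = M at hM ⊢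
  have hT' := hT.adjusted (δ := δ)
  have hred' := hred.adjusted (T := T) (S := S) hδ h5 (fun j hj => not_not.2 (hT.subS j hj))
  have ha' : adjusted a T S δ i j = 0 := by
    simp only [adjusted, if_pos h1, if_neg h3, ← h4]; ring
  have hMlen : M.length ≤ b.n := by
    have := (hT.rows _ hM).length_eq
    have h6 := List.Subperm.length_le (List.subperm_of_subset h₀ h₀r)
    simp only [List.length_cons, List.length_map] at this h6
    omega
  refine ⟨adjusted a T S δ, ?_⟩
  simp only [grow, Bd.cut_eq hMlen]
  by_cases hQ : (M.filter fun x => decide (x.2 = j)).isEmpty = true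
  · right
    refine ⟨T, S, (i, j) :: M, by rw [if_pos hQ], ?_, ?_⟩
    · have hjM : j ∉ M.map Prod.snd := by
        simp only [List.isEmpty_iff, List.filter_eq_nil_iff, decide_eq_true_eq] at hQ
        intro hc
        obtain ⟨e, he, rfl⟩ := List.mem_map.1 hc
        exact hQ e he rfl
      refine ⟨hT.rows _ hM, List.nodup_cons.2 ⟨hjM, (hT.cols _ hM).nodup_iff.2 h₀'⟩, ?_, ?_⟩
      · intro x hx
        rcases List.mem_cons.1 hx with rfl | hx
        · exact h2
        · exact h₀c x ((hT.cols _ hM).mem_iff.1 hx)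
      · intro e he
        rcases List.mem_cons.1 he with rfl | he
        · exact ha'
        · exact hT'.tight _ hM e he
    · obtain ⟨k0, u, v, k1, k2, k3⟩ := hred'
      refine ⟨k0, u, v, k1, k2, fun x hx => k3 x fun hc => hx ?_⟩
      exact List.mem_cons_of_mem _ ((hT.cols _ hM).mem_iff.2 hc)
  · left
    obtain ⟨q, Q, hq⟩ := List.exists_cons_of_ne_nil
      (l := M.filter fun x => decide (x.2 = j)) (by simpa using hQ)
    have hqM : q ∈ M.filter fun x => decide (x.2 = j) := by rw [hq]; simp
    simp only [List.mem_filter, decide_eq_true_eq] at hqM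
    obtain ⟨hqM, rfl⟩ := hqM
    refine ⟨_, _, by rw [if_neg hQ], ?_, by simp, hred'⟩
    rw [hq]
    exact hT'.extend h₀ h₀' hM h3 ha' hqM

/-- Each step without augmentation adds a row to the tree, which can hold at most all rows. Once a
matching has been found, `step` is the identity. -/
theorem iterate_step_spec (hA : rows.length * cols.length ≤ b.n) (hr : rows.length ≤ b.n)
    (hcols : cols.Nodup) (hrc : rows.length ≤ cols.length)
    (hT : Tree M₀ i₀ a T S) (h₀ : (i₀ :: M₀.map Prod.fst).Nodup)
    (h₀r : ∀ i ∈ i₀ :: M₀.map Prod.fst, i ∈ rows)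
    (h₀' : (M₀.map Prod.snd).Nodup) (h₀c : ∀ j ∈ M₀.map Prod.snd, j ∈ cols)
    (hred : Reduced rows cols c a fun j => j ∉ M₀.map Prod.snd) (n : ℕ)
    (hn : rows.length < T.length + n) :
    ∃ a' T' S' M, (step b)^[n] (entries rows cols a, T, S, []) = (entries rows cols a', T', S', [M]) ∧
        Matching (i₀ :: M₀.map Prod.fst) cols a' M ∧
        Reduced rows cols c a' fun j => j ∉ M.map Prod.snd := by
  induction n generalizing a T S with
  | zero =>
    have := List.Subperm.length_le (List.subperm_of_subset hT.nodup
      fun i hi => h₀r i (hT.sub i hi))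
    simp only [List.length_map] at this
    omega
  | succ n ih =>
    rw [Function.iterate_succ_apply]
    obtain ⟨a', ⟨T', S', h1, h2, h3, h4⟩ | ⟨T', S', M, h1, h2, h3⟩⟩ :=
      step_spec hA hr hcols hrc hT h₀ h₀r h₀' h₀c hred
    · rw [h1]
      exact ih h2 h4 (by omega)
    · refine ⟨a', T', S', M, ?_, h2, h3⟩
      rw [h1]
      exact Function.iterate_fixed (by simp [step]) n

theorem phase_spec (hA : rows.length * cols.length ≤ b.n) (hr : rows.length ≤ b.n)
    (hcols : cols.Nodup) (hrc : rows.length ≤ cols.length) {M : List (ℕ × ℕ)}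
    (hM : Matching R cols a M) (hR : (i₀ :: R).Nodup) (hRr : ∀ i ∈ i₀ :: R, i ∈ rows)
    (hred : Reduced rows cols c a fun j => j ∉ M.map Prod.snd) :
    ∃ a' M', phase b (entries rows cols a, M) i₀ = (entries rows cols a', M') ∧
      Matching (i₀ :: R) cols a' M' ∧ Reduced rows cols c a' fun j => j ∉ M'.map Prod.snd := by
  have hp := List.Perm.cons i₀ hM.rows
  have hT : Tree M i₀ a [(i₀, M)] [] := by
    refine ⟨by simp, by simp, by simp, by simp, ?_, ?_, ?_, ?_, ?_⟩
    · simp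
    · simp
    · simpa using hM.tight
    · have : i₀ ∉ M.map Prod.fst := (List.nodup_cons.1 (hp.nodup_iff.2 hR)).1
      simp only [List.mem_singleton, forall_eq, List.map_cons, List.map_nil, List.not_mem_nil,
        iff_false]
      rintro e he rfl
      exact this (List.mem_map.2 ⟨e, he, rfl⟩)
    · simp +contextual
  obtain ⟨a', T', S', M', h1, h2, h3⟩ := iterate_step_spec hA hr hcols hrc hT (hp.nodup_iff.2 hR)
    (fun i hi => hRr i (hp.mem_iff.1 hi)) hM.nodup hM.cols hred b.n (by simp; omega)
  refine ⟨a', M', ?_, ?_, h3⟩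
  · simp only [phase, h1, List.headD_cons]
  · exact ⟨h2.rows.trans hp, h2.nodup, h2.cols, h2.tight⟩

theorem foldl_phase_spec (hA : rows.length * cols.length ≤ b.n) (hr : rows.length ≤ b.n)
    (hcols : cols.Nodup) (hrc : rows.length ≤ cols.length) (L : List ℕ) {M : List (ℕ × ℕ)}
    (hM : Matching R cols a M) (hR : (L ++ R).Nodup) (hRr : ∀ i ∈ L ++ R, i ∈ rows)
    (hred : Reduced rows cols c a fun j => j ∉ M.map Prod.snd) :
    ∃ a' M', L.foldl (phase b) (entries rows cols a, M) = (entries rows cols a', M') ∧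
      Matching (L ++ R) cols a' M' ∧ Reduced rows cols c a' fun j => j ∉ M'.map Prod.snd := by
  induction L generalizing R a M with
  | nil => exact ⟨a, M, rfl, hM, hred⟩
  | cons i L ih =>
    have hp : (L ++ i :: R).Perm (i :: L ++ R) := List.perm_middle
    have hR' := hp.nodup_iff.2 hR
    obtain ⟨a', M', h1, h2, h3⟩ := phase_spec (i₀ := i) hA hr hcols hrc hM
      (List.nodup_append.1 hR').2.1 (fun x hx => hRr x (hp.mem_iff.1 (by simp_all))) hred
    rw [List.foldl_cons, h1]
    obtain ⟨a'', M'', h4, h5, h6⟩ := ih h2 hR' (fun x hx => hRr x (hp.mem_iff.1 hx)) h3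
    exact ⟨a'', M'', h4, ⟨h5.rows.trans hp, h5.nodup, h5.cols, h5.tight⟩, h6⟩

/-- The Hungarian method finds a matching of the rows of smallest cost. -/
theorem hung_spec (hA : rows.length * cols.length ≤ b.n) (hr : rows.length ≤ b.n)
    (hrows : rows.Nodup) (hcols : cols.Nodup) (hrc : rows.length ≤ cols.length)
    (hc : ∀ i j, 0 ≤ c i j) :
    let M := hung b rows (entries rows cols c)
    (M.map Prod.fst).Perm rows ∧ (M.map Prod.snd).Nodup ∧ (∀ j ∈ M.map Prod.snd, j ∈ cols) ∧
      ∀ g : ℕ → ℕ, (∀ i ∈ rows, g i ∈ cols) → (rows.map g).Nodup →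
        (M.map fun e => c e.1 e.2).sum ≤ (rows.map fun i => c i (g i)).sum := by
  obtain ⟨a', M', h1, h2, h3⟩ := foldl_phase_spec (c := c) (a := c) (R := []) (M := []) hA hr hcols
    hrc rows ⟨by simp, by simp, by simp, by simp⟩ (by simpa) (by simp)
    ⟨fun i _ j _ => hc i j, 0, 0, by simp, by simp, by simp⟩
  rw [List.append_nil] at h2
  have hM : hung b rows (entries rows cols c) = M' := by rw [hung, Bd.cut_eq hr, h1]
  rw [hM]
  refine ⟨h2.rows, h2.nodup, h2.cols, fun g hg hgn => ?_⟩
  -- Weak duality. The matching found costs the sum of all row potentials plus the potentials of its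
  -- columns. The unused columns have potential 0 and no potential of a column is positive, so no
  -- other set of columns has a smaller sum.
  obtain ⟨h4, u, v, h5, h6, h7⟩ := h3
  have e1 : (M'.map fun e => c e.1 e.2) = M'.map fun e => u e.1 + v e.2 := by
    refine List.map_congr_left fun e he => ?_
    have := h5 e.1 (h2.rows.mem_iff.1 (List.mem_map.2 ⟨e, he, rfl⟩)) e.2
      (h2.cols _ (List.mem_map.2 ⟨e, he, rfl⟩))
    rw [h2.tight e he] at this
    omega
  have e2 : (M'.map fun e => u e.1 + v e.2).sum = (rows.map u).sum + ((M'.map Prod.snd).map v).sum := by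
    rw [List.sum_map_add, ← (h2.rows.map u).sum_eq]
    simp [Function.comp_def]
  have e3 : ∀ l : List ℕ, l.Nodup → (l.map v).sum = ∑ j ∈ l.toFinset, v j := fun l hl =>
    (List.sum_toFinset v hl).symm
  have e4 : (rows.map fun i => u i + v (g i)).sum ≤ (rows.map fun i => c i (g i)).sum := by
    refine List.sum_le_sum fun i hi => ?_
    have := h5 i hi _ (hg i hi)
    have := h4 i hi _ (hg i hi)
    omega
  have e5 : ((M'.map Prod.snd).map v).sum ≤ ((rows.map g).map v).sum := by
    rw [e3 _ h2.nodup, e3 _ hgn]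
    have e6 : ∑ j ∈ (M'.map Prod.snd).toFinset, v j = ∑ j ∈ cols.toFinset, v j := by
      refine Finset.sum_subset (fun j hj => ?_) fun j _ hj => h7 j fun hc => hj (by simpa using hc)
      exact List.mem_toFinset.2 (h2.cols j (List.mem_toFinset.1 hj))
    rw [e6]
    have := Finset.sum_le_sum_of_subset_of_nonneg (f := fun j => - v j)
      (s := (rows.map g).toFinset) (t := cols.toFinset) (fun j hj => ?_)
      fun j _ _ => neg_nonneg.2 (h6 j)
    · simpa using this
    · obtain ⟨i, hi, rfl⟩ := List.mem_map.1 (List.mem_toFinset.1 hj)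
      exact List.mem_toFinset.2 (hg i hi)
  rw [e1, e2]
  rw [List.sum_map_add] at e4
  rw [show ((rows.map g).map v) = rows.map fun i => v (g i) by simp] at e5
  exact (add_le_add_right e5 _).trans e4

end Hungarian

/-! ### The algorithm -/

namespace SingleSource

open RAM Hungarian

/-- Split `m` length-prefixed lists off a list; the result has them in reverse order. -/
def parse (b : Bd) (m : ℕ) (l : List ℕ) : ℕ × List ℕ × List (List ℕ) :=
  (fun s : ℕ × List ℕ × List (List ℕ) => if 0 < s.1 then
    (s.1 - 1, b.drop (s.2.1.headD 0) s.2.1.tail, b.take (s.2.1.headD 0) s.2.1.tail :: s.2.2)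
      else s)^[b.n] (m, l, [])

/-- Bring a list of numerators and denominators to a common denominator; the state consists of the
remaining input, the product of the denominators and the numerators so far, in reverse order. -/
def scale (b : Bd) (l : List ℕ) : List ℕ × ℕ × List ℕ :=
  (fun s : List ℕ × ℕ × List ℕ => if s.1.isEmpty = true then s else
    (s.1.tail.tail, b.mul s.2.1 (s.1.tail.headD 0), b.mul s.2.1 (s.1.headD 0) ::
      (b.cut s.2.2).map fun x => b.mul x (s.1.tail.headD 0)))^[b.n] (l, 1, [])

/-- Is `r` an endpoint of all paths? -/
def isRoot (b : Bd) (paths : List (List ℕ)) (r : ℕ) : Bool :=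
  (b.cut paths).all fun p => decide (¬ (¬ p.headD 0 = r ∧ ¬ (b.cut p).reverse.headD 0 = r))

/-- A common endpoint. -/
def root (b : Bd) (n : ℕ) (paths : List (List ℕ)) : ℕ :=
  ((b.cut (b.range n)).filter fun r => isRoot b paths r).headD 0

/-- The path `p` in the direction that starts in `r`. -/
def orient (b : Bd) (r : ℕ) (p : List ℕ) : List ℕ :=
  if p.headD 0 = r then p else (b.cut p).reverse

/-- The edges of all paths, directed away from `r`, with multiplicity. -/
def rawEdges (b : Bd) (r : ℕ) (paths : List (List ℕ)) : List (ℕ × ℕ) :=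
  (b.cut paths).flatMap fun p => b.cut (pairs (b.cut (orient b r p)))

/-- Remove duplicates. -/
def nub (b : Bd) (l : List (ℕ × ℕ)) : List (ℕ × ℕ) :=
  (b.cut l).foldr (fun e acc => if (b.cut acc).any (fun x => decide (x = e)) = true then acc
    else e :: acc) []

/-- Scaled traversal costs; colours `i ≥ k` have traversal costs `0`. -/
def tcost (b : Bd) (k : ℕ) (C : List ℕ) (i j : ℕ) : ℕ :=
  if i < k then b.getD C (b.mul i k + j) 0 else 0

/-- The children of the vertex `v`. -/
def children (b : Bd) (E : List (ℕ × ℕ)) (v : ℕ) : List ℕ :=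
  (b.cut ((b.cut E).filter fun e => decide (e.1 = v))).map fun e => e.2

/-- For each vertex `v` and colour `i` of the edge that leads to `v`, the smallest cost below `v`
and the colours of the edges that leave `v`. -/
abbrev Table : Type := List (List (ℕ × List (ℕ × ℕ)))

/-- An entry of the table. -/
def cell (b : Bd) (F : Table) (v i : ℕ) : ℕ × List (ℕ × ℕ) := b.getD (b.getD F v []) i (0, [])

/-- The cost of giving the colour `j` to the edge from `v` to `c` if the edge that leads to `v` has
the colour `i`. -/
def edgeCost (b : Bd) (k : ℕ) (C : List ℕ) (W : List (ℕ × ℕ)) (F : Table) (v i c j : ℕ) : ℕ :=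
  b.mul (tcost b k C i j) ((b.cut W).count (v, c)) + (cell b F c j).1

/-- The colours other than `i`. -/
def colors (b : Bd) (k i : ℕ) : List ℕ := (b.cut (b.range k)).filter fun j => decide (¬ j = i)

/-- The assignment problem at the vertex `v`. -/
def matrix (b : Bd) (k : ℕ) (C : List ℕ) (E W : List (ℕ × ℕ)) (F : Table) (v i : ℕ) :
    List (ℕ × ℕ × ℤ) :=
  (b.cut (children b E v)).flatMap fun c => b.cut ((b.cut (colors b k i)).map fun j =>
    (c, j, (edgeCost b k C W F v i c j : ℤ)))

/-- A matching together with its cost. -/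
def evaluate (b : Bd) (k : ℕ) (C : List ℕ) (W : List (ℕ × ℕ)) (F : Table) (v i : ℕ)
    (M : List (ℕ × ℕ)) : ℕ × List (ℕ × ℕ) :=
  ((b.cut ((b.cut M).map fun e => edgeCost b k C W F v i e.1 e.2)).sum, M)

/-- Optimal colours below `v`. -/
def solve (b : Bd) (k : ℕ) (C : List ℕ) (E W : List (ℕ × ℕ)) (F : Table) (v i : ℕ) :
    ℕ × List (ℕ × ℕ) :=
  evaluate b k C W F v i (hung b (children b E v) (matrix b k C E W F v i))

/-- Recompute the table. -/
def update (b : Bd) (n k : ℕ) (C : List ℕ) (E W : List (ℕ × ℕ)) (F : Table) : Table :=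
  -- There are k + 1 colours here: the last one, k, is the extra colour above the root.
  (b.cut (b.range n)).map fun v => (b.cut (b.range (k + 1))).map fun i => solve b k C E W F v i

/-- The final table. -/
def table (b : Bd) (n k : ℕ) (C : List ℕ) (E W : List (ℕ × ℕ)) : Table :=
  -- The whole table is recomputed in every round, so the vertices need not be ordered from the
  -- leaves upwards; an entry is final one round after those of the children are.
  (update b n k C E W)^[b.n] []

/-- The next colour on a path. -/
def nextColor (b : Bd) (F : Table) (s : ℕ × ℕ × List ℕ) (v : ℕ) : ℕ :=
  lookup (b.cut (cell b F s.1 s.2.1).2) v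

/-- The colours on a path that starts in the root, in reverse order. -/
def pathColors (b : Bd) (k : ℕ) (F : Table) (p : List ℕ) : List ℕ :=
  ((b.cut p.tail).foldl (fun s v => (v, nextColor b F s v, nextColor b F s v :: s.2.2))
    (p.headD 0, k, ([] : List ℕ))).2.2

/-- The colours on a path in its given direction. -/
def answer (b : Bd) (k r : ℕ) (F : Table) (p : List ℕ) : List ℕ :=
  if p.headD 0 = r then (b.cut (pathColors b k F p)).reverse
  else pathColors b k F (b.cut p).reverse

/-- The colours on all paths. -/
def answers (b : Bd) (k r : ℕ) (F : Table) (paths : List (List ℕ)) : List ℕ :=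
  (b.cut paths).flatMap fun p => b.cut (answer b k r F p)

/-- The algorithm from the edges on. -/
def fromEdges (cc : Bool) (b : Bd) (n k : ℕ) (C : List ℕ) (paths : List (List ℕ)) (r : ℕ)
    (raw : List (ℕ × ℕ)) : List ℕ :=
  -- Only the weights depend on the problem: each arc counts once for changeover costs, and once per
  -- path through it for reload costs.
  answers b k r (table b n k C (nub b raw) (if cc = true then nub b raw else raw)) paths

/-- The algorithm from the root on. -/
def fromRoot (cc : Bool) (b : Bd) (n k : ℕ) (C : List ℕ) (paths : List (List ℕ)) (r : ℕ) :
    List ℕ :=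
  fromEdges cc b n k C paths r (rawEdges b r paths)

/-- The algorithm from the paths on. -/
def fromPaths (cc : Bool) (b : Bd) (n k : ℕ) (C : List ℕ) (paths : List (List ℕ)) : List ℕ :=
  fromRoot cc b n k C paths (root b n paths)

/-- The algorithm, after parsing the paths. -/
def fromParsed (cc : Bool) (b : Bd) (n k : ℕ) (s : ℕ × List ℕ × List (List ℕ)) : List ℕ :=
  fromPaths cc b n k (b.cut (scale b s.2.1).2.2).reverse (b.cut s.2.2).reverse

/-- The algorithm; `cc` selects changeover costs. -/
def algorithm (cc : Bool) (x : Bd × List ℕ) : List ℕ :=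
  fromParsed cc x.1 (x.2.headD 0) (x.2.tail.headD 0)
    (parse x.1 (x.2.tail.tail.headD 0) x.2.tail.tail.tail)

section

variable {α : Type} [Rep α] {b : α → Bd}

@[fun_prop] theorem fp_parse {m : α → ℕ} {l : α → List ℕ} (hb : FP b) (hm : FP m) (hl : FP l) :
    FP fun a => parse (b a) (m a) (l a) := by
  unfold parse; fun_prop

@[fun_prop] theorem fp_scale {l : α → List ℕ} (hb : FP b) (hl : FP l) :
    FP fun a => scale (b a) (l a) := by
  unfold scale; fun_prop

@[fun_prop] theorem fp_isRoot {paths : α → List (List ℕ)} {r : α → ℕ} (hb : FP b) (hp : FP paths)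
    (hr : FP r) : FP fun a => isRoot (b a) (paths a) (r a) := by
  unfold isRoot; fun_prop

@[fun_prop] theorem fp_root {n : α → ℕ} {paths : α → List (List ℕ)} (hb : FP b) (hn : FP n)
    (hp : FP paths) : FP fun a => root (b a) (n a) (paths a) := by
  unfold root; fun_prop

@[fun_prop] theorem fp_orient {r : α → ℕ} {p : α → List ℕ} (hb : FP b) (hr : FP r) (hp : FP p) :
    FP fun a => orient (b a) (r a) (p a) := by
  unfold orient; fun_prop

@[fun_prop] theorem fp_rawEdges {r : α → ℕ} {p : α → List (List ℕ)} (hb : FP b) (hr : FP r)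
    (hp : FP p) : FP fun a => rawEdges (b a) (r a) (p a) := by
  unfold rawEdges; fun_prop

@[fun_prop] theorem fp_nub {l : α → List (ℕ × ℕ)} (hb : FP b) (hl : FP l) :
    FP fun a => nub (b a) (l a) := by
  unfold nub; fun_prop

variable {n k r v i c j : α → ℕ} {C : α → List ℕ} {E W M : α → List (ℕ × ℕ)} {F : α → Table}

@[fun_prop] theorem fp_tcost (hb : FP b) (hk : FP k) (hC : FP C) (hi : FP i) (hj : FP j) :
    FP fun a => tcost (b a) (k a) (C a) (i a) (j a) := by
  unfold tcost; fun_prop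

@[fun_prop] theorem fp_children (hb : FP b) (hE : FP E) (hv : FP v) :
    FP fun a => children (b a) (E a) (v a) := by
  unfold children; fun_prop

@[fun_prop] theorem fp_cell (hb : FP b) (hF : FP F) (hv : FP v) (hi : FP i) :
    FP fun a => cell (b a) (F a) (v a) (i a) := by
  unfold cell; fun_prop

@[fun_prop] theorem fp_edgeCost (hb : FP b) (hk : FP k) (hC : FP C) (hW : FP W) (hF : FP F)
    (hv : FP v) (hi : FP i) (hc : FP c) (hj : FP j) :
    FP fun a => edgeCost (b a) (k a) (C a) (W a) (F a) (v a) (i a) (c a) (j a) := by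
  unfold edgeCost; fun_prop

@[fun_prop] theorem fp_colors (hb : FP b) (hk : FP k) (hi : FP i) :
    FP fun a => colors (b a) (k a) (i a) := by
  unfold colors; fun_prop

@[fun_prop] theorem fp_matrix (hb : FP b) (hk : FP k) (hC : FP C) (hE : FP E) (hW : FP W)
    (hF : FP F) (hv : FP v) (hi : FP i) :
    FP fun a => matrix (b a) (k a) (C a) (E a) (W a) (F a) (v a) (i a) := by
  unfold matrix; fun_prop

@[fun_prop] theorem fp_evaluate (hb : FP b) (hk : FP k) (hC : FP C) (hW : FP W)
    (hF : FP F) (hv : FP v) (hi : FP i) (hM : FP M) :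
    FP fun a => evaluate (b a) (k a) (C a) (W a) (F a) (v a) (i a) (M a) := by
  unfold evaluate; fun_prop

@[fun_prop] theorem fp_solve (hb : FP b) (hk : FP k) (hC : FP C) (hE : FP E) (hW : FP W)
    (hF : FP F) (hv : FP v) (hi : FP i) :
    FP fun a => solve (b a) (k a) (C a) (E a) (W a) (F a) (v a) (i a) := by
  unfold solve; fun_prop

@[fun_prop] theorem fp_update (hb : FP b) (hn : FP n) (hk : FP k) (hC : FP C) (hE : FP E)
    (hW : FP W) (hF : FP F) : FP fun a => update (b a) (n a) (k a) (C a) (E a) (W a) (F a) := by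
  unfold update; fun_prop

@[fun_prop] theorem fp_table (hb : FP b) (hn : FP n) (hk : FP k) (hC : FP C) (hE : FP E)
    (hW : FP W) : FP fun a => table (b a) (n a) (k a) (C a) (E a) (W a) := by
  unfold table; fun_prop

@[fun_prop] theorem fp_nextColor {s : α → ℕ × ℕ × List ℕ} (hb : FP b) (hF : FP F) (hs : FP s)
    (hv : FP v) : FP fun a => nextColor (b a) (F a) (s a) (v a) := by
  unfold nextColor; fun_prop

@[fun_prop] theorem fp_pathColors {p : α → List ℕ} (hb : FP b) (hk : FP k) (hF : FP F)
    (hp : FP p) : FP fun a => pathColors (b a) (k a) (F a) (p a) := by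
  unfold pathColors; fun_prop

@[fun_prop] theorem fp_answer {p : α → List ℕ} (hb : FP b) (hk : FP k) (hr : FP r) (hF : FP F)
    (hp : FP p) : FP fun a => answer (b a) (k a) (r a) (F a) (p a) := by
  unfold answer; fun_prop

@[fun_prop] theorem fp_answers {p : α → List (List ℕ)} (hb : FP b) (hk : FP k) (hr : FP r)
    (hF : FP F) (hp : FP p) : FP fun a => answers (b a) (k a) (r a) (F a) (p a) := by
  unfold answers; fun_prop

variable {paths : α → List (List ℕ)} (cc : Bool)

@[fun_prop] theorem fp_fromEdges (hb : FP b) (hn : FP n) (hk : FP k) (hC : FP C)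
    (hp : FP paths) (hr : FP r) (hE : FP E) :
    FP fun a => fromEdges cc (b a) (n a) (k a) (C a) (paths a) (r a) (E a) := by
  unfold fromEdges; fun_prop

@[fun_prop] theorem fp_fromRoot (hb : FP b) (hn : FP n) (hk : FP k) (hC : FP C)
    (hp : FP paths) (hr : FP r) :
    FP fun a => fromRoot cc (b a) (n a) (k a) (C a) (paths a) (r a) := by
  unfold fromRoot; fun_prop

@[fun_prop] theorem fp_fromPaths (hb : FP b) (hn : FP n) (hk : FP k) (hC : FP C)
    (hp : FP paths) : FP fun a => fromPaths cc (b a) (n a) (k a) (C a) (paths a) := by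
  unfold fromPaths; fun_prop

@[fun_prop] theorem fp_fromParsed {s : α → ℕ × List ℕ × List (List ℕ)} (hb : FP b) (hn : FP n)
    (hk : FP k) (hs : FP s) : FP fun a => fromParsed cc (b a) (n a) (k a) (s a) := by
  unfold fromParsed; fun_prop

theorem fp_algorithm : FP (algorithm cc) := by
  unfold algorithm; fun_prop

end

end SingleSource

/-! ### Correctness of the dynamic program on a rooted tree. -/

namespace SingleSource

open RAM Hungarian

/-- The loops are long enough. -/
structure Bounds (b : Bd) (n k : ℕ) (E W : List (ℕ × ℕ)) : Prop where
  n_le : n ≤ b.n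
  k_lt : k + 1 ≤ b.n
  kk_le : k * k ≤ b.n
  E_le : E.length ≤ b.n
  W_le : W.length ≤ b.n

/-- `E` is the list of the edges, directed away from the root `r`, of a tree on the vertices below
`n` with degrees less than `k`; `d` is the distance from the root. -/
structure IsTree (n k r : ℕ) (E : List (ℕ × ℕ)) (d : ℕ → ℕ) : Prop where
  root_lt : r < n
  nodup : E.Nodup
  fst_lt : ∀ e ∈ E, e.1 < n
  snd_perm : (E.map Prod.snd).Perm ((List.range n).filter fun v => decide (v ≠ r))
  degree : ∀ v < n, (E.filter fun e => decide (e.1 = v)).length + 1 ≤ k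
  depth : ∀ e ∈ E, d e.2 = d e.1 + 1
  depth_root : d r = 0
  depth_lt : ∀ v < n, d v < n

/-- The heads of the edges with tail `v`. -/
def heads (E : List (ℕ × ℕ)) (v : ℕ) : List ℕ := (E.filter fun e => decide (e.1 = v)).map Prod.snd

theorem mem_heads {E : List (ℕ × ℕ)} {v c : ℕ} : c ∈ heads E v ↔ (v, c) ∈ E := by
  simp [heads]

theorem sum_heads {n : ℕ} (E : List (ℕ × ℕ)) (hE : ∀ e ∈ E, e.1 < n) (f : ℕ → ℕ → ℕ) :
    ∑ v ∈ Finset.range n, ((heads E v).map (f v)).sum = (E.map fun e => f e.1 e.2).sum := by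
  induction E with
  | nil => simp [heads]
  | cons e E ih =>
    rw [List.map_cons, List.sum_cons, ← ih fun x hx => hE x (List.mem_cons_of_mem _ hx)]
    have h : ∀ v, ((heads (e :: E) v).map (f v)).sum =
        (if e.1 = v then f v e.2 else 0) + ((heads E v).map (f v)).sum := by
      intro v
      unfold heads
      rw [List.filter_cons]
      by_cases h : e.1 = v <;> simp [h]
    simp only [h, Finset.sum_add_distrib]
    rw [Finset.sum_ite_eq, if_pos (Finset.mem_range.2 (hE e List.mem_cons_self))]

variable {b : Bd} {n k r : ℕ} {C : List ℕ} {E W : List (ℕ × ℕ)} {F F' : Table} {v i : ℕ}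
  {d : ℕ → ℕ}

theorem IsTree.snd_nodup (hT : IsTree n k r E d) : (E.map Prod.snd).Nodup :=
  hT.snd_perm.nodup_iff.2 (List.nodup_range.filter _)

theorem IsTree.mem_snd (hT : IsTree n k r E d) {c : ℕ} : c ∈ E.map Prod.snd ↔ c < n ∧ c ≠ r := by
  rw [hT.snd_perm.mem_iff]; simp

theorem IsTree.heads_nodup (hT : IsTree n k r E d) (v : ℕ) : (heads E v).Nodup :=
  hT.snd_nodup.sublist (List.filter_sublist.map _)

theorem IsTree.heads_lt (hT : IsTree n k r E d) {v c : ℕ} (h : c ∈ heads E v) : c < n :=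
  (hT.mem_snd.1 (List.mem_map.2 ⟨_, mem_heads.1 h, rfl⟩)).1

/-- Each vertex other than the root is the head of exactly one edge. -/
theorem IsTree.sum_snd (hT : IsTree n k r E d) (g : ℕ → ℕ) :
    (E.map fun e => g e.2).sum + g r = ∑ v ∈ Finset.range n, g v := by
  have h1 : (E.map fun e => g e.2).sum = ∑ v ∈ (Finset.range n).filter (· ≠ r), g v := by
    rw [show (E.map fun e => g e.2) = (E.map Prod.snd).map g by simp,
      (hT.snd_perm.map g).sum_eq, ← List.sum_toFinset _ (List.nodup_range.filter _)]
    refine Finset.sum_congr ?_ fun _ _ => rfl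
    ext x; simp
  rw [h1, Finset.filter_ne', Finset.sum_erase_add _ _ (Finset.mem_range.2 hT.root_lt)]

theorem children_eq (hb : Bounds b n k E W) (v : ℕ) : children b E v = heads E v := by
  rw [children, Bd.cut_eq hb.E_le, Bd.cut_eq ((List.length_filter_le _ _).trans hb.E_le)]
  rfl

theorem colors_eq (hb : Bounds b n k E W) (i : ℕ) :
    colors b k i = (List.range k).filter fun j => decide (¬ j = i) := by
  have := hb.k_lt
  rw [colors, Bd.range_eq (by omega), Bd.cut_eq (by simp; omega)]

theorem mem_colors (hb : Bounds b n k E W) {i j : ℕ} : j ∈ colors b k i ↔ j < k ∧ j ≠ i := by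
  rw [colors_eq hb]; simp

theorem colors_nodup (hb : Bounds b n k E W) (i : ℕ) : (colors b k i).Nodup := by
  rw [colors_eq hb]; exact List.nodup_range.filter _

theorem length_colors_le (hb : Bounds b n k E W) (i : ℕ) : (colors b k i).length ≤ k := by
  rw [colors_eq hb]; exact (List.length_filter_le _ _).trans (by simp)

theorem le_length_colors (hb : Bounds b n k E W) (i : ℕ) : k ≤ (colors b k i).length + 1 := by
  have h : List.Subperm (List.range k) (i :: colors b k i) := by
    refine List.subperm_of_subset List.nodup_range fun j hj => ?_
    by_cases hji : j = i
    · simp [hji]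
    · exact List.mem_cons_of_mem _ ((mem_colors hb).2 ⟨List.mem_range.1 hj, hji⟩)
  simpa using h.length_le

theorem edgeCost_eq (hb : Bounds b n k E W) (F : Table) (v i c j : ℕ) :
    edgeCost b k C W F v i c j = tcost b k C i j * W.count (v, c) + (cell b F c j).1 := by
  rw [edgeCost, Bd.cut_eq hb.W_le, Bd.mul_eq]
  exact (List.count_le_length.trans hb.W_le).trans_lt Nat.lt_two_pow_self

theorem length_heads_lt (hT : IsTree n k r E d) (hv : v < n) : (heads E v).length + 1 ≤ k := by
  rw [heads, List.length_map]; exact hT.degree v hv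

theorem matrix_eq (hb : Bounds b n k E W) (hT : IsTree n k r E d) (F : Table) (hv : v < n) :
    matrix b k C E W F v i = entries (heads E v) (colors b k i)
      fun c j => (edgeCost b k C W F v i c j : ℤ) := by
  have h1 := length_heads_lt hT hv
  have h2 := hb.k_lt
  have h3 := length_colors_le hb i
  rw [matrix, children_eq hb, Bd.cut_eq (l := heads E v) (by omega),
    Bd.cut_eq (l := colors b k i) (by omega)]
  simp only [entries]
  congr 1
  funext c
  exact Bd.cut_eq (by simp; omega)

theorem lookup_eq {M : List (ℕ × ℕ)} (hM : (M.map Prod.fst).Nodup) {e : ℕ × ℕ} (he : e ∈ M) :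
    lookup M e.1 = e.2 := by
  have hne : (M.filter fun x => decide (x.1 = e.1)) ≠ [] :=
    List.ne_nil_of_mem (List.mem_filter.2 ⟨he, by simp⟩)
  obtain ⟨t, l, htl⟩ := List.exists_cons_of_ne_nil hne
  have ht : t ∈ M.filter fun x => decide (x.1 = e.1) := by rw [htl]; simp
  rw [lookup, htl, List.headD_cons]
  simp only [List.mem_filter, decide_eq_true_eq] at ht
  rw [eq_of_nodup_map hM ht.1 he ht.2]

/-- The colouring `g` of the edges that leave a vertex is proper if the colour `i` leads to it. -/
def Proper (k : ℕ) (l : List ℕ) (i : ℕ) (g : ℕ → ℕ) : Prop :=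
  (∀ c ∈ l, g c < k ∧ g c ≠ i) ∧ (l.map g).Nodup

/-- At most k - 1 children face at least k - 1 colours other than i, so `hung_spec` applies. A
proper choice of colours for the children is the same as an injection of the rows into the columns.
-/
theorem solve_spec (hb : Bounds b n k E W) (hT : IsTree n k r E d) (F : Table) (hv : v < n) :
    let s := solve b k C E W F v i
    let cost (g : ℕ → ℕ) := ((heads E v).map fun c => edgeCost b k C W F v i c (g c)).sum
    Proper k (heads E v) i (lookup (b.cut s.2)) ∧ s.1 = cost (lookup (b.cut s.2)) ∧
      ∀ g, Proper k (heads E v) i g → s.1 ≤ cost g := by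
  have h1 := length_heads_lt hT hv
  have h2 := hb.k_lt
  have h3 := length_colors_le hb i
  have h4 := le_length_colors hb i
  have hspec := hung_spec (b := b) (rows := heads E v) (cols := colors b k i)
    (c := fun c j => (edgeCost b k C W F v i c j : ℤ)) ((Nat.mul_le_mul (by omega) h3).trans hb.kk_le)
    (by omega) (hT.heads_nodup v) (colors_nodup hb i) (by omega) (by intros; positivity)
  rw [← matrix_eq hb hT F hv] at hspec
  simp only [solve, evaluate, children_eq hb]
  generalize hung b (heads E v) (matrix b k C E W F v i) = M at hspec ⊢
  obtain ⟨k1, k2, k3, k4⟩ := hspec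
  have hlen : M.length ≤ b.n := by
    have := k1.length_eq
    rw [List.length_map] at this
    omega
  rw [Bd.cut_eq hlen, Bd.cut_eq (by simpa using hlen)]
  have hfst : (M.map Prod.fst).Nodup := k1.nodup_iff.2 (hT.heads_nodup v)
  have hmap : ∀ {β : Type} (f : ℕ → ℕ → β), (M.map fun e => f e.1 e.2).Perm
      ((heads E v).map fun c => f c (lookup M c)) := by
    intro β f
    refine List.Perm.trans (.of_eq ?_) (k1.map fun c => f c (lookup M c))
    rw [List.map_map]
    exact List.map_congr_left fun e he => by simp [lookup_eq hfst he]
  refine ⟨⟨fun c hc => ?_, ?_⟩, (hmap (edgeCost b k C W F v i)).sum_eq, fun g hg => ?_⟩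
  · obtain ⟨e, he, rfl⟩ := List.mem_map.1 (k1.mem_iff.2 hc)
    rw [lookup_eq hfst he]
    exact (mem_colors hb).1 (k3 _ (List.mem_map.2 ⟨e, he, rfl⟩))
  · exact (hmap fun _ j => j).nodup_iff.1 k2
  · have := k4 g (fun c hc => (mem_colors hb).2 (hg.1 c hc)) hg.2
    zify
    simpa [Function.comp_def, Nat.cast_list_sum] using this

/-- Only the costs stored at the children enter the matrix. As equal matrices give equal matchings,
the chosen colours agree too. -/
theorem solve_congr (hb : Bounds b n k E W) (hT : IsTree n k r E d) (hv : v < n)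
    (h : ∀ c ∈ heads E v, ∀ j < k, (cell b F c j).1 = (cell b F' c j).1) :
    solve b k C E W F v i = solve b k C E W F' v i := by
  have h1 := length_heads_lt hT hv
  have h2 := hb.k_lt
  have h3 := length_colors_le hb i
  have h4 := le_length_colors hb i
  have hec : ∀ c ∈ heads E v, ∀ j ∈ colors b k i,
      edgeCost b k C W F v i c j = edgeCost b k C W F' v i c j := by
    intro c hc j hj
    rw [edgeCost_eq hb, edgeCost_eq hb, h c hc j ((mem_colors hb).1 hj).1]
  have hm : matrix b k C E W F v i = matrix b k C E W F' v i := by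
    rw [matrix_eq hb hT F hv, matrix_eq hb hT F' hv, entries, entries]
    refine List.flatMap_congr fun c hc => List.map_congr_left fun j hj => ?_
    rw [hec c hc j hj]
  have hspec := hung_spec (b := b) (rows := heads E v) (cols := colors b k i)
    (c := fun c j => (edgeCost b k C W F v i c j : ℤ)) ((Nat.mul_le_mul (by omega) h3).trans hb.kk_le)
    (by omega) (hT.heads_nodup v) (colors_nodup hb i) (by omega) (by intros; positivity)
  rw [← matrix_eq hb hT F hv] at hspec
  obtain ⟨k1, k2, k3, k4⟩ := hspec
  simp only [solve, evaluate, children_eq hb, ← hm]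
  congr 3
  have hlen : (hung b (heads E v) (matrix b k C E W F v i)).length ≤ b.n := by
    have := k1.length_eq
    rw [List.length_map] at this
    omega
  rw [Bd.cut_eq hlen]
  refine List.map_congr_left fun e he => hec _ (k1.mem_iff.1 (List.mem_map.2 ⟨e, he, rfl⟩)) _
    (k3 _ (List.mem_map.2 ⟨e, he, rfl⟩))

theorem cell_update (hb : Bounds b n k E W) (hv : v < n) (hi : i ≤ k) :
    cell b (update b n k C E W F) v i = solve b k C E W F v i := by
  have h1 := hb.n_le
  have h2 := hb.k_lt
  rw [cell, Bd.getD_eq (by omega), Bd.getD_eq (by omega), update, Bd.range_eq h1, Bd.range_eq h2,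
    Bd.cut_eq (by simpa using h2), Bd.cut_eq (by simpa using h1)]
  simp [List.getD_eq_getElem?_getD, hv, Nat.lt_succ_of_le hi]

/-- A child is one level deeper and so stabilises one round earlier. The case `t = 0` is void
because depths are less than n. -/
theorem cell_iterate (hb : Bounds b n k E W) (hT : IsTree n k r E d) (t : ℕ) (hv : v < n)
    (hi : i ≤ k) (ht : n ≤ t + d v) :
    cell b ((update b n k C E W)^[t + 1] []) v i = cell b ((update b n k C E W)^[t] []) v i := by
  induction t generalizing v i with
  | zero => have := hT.depth_lt v hv
            omega
  | succ t ih =>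
    rw [Function.iterate_succ_apply', Function.iterate_succ_apply', cell_update hb hv hi,
      cell_update hb hv hi]
    refine solve_congr hb hT hv fun c hc j hj => ?_
    rw [← Function.iterate_succ_apply' (update b n k C E W)]
    rw [ih (hT.heads_lt hc) hj.le]
    have := hT.depth _ (mem_heads.1 hc)
    dsimp only at this
    omega

/-- The optimality equation: the final table is reproduced by solving the assignment problems that
it defines. -/
theorem cell_table (hb : Bounds b n k E W) (hT : IsTree n k r E d) (hv : v < n) (hi : i ≤ k) :
    cell b (table b n k C E W) v i = solve b k C E W (table b n k C E W) v i := by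
  conv_lhs => rw [table, ← cell_iterate hb hT _ hv hi (by have := hb.n_le; omega)]
  rw [Function.iterate_succ_apply', cell_update hb hv hi]
  rfl

/-- A colouring of the vertices other than the root (which stand for the edges that lead to them)
is proper; the root has the extra colour `k`. -/
def IsColoring (n k r : ℕ) (E : List (ℕ × ℕ)) (χ : ℕ → ℕ) : Prop :=
  χ r = k ∧ ∀ v < n, Proper k (heads E v) (χ v) χ

/-- The total cost. -/
def total (b : Bd) (k : ℕ) (C : List ℕ) (W : List (ℕ × ℕ)) (χ : ℕ → ℕ) : ℕ :=
  (W.map fun e => tcost b k C (χ e.1) (χ e.2)).sum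

theorem IsColoring.le (hT : IsTree n k r E d) {χ : ℕ → ℕ} (hχ : IsColoring n k r E χ)
    (hv : v < n) : χ v ≤ k := by
  by_cases h : v = r
  · rw [h, hχ.1]
  · obtain ⟨e, he, rfl⟩ := List.mem_map.1 (hT.mem_snd.2 ⟨hv, h⟩)
    exact ((hχ.2 _ (hT.fst_lt e he)).1 _ (mem_heads.2 he)).1.le

theorem total_eq (hEn : E.Nodup) (hE : ∀ e, e ∈ E ↔ e ∈ W) (χ : ℕ → ℕ) :
    total b k C W χ = (E.map fun e => tcost b k C (χ e.1) (χ e.2) * W.count e).sum := by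
  rw [total, Finset.sum_list_map_count, ← List.sum_toFinset _ hEn]
  refine Finset.sum_congr ?_ fun e _ => by
    rw [smul_eq_mul, mul_comm]; congr!
  ext e
  simp [hE]

/-- Valid for any table. The local cost at v consists of the weighted traversals at v and the
entries of its children; over all v, the former give the total cost and the latter every entry
except that of the root. -/
theorem sum_cells (hb : Bounds b n k E W) (hT : IsTree n k r E d) (hE : ∀ e, e ∈ E ↔ e ∈ W)
    (F : Table) (χ : ℕ → ℕ) (hr : χ r = k) :
    ∑ v ∈ Finset.range n,
      ((heads E v).map fun c => edgeCost b k C W F v (χ v) c (χ c)).sum + (cell b F r k).1 =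
    total b k C W χ + ∑ v ∈ Finset.range n, (cell b F v (χ v)).1 := by
  rw [sum_heads E hT.fst_lt fun v c => edgeCost b k C W F v (χ v) c (χ c), total_eq hT.nodup hE,
    ← hT.sum_snd fun v => (cell b F v (χ v)).1, hr]
  simp only [edgeCost_eq hb, List.sum_map_add]
  ring

/-- By `solve_spec`, each entry is at most the local cost under χ. Summed over the vertices,
`sum_cells` cancels all entries but that of the root; no induction over the tree is needed. -/
theorem le_total (hb : Bounds b n k E W) (hT : IsTree n k r E d) (hE : ∀ e, e ∈ E ↔ e ∈ W)
    {χ : ℕ → ℕ} (hχ : IsColoring n k r E χ) :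
    (cell b (table b n k C E W) r k).1 ≤ total b k C W χ := by
  have h1 := sum_cells (C := C) hb hT hE (table b n k C E W) χ hχ.1
  have h2 : ∑ v ∈ Finset.range n, (cell b (table b n k C E W) v (χ v)).1 ≤
      ∑ v ∈ Finset.range n,
        ((heads E v).map fun c => edgeCost b k C W (table b n k C E W) v (χ v) c (χ c)).sum := by
    refine Finset.sum_le_sum fun v hv => ?_
    have hv := Finset.mem_range.1 hv
    rw [cell_table hb hT hv (hχ.le hT hv)]
    exact (solve_spec hb hT _ hv).2.2 χ (hχ.2 v hv)
  omega

/-- `χ` is the colouring given by the table `F`. -/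
def Follows (b : Bd) (k r : ℕ) (E : List (ℕ × ℕ)) (F : Table) (χ : ℕ → ℕ) : Prop :=
  χ r = k ∧ ∀ e ∈ E, χ e.2 = lookup (b.cut (cell b F e.1 (χ e.1)).2) e.2

theorem exists_follows (hT : IsTree n k r E d) (F : Table) : ∃ χ, Follows b k r E F χ := by
  have hpar : ∀ e ∈ E, ((E.filter fun x => decide (x.2 = e.2)).headD (0, 0)) = e := by
    intro e he
    have hne : (E.filter fun x => decide (x.2 = e.2)) ≠ [] :=
      List.ne_nil_of_mem (List.mem_filter.2 ⟨he, by simp⟩)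
    obtain ⟨t, l, htl⟩ := List.exists_cons_of_ne_nil hne
    have ht : t ∈ E.filter fun x => decide (x.2 = e.2) := by rw [htl]; simp
    rw [htl, List.headD_cons]
    simp only [List.mem_filter, decide_eq_true_eq] at ht
    exact eq_of_nodup_map hT.snd_nodup ht.1 he ht.2
  let par (c : ℕ) : ℕ := ((E.filter fun x => decide (x.2 = c)).headD (0, 0)).1
  -- Recursion on the depth: the colour of c follows from that of its parent, one level up, and the
  -- root at depth 0 has colour k.
  let col : ℕ → ℕ → ℕ := fun t => Nat.rec (fun _ => k)
    (fun _ f c => lookup (b.cut (cell b F (par c) (f (par c))).2) c) t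
  refine ⟨fun c => col (d c) c, (congrFun (congrArg col hT.depth_root) r).trans rfl, fun e he => ?_⟩
  have hp : par e.2 = e.1 := by simp only [par, hpar e he]
  have hcol : ∀ t c, col (t + 1) c = lookup (b.cut (cell b F (par c) (col t (par c))).2) c :=
    fun _ _ => rfl
  dsimp only
  rw [hT.depth e he, hcol, hp]

theorem Follows.isColoring (hb : Bounds b n k E W) (hT : IsTree n k r E d)
    {χ : ℕ → ℕ} (h : Follows b k r E (table b n k C E W) χ) : IsColoring n k r E χ := by
  -- `cell_table` only speaks of colours up to k, so the range of χ is settled first, by induction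
  -- on the depth.
  have key : ∀ t, ∀ v < n, d v ≤ t → χ v ≤ k := by
    intro t
    induction t with
    | zero =>
      intro v hv hd
      by_cases hr : v = r
      · rw [hr, h.1]
      · obtain ⟨e, he, rfl⟩ := List.mem_map.1 (hT.mem_snd.2 ⟨hv, hr⟩)
        have := hT.depth e he
        omega
    | succ t ih =>
      intro v hv hd
      by_cases hr : v = r
      · rw [hr, h.1]
      · obtain ⟨e, he, rfl⟩ := List.mem_map.1 (hT.mem_snd.2 ⟨hv, hr⟩)
        have h1 := hT.depth e he
        have h2 := ih e.1 (hT.fst_lt e he) (by omega)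
        rw [h.2 e he, cell_table hb hT (hT.fst_lt e he) h2]
        exact ((solve_spec hb hT _ (hT.fst_lt e he)).1.1 _ (mem_heads.2 he)).1.le
  refine ⟨h.1, fun v hv => ?_⟩
  have h1 := (solve_spec (C := C) (i := χ v) hb hT (table b n k C E W) hv).1
  rw [← cell_table hb hT hv (key _ v hv le_rfl)] at h1
  have h2 : ∀ c ∈ heads E v, χ c = lookup (b.cut (cell b (table b n k C E W) v (χ v)).2) c :=
    fun c hc => h.2 _ (mem_heads.1 hc)
  refine ⟨fun c hc => by rw [h2 c hc]; exact h1.1 c hc, ?_⟩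
  rw [List.map_congr_left h2]
  exact h1.2

/-- The computation of `le_total`, with equality at each vertex since χ uses the matchings stored in
the table. -/
theorem Follows.total_eq (hb : Bounds b n k E W) (hT : IsTree n k r E d)
    (hE : ∀ e, e ∈ E ↔ e ∈ W) {χ : ℕ → ℕ} (h : Follows b k r E (table b n k C E W) χ) :
    total b k C W χ = (cell b (table b n k C E W) r k).1 := by
  have hχ := h.isColoring hb hT
  have h1 := sum_cells (C := C) hb hT hE (table b n k C E W) χ hχ.1
  have h2 : ∑ v ∈ Finset.range n, (cell b (table b n k C E W) v (χ v)).1 =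
      ∑ v ∈ Finset.range n,
        ((heads E v).map fun c => edgeCost b k C W (table b n k C E W) v (χ v) c (χ c)).sum := by
    refine Finset.sum_congr rfl fun v hv => ?_
    have hv := Finset.mem_range.1 hv
    have h3 := (solve_spec (C := C) (i := χ v) hb hT (table b n k C E W) hv).2.1
    rw [← cell_table hb hT hv (hχ.le hT hv)] at h3
    rw [h3]
    refine congrArg _ (List.map_congr_left fun c hc => ?_)
    rw [h.2 _ (mem_heads.1 hc)]
  omega

theorem Follows.optimal (hb : Bounds b n k E W) (hT : IsTree n k r E d)
    (hE : ∀ e, e ∈ E ↔ e ∈ W) {χ χ' : ℕ → ℕ} (h : Follows b k r E (table b n k C E W) χ)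
    (hχ' : IsColoring n k r E χ') : total b k C W χ ≤ total b k C W χ' := by
  rw [h.total_eq hb hT hE]
  exact le_total hb hT hE hχ'

theorem Follows.pathColors {χ : ℕ → ℕ} (h : Follows b k r E F χ) {q : List ℕ}
    (hq : q.length ≤ b.n) (hE : ∀ e ∈ pairs (r :: q), e ∈ E) :
    pathColors b k F (r :: q) = (q.map χ).reverse := by
  have H : ∀ (q : List ℕ) (v : ℕ) (l : List ℕ), (∀ e ∈ pairs (v :: q), e ∈ E) →
      (q.foldl (fun s v => (v, nextColor b F s v, nextColor b F s v :: s.2.2)) (v, χ v, l)).2.2 =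
        (q.map χ).reverse ++ l := by
    intro q
    induction q with
    | nil => simp
    | cons c q ih =>
      intro v l hE
      have hp : pairs (v :: c :: q) = (v, c) :: pairs (c :: q) := rfl
      rw [hp] at hE
      have hc := h.2 (v, c) (hE _ List.mem_cons_self)
      simp only [List.foldl_cons, nextColor] at hc ⊢
      rw [← hc]
      have := ih c (χ c :: l) fun e he => hE e (List.mem_cons_of_mem _ he)
      simp only [nextColor] at this
      rw [this]
      simp
  rw [SingleSource.pathColors]
  simp only [List.tail_cons, List.headD_cons, Bd.cut_eq hq]
  rw [← h.1, H q r [] hE, List.append_nil]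

end SingleSource

/-! ### Correctness of parsing, of the common denominator and of the search for the root. -/

namespace SingleSource

open RAM

variable {b : Bd}

theorem parse_eq (ps : List (List ℕ)) (rest : List ℕ) (hps : ps.length ≤ b.n)
    (hp : ∀ p ∈ ps, p.length ≤ b.n) :
    parse b ps.length (ps.flatMap (fun p => p.length :: p) ++ rest) = (0, rest, ps.reverse) := by
  have H : ∀ (N : ℕ) (ps acc : List (List ℕ)), ps.length ≤ N → (∀ p ∈ ps, p.length ≤ b.n) →
      (fun s : ℕ × List ℕ × List (List ℕ) => if 0 < s.1 then
        (s.1 - 1, b.drop (s.2.1.headD 0) s.2.1.tail, b.take (s.2.1.headD 0) s.2.1.tail :: s.2.2)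
          else s)^[N] (ps.length, ps.flatMap (fun p => p.length :: p) ++ rest, acc) =
        (0, rest, ps.reverse ++ acc) := by
    intro N
    induction N with
    | zero =>
      intro ps acc h _
      obtain rfl := List.length_eq_zero_iff.1 (Nat.le_zero.1 h)
      rfl
    | succ N ih =>
      intro ps acc h hp
      rw [Function.iterate_succ_apply]
      cases ps with
      | nil => simpa using ih [] acc (by simp) (by simp)
      | cons p ps =>
        have h1 : p.length ≤ b.n := hp p List.mem_cons_self
        have := ih ps (p :: acc) (by simpa using h) fun q hq => hp q (List.mem_cons_of_mem _ hq)
        simp only [List.reverse_cons, List.append_assoc, List.singleton_append]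
        rw [← this]
        congr 1
        simp [Bd.drop_eq h1, Bd.take_eq h1]
  exact (H b.n ps [] hps hp).trans (by rw [List.append_nil])

/-- Invariant: the numerators collected so far, over the current denominator Q, are the costs read.
A new fraction x.1 / x.2 contributes Q · x.1, while Q and the older numerators are multiplied by
x.2. The final Q is `P`. -/
theorem scale_spec (L : List (ℕ × ℕ)) (hL : L.length ≤ b.n)
    (hlt : ∀ x ∈ L, x.1 < 2 ^ b.n ∧ x.2 < 2 ^ b.n ∧ 0 < x.2) :
    ∃ P : ℕ, 0 < P ∧ ((b.cut (scale b (L.flatMap fun x => [x.1, x.2])).2.2).reverse).map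
      (fun y : ℕ => (y : ℚ≥0)) = L.map fun x => P * ((x.1 : ℚ≥0) / x.2) := by
  have H : ∀ (N : ℕ) (L : List (ℕ × ℕ)) (Q : ℕ) (out : List ℕ), L.length ≤ N →
      out.length + L.length ≤ b.n → 0 < Q →
      (∀ x ∈ L, x.1 < 2 ^ b.n ∧ x.2 < 2 ^ b.n ∧ 0 < x.2) →
      ∃ (P : ℕ) (out' : List ℕ), 0 < P ∧ out'.length = out.length + L.length ∧
        (fun s : List ℕ × ℕ × List ℕ => if s.1.isEmpty = true then s else
          (s.1.tail.tail, b.mul s.2.1 (s.1.tail.headD 0), b.mul s.2.1 (s.1.headD 0) ::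
            (b.cut s.2.2).map fun x => b.mul x (s.1.tail.headD 0)))^[N]
              (L.flatMap fun x => [x.1, x.2], Q, out) = ([], P, out') ∧
        out'.reverse.map (fun y : ℕ => (y : ℚ≥0)) =
          (out.reverse.map fun y : ℕ => P * ((y : ℚ≥0) / Q)) ++ L.map fun x => P * ((x.1 : ℚ≥0) / x.2) := by
    intro N
    induction N with
    | zero =>
      intro L Q out h _ hQ _
      obtain rfl := List.length_eq_zero_iff.1 (Nat.le_zero.1 h)
      refine ⟨Q, out, hQ, by simp, rfl, ?_⟩
      simp only [List.map_nil, List.append_nil]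
      refine List.map_congr_left fun y _ => ?_
      have : (Q : ℚ≥0) ≠ 0 := by exact_mod_cast hQ.ne'
      field_simp
    | succ N ih =>
      intro L Q out h ho hQ hlt
      rw [Function.iterate_succ_apply]
      cases L with
      | nil =>
        simpa using ih [] Q out (by simp) ho hQ (by simp)
      | cons x L =>
        obtain ⟨h1, h2, h3⟩ := hlt x List.mem_cons_self
        simp only [List.length_cons] at h ho
        obtain ⟨P, out', k1, k2, k3, k4⟩ := ih L (Q * x.2) (Q * x.1 :: out.map (· * x.2))
          (by omega) (by simp; omega) (Nat.mul_pos hQ h3) fun y hy =>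
          hlt y (List.mem_cons_of_mem _ hy)
        refine ⟨P, out', k1, by simp at k2 ⊢; omega, ?_, ?_⟩
        · rw [← k3]
          congr 1
          -- The second factor of each product is a number of the input; the growing numbers stand
          -- first, where no bound is needed.
          simp [Bd.cut_eq (b := b) (l := out) (by omega), Bd.mul_eq h1, Bd.mul_eq h2]
        · rw [k4]
          have hQ' : (Q : ℚ≥0) ≠ 0 := by exact_mod_cast hQ.ne'
          have hx' : (x.2 : ℚ≥0) ≠ 0 := by exact_mod_cast h3.ne'
          simp only [List.reverse_cons, List.map_append, List.map_cons, List.map_nil,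
            List.append_assoc, List.singleton_append, ← List.map_reverse, List.map_map]
          congr 1
          · refine List.map_congr_left fun y _ => ?_
            simp only [Function.comp_apply]
            push_cast
            field_simp
          · congr 1
            push_cast
            field_simp
  obtain ⟨P, out', k1, k2, k3, k4⟩ := H b.n L 1 [] hL (by simpa using hL) one_pos hlt
  refine ⟨P, k1, ?_⟩
  rw [scale, k3, Bd.cut_eq (by dsimp only; simp at k2; omega), k4]
  simp

theorem getElem?_flatMap_of_length {α β : Type} (l : List α) (f : α → List β) (k : ℕ)
    (hf : ∀ x, (f x).length = k) (i j : ℕ) (hj : j < k) :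
    (l.flatMap f)[i * k + j]? = l[i]?.bind fun x => (f x)[j]? := by
  induction l generalizing i with
  | nil => simp
  | cons x l ih =>
    rw [List.flatMap_cons]
    cases i with
    | zero =>
      rw [Nat.zero_mul, Nat.zero_add, List.getElem?_append_left (by rw [hf]; exact hj)]
      simp
    | succ i =>
      rw [List.getElem?_append_right (by rw [hf, Nat.succ_mul]; omega), hf,
        show (i + 1) * k + j - k = i * k + j by rw [Nat.succ_mul]; omega, ih]
      simp

theorem tcost_spec {k P : ℕ} {C : List ℕ} {tc : Fin k → Fin k → ℚ≥0}
    (hC : C.map (fun y : ℕ => (y : ℚ≥0)) = ((List.finRange k).flatMap fun i =>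
      (List.finRange k).map fun j => P * tc i j)) (hkk : k * k ≤ b.n) (i j : Fin k) :
    (tcost b k C i j : ℚ≥0) = P * tc i j := by
  have hi := i.2
  have hj := j.2
  have hk : k ≤ b.n := (Nat.le_mul_self k).trans hkk
  have hidx : i.1 * k + j.1 < k * k := by
    calc i.1 * k + j.1 < i.1 * k + k := by omega
      _ = (i.1 + 1) * k := by ring
      _ ≤ k * k := Nat.mul_le_mul_right _ hi
  rw [tcost, if_pos hi, Bd.mul_eq (lt_of_le_of_lt hk Nat.lt_two_pow_self), Bd.getD_eq (by omega)]
  have h := congrArg (fun l => l[i.1 * k + j.1]?) hC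
  rw [getElem?_flatMap_of_length _ _ k (by simp) _ _ hj, List.getElem?_map] at h
  simp only [List.getElem?_map, hi, List.getElem?_eq_getElem, List.length_finRange,
    List.getElem_finRange, Option.bind_some, hj, Option.map_some] at h
  rw [List.getD_eq_getElem?_getD]
  rcases hc : C[i.1 * k + j.1]? with _ | x
  · rw [hc] at h; simp at h
  · rw [hc] at h
    simpa using h

theorem tcost_of_le {k : ℕ} {C : List ℕ} {i j : ℕ} (h : k ≤ i) : tcost b k C i j = 0 := by
  rw [tcost, if_neg (by omega)]

theorem nub_spec {l : List (ℕ × ℕ)} (hl : l.length ≤ b.n) :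
    (nub b l).Nodup ∧ (nub b l).length ≤ l.length ∧ ∀ e, e ∈ nub b l ↔ e ∈ l := by
  rw [nub, Bd.cut_eq hl]
  induction l with
  | nil => simp
  | cons x l ih =>
    simp only [List.length_cons] at hl
    obtain ⟨h1, h2, h3⟩ := ih (by omega)
    rw [List.foldr_cons]
    generalize l.foldr (fun e acc => if (b.cut acc).any (fun x => decide (x = e)) = true then acc
      else e :: acc) [] = acc at h1 h2 h3 ⊢
    rw [Bd.cut_eq (by omega)]
    split
    · rename_i h
      simp only [List.any_eq_true, decide_eq_true_eq, exists_eq_right] at h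
      refine ⟨h1, by simp; omega, fun e => ?_⟩
      rw [h3, List.mem_cons]
      constructor
      · exact .inr
      · rintro (rfl | he)
        · exact (h3 _).1 h
        · exact he
    · rename_i h
      simp only [List.any_eq_true, decide_eq_true_eq, exists_eq_right] at h
      exact ⟨List.nodup_cons.2 ⟨h, h1⟩, by simp; omega, fun e => by simp [h3]⟩

theorem isRoot_iff {paths : List (List ℕ)} (hp : paths.length ≤ b.n)
    (hpl : ∀ p ∈ paths, p.length ≤ b.n) (r : ℕ) :
    isRoot b paths r = true ↔ ∀ p ∈ paths, p.headD 0 = r ∨ p.reverse.headD 0 = r := by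
  rw [isRoot, Bd.cut_eq hp, List.all_eq_true]
  refine forall₂_congr fun p hp => ?_
  rw [Bd.cut_eq (hpl p hp), decide_eq_true_eq]
  tauto

theorem root_spec {paths : List (List ℕ)} (hp : paths.length ≤ b.n)
    (hpl : ∀ p ∈ paths, p.length ≤ b.n) {n : ℕ} (hn : n ≤ b.n)
    (h : ∃ r < n, ∀ p ∈ paths, p.headD 0 = r ∨ p.reverse.headD 0 = r) :
    root b n paths < n ∧
      ∀ p ∈ paths, p.headD 0 = root b n paths ∨ p.reverse.headD 0 = root b n paths := by
  obtain ⟨r, hr, h⟩ := h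
  have hne : ((List.range n).filter fun r => isRoot b paths r) ≠ [] :=
    List.ne_nil_of_mem (List.mem_filter.2 ⟨List.mem_range.2 hr, (isRoot_iff hp hpl r).2 h⟩)
  obtain ⟨t, l, htl⟩ := List.exists_cons_of_ne_nil hne
  have ht : t ∈ (List.range n).filter fun r => isRoot b paths r := by rw [htl]; simp
  rw [List.mem_filter, List.mem_range, isRoot_iff hp hpl] at ht
  rw [root, Bd.range_eq hn, Bd.cut_eq (by simpa using hn), htl, List.headD_cons]
  exact ht

end SingleSource

namespace SingleSource

open RAM EdgeColoring

/-! ### Paths in a tree -/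

/-- Shortest paths from r to a and to a', each prolonged to b, are shortest and hence paths; in a
tree they coincide, and so do their penultimate vertices. -/
theorem parent_unique {V : Type*} {G : SimpleGraph V} (hG : G.IsTree) {r a a' b : V}
    (h : G.Adj a b) (h' : G.Adj a' b) (hd : G.dist r b = G.dist r a + 1)
    (hd' : G.dist r b = G.dist r a' + 1) : a = a' := by
  obtain ⟨p, -, hpl⟩ := hG.connected.exists_path_of_dist r a
  obtain ⟨q, -, hql⟩ := hG.connected.exists_path_of_dist r a'
  have h1 : (p.concat h).IsPath :=
    SimpleGraph.Walk.isPath_of_length_eq_dist _ (by rw [SimpleGraph.Walk.length_concat, hpl, hd])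
  have h2 : (q.concat h').IsPath :=
    SimpleGraph.Walk.isPath_of_length_eq_dist _ (by rw [SimpleGraph.Walk.length_concat, hql, hd'])
  have := congrArg SimpleGraph.Walk.penultimate ((hG.existsUnique_path r b).unique h1 h2)
  simpa using this

/-- The ordered pairs of consecutive entries. -/
def steps {α : Type} (l : List α) : List (α × α) := l.zip l.tail

theorem steps_cons_cons {α : Type} (a b : α) (l : List α) :
    steps (a :: b :: l) = (a, b) :: steps (b :: l) := rfl

theorem pathEdges_eq {α : Type} (l : List α) :
    pathEdges l = (steps l).map fun x => s(x.1, x.2) := rfl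

theorem pairs_map {α : Type} (f : α → ℕ) (l : List α) :
    pairs (l.map f) = (steps l).map fun e => (f e.1, f e.2) := by
  rw [pairs, steps, ← List.map_tail, List.zip_map]
  rfl

theorem length_steps_le {α : Type} (l : List α) : (steps l).length ≤ l.length := by
  simp [steps]

theorem steps_ne {α : Type} {l : List α} (hl : l.Nodup) : ∀ e ∈ steps l, e.1 ≠ e.2 := by
  induction l with
  | nil => simp [steps]
  | cons a l ih =>
    cases l with
    | nil => simp [steps]
    | cons b l =>
      intro e he
      rw [List.nodup_cons] at hl
      rcases List.mem_cons.1 he with rfl | he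
      · rintro h
        simp only at h
        exact hl.1 (h ▸ List.mem_cons_self)
      · exact ih hl.2 e he

theorem mem_of_mem_steps {α : Type} {l : List α} {e : α × α} (h : e ∈ steps l) :
    e.1 ∈ l ∧ e.2 ∈ l.tail := List.of_mem_zip h

theorem exists_mem_steps {α : Type} {l : List α} {v : α} (h : v ∈ l.tail) :
    ∃ a, (a, v) ∈ steps l := by
  induction l with
  | nil => simp at h
  | cons a l ih =>
    cases l with
    | nil => simp at h
    | cons b l =>
      rcases List.mem_cons.1 h with rfl | h
      · exact ⟨a, List.mem_cons_self⟩
      · obtain ⟨x, hx⟩ := ih h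
        exact ⟨x, List.mem_cons_of_mem _ hx⟩

/-- A path that has begun to descend cannot turn back: the only neighbour of b closer to r is its
parent, the vertex a just left. -/
theorem dist_steps {V : Type} {G : SimpleGraph V} (hG : G.IsTree) (r : V) (l : List V) :
    ∀ a b, (∀ e ∈ steps (a :: b :: l), G.Adj e.1 e.2) → (a :: b :: l).Nodup →
      G.dist r b = G.dist r a + 1 →
      ∀ e ∈ steps (a :: b :: l), G.dist r e.2 = G.dist r e.1 + 1 := by
  induction l with
  | nil =>
    intro a b _ _ h e he
    rcases List.mem_cons.1 he with rfl | he
    · exact h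
    · simp at he
  | cons c l ih =>
    intro a b hadj hnd h e he
    rcases List.mem_cons.1 he with rfl | he
    · exact h
    · refine ih b c (fun e he => hadj e (List.mem_cons_of_mem _ he)) (List.nodup_cons.1 hnd).2 ?_
        e he
      have hab : G.Adj a b := hadj (a, b) List.mem_cons_self
      have hbc : G.Adj b c := hadj (b, c) (List.mem_cons_of_mem _ List.mem_cons_self)
      rcases hG.dist_eq_dist_add_one_of_adj r hbc with h1 | h1
      · have := parent_unique hG hab hbc.symm h h1
        subst this
        simp at hnd
      · exact h1

theorem consecutive_reverse {α : Type} (l : List α) :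
    consecutive l.reverse = (consecutive l).reverse := by
  have H : ∀ (l : List α) (x y : α), consecutive (l ++ [y, x]) = consecutive (l ++ [y]) ++ [s(y, x)] := by
    intro l
    induction l with
    | nil => intro x y; rfl
    | cons a l ih =>
      intro x y
      cases l with
      | nil => rfl
      | cons c l =>
        have := ih x y
        simp only [consecutive, List.cons_append, List.tail_cons, List.zip_cons_cons,
          List.map_cons] at this ⊢
        rw [this]
  induction l with
  | nil => rfl
  | cons a l ih =>
    cases l with
    | nil => rfl
    | cons c l =>
      have h1 : consecutive (a :: c :: l) = s(a, c) :: consecutive (c :: l) := rfl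
      simp only [h1, List.reverse_cons, List.append_assoc, List.singleton_append] at ih ⊢
      rw [H, ih, Sym2.eq_swap]

theorem pathEdges_reverse {α : Type} (l : List α) : pathEdges l.reverse = (pathEdges l).reverse :=
  consecutive_reverse l

theorem traversals_reverse {α : Type} (l : List α) :
    traversals l.reverse = (traversals l).reverse := by
  rw [traversals, pathEdges_reverse, consecutive_reverse]
  rfl

/-- The traversal at the tail of an edge, if `par` gives the parents of the vertices. -/
def turn {α : Type} (par : α → α) (e : α × α) : Sym2 (Sym2 α) := s(s(par e.1, e.1), s(e.1, e.2))

/-- On a descending path, the edge before (x, y) joins x to its parent, so a traversal is determined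
by its second arc. -/
theorem traversals_eq {α : Type} (par : α → α) (l : List α) : ∀ a,
    (∀ e ∈ steps (a :: l), par e.2 = e.1) → traversals (a :: l) = (steps l).map (turn par) := by
  induction l with
  | nil => intro a _; rfl
  | cons b l ih =>
    intro a h
    cases l with
    | nil => rfl
    | cons c l =>
      have h1 : traversals (a :: b :: c :: l) = s(s(a, b), s(b, c)) :: traversals (b :: c :: l) := rfl
      have h2 : par b = a := h (a, b) List.mem_cons_self
      rw [h1, ih b fun e he => h e (List.mem_cons_of_mem _ he), steps_cons_cons, List.map_cons, turn,
        h2]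

/-! ### Instances on a tree with a common endpoint of the paths -/

variable (I : PathInstance) (r : Fin I.n)

/-- The path in the direction that starts in `r`. -/
def directed (p : List (Fin I.n)) : List (Fin I.n) := if p.head? = some r then p else p.reverse

/-- The edges of all paths, directed away from `r`, with multiplicity. -/
def arcs : List (Fin I.n × Fin I.n) := I.paths.flatMap fun p => steps (directed I r p)

/-- The graph is a tree, and `r` is a common endpoint of the paths. -/
structure IsRooted : Prop where
  tree : I.graph.IsTree
  endpoint : I.IsCommonEndpoint r

variable {I r}

theorem directed_eq_or (p : List (Fin I.n)) : directed I r p = p ∨ directed I r p = p.reverse := by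
  unfold directed
  split <;> simp

theorem IsRooted.directed_eq (h : IsRooted I r) {p : List (Fin I.n)} (hp : p ∈ I.paths) :
    ∃ a q, directed I r p = r :: a :: q ∧ (r :: a :: q).Nodup := by
  have h1 : (directed I r p).head? = some r := by
    unfold directed
    split
    · assumption
    · rename_i h1
      rw [List.head?_reverse]
      exact (h.endpoint p hp).resolve_left h1
  have h2 : (directed I r p).Nodup ∧ 2 ≤ (directed I r p).length := by
    have := I.paths_simple p hp
    have := I.paths_length p hp
    rcases directed_eq_or (r := r) p with h | h <;> rw [h]
    · tauto
    · rw [List.nodup_reverse, List.length_reverse]; tauto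
  rcases hl : directed I r p with _ | ⟨x, _ | ⟨a, q⟩⟩
  · rw [hl] at h1; simp at h1
  · rw [hl] at h2; simp at h2
  · rw [hl] at h1 h2
    obtain rfl : x = r := by simpa using h1
    exact ⟨a, q, rfl, h2.1⟩

theorem mem_pathEdges_directed {p : List (Fin I.n)} {e : Sym2 (Fin I.n)} :
    e ∈ pathEdges (directed I r p) ↔ e ∈ pathEdges p := by
  rcases directed_eq_or (r := r) p with h | h <;> rw [h]
  rw [pathEdges_reverse, List.mem_reverse]

theorem IsRooted.mem_edgeSet (h : IsRooted I r) {e : Sym2 (Fin I.n)} :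
    e ∈ I.graph.edgeSet ↔ ∃ x ∈ arcs I r, e = s(x.1, x.2) := by
  rw [PathInstance.graph, unionGraph, SimpleGraph.edgeSet_fromEdgeSet]
  simp only [Set.mem_sdiff, Set.mem_ofPred_eq, arcs, List.mem_flatMap]
  constructor
  · rintro ⟨⟨p, hp, he⟩, -⟩
    rw [← mem_pathEdges_directed (r := r), pathEdges_eq, List.mem_map] at he
    obtain ⟨x, hx, rfl⟩ := he
    exact ⟨x, ⟨p, hp, hx⟩, rfl⟩
  · rintro ⟨x, ⟨p, hp, hx⟩, rfl⟩
    refine ⟨⟨p, hp, ?_⟩, ?_⟩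
    · rw [← mem_pathEdges_directed (r := r), pathEdges_eq, List.mem_map]
      exact ⟨x, hx, rfl⟩
    · obtain ⟨a, q, h1, h2⟩ := h.directed_eq hp
      rw [h1] at hx
      simpa using steps_ne h2 x hx

theorem IsRooted.adj (h : IsRooted I r) {e : Fin I.n × Fin I.n} (he : e ∈ arcs I r) :
    I.graph.Adj e.1 e.2 :=
  (SimpleGraph.mem_edgeSet _).1 (h.mem_edgeSet.2 ⟨e, he, rfl⟩)

theorem IsRooted.dist (h : IsRooted I r) {e : Fin I.n × Fin I.n} (he : e ∈ arcs I r) :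
    I.graph.dist r e.2 = I.graph.dist r e.1 + 1 := by
  obtain ⟨p, hp, hx⟩ := List.mem_flatMap.1 he
  obtain ⟨a, q, h1, h2⟩ := h.directed_eq hp
  have hadj : ∀ e ∈ steps (r :: a :: q), I.graph.Adj e.1 e.2 := fun e he =>
    h.adj (List.mem_flatMap.2 ⟨p, hp, by rwa [h1]⟩)
  rw [h1] at hx
  refine dist_steps h.tree r q r a hadj h2 ?_ e hx
  have := hadj (r, a) List.mem_cons_self
  rw [SimpleGraph.dist_self, zero_add]
  exact SimpleGraph.dist_eq_one_iff_adj.2 this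

theorem IsRooted.eq_of_snd (h : IsRooted I r) {e f : Fin I.n × Fin I.n} (he : e ∈ arcs I r)
    (hf : f ∈ arcs I r) (hef : e.2 = f.2) : e = f := by
  refine Prod.ext (parent_unique h.tree (h.adj he) ?_ (h.dist he) ?_) hef
  · rw [hef]; exact h.adj hf
  · rw [hef]; exact h.dist hf

theorem IsRooted.snd_ne (h : IsRooted I r) {e : Fin I.n × Fin I.n} (he : e ∈ arcs I r) :
    e.2 ≠ r := by
  intro h1
  have := h.dist he
  rw [h1, SimpleGraph.dist_self] at this
  omega

theorem IsRooted.exists_arc (h : IsRooted I r) {v : Fin I.n} (hv : v ≠ r) :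
    ∃ a, (a, v) ∈ arcs I r := by
  obtain ⟨p, hp, hvp⟩ := I.paths_cover v
  have hvp' : v ∈ directed I r p := by
    rcases directed_eq_or (r := r) p with h | h <;> rw [h]
    · exact hvp
    · exact List.mem_reverse.2 hvp
  obtain ⟨a, q, h1, h2⟩ := h.directed_eq hp
  rw [h1] at hvp'
  obtain ⟨x, hx⟩ := exists_mem_steps (l := r :: a :: q) ((List.mem_cons.1 hvp').resolve_left hv)
  exact ⟨x, List.mem_flatMap.2 ⟨p, hp, by rwa [h1]⟩⟩

/-- Both directions of an edge cannot be arcs, as the distance from r grows along each arc. -/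
theorem IsRooted.eq_of_edge (h : IsRooted I r) {e f : Fin I.n × Fin I.n} (he : e ∈ arcs I r)
    (hf : f ∈ arcs I r) (hef : s(e.1, e.2) = s(f.1, f.2)) : e = f := by
  rcases Sym2.eq_iff.1 hef with ⟨-, h2⟩ | ⟨h1, h2⟩
  · exact h.eq_of_snd he hf h2
  · have h3 := h.dist he
    have h4 := h.dist hf
    rw [h1, h2] at h3
    omega

/-- The pair of the numbers of the vertices. -/
def valPair (e : Fin I.n × Fin I.n) : ℕ × ℕ := (e.1, e.2)

theorem valPair_injective : Function.Injective (valPair (I := I)) := by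
  rintro ⟨a, b⟩ ⟨c, d⟩ h
  simp only [valPair, Prod.mk.injEq] at h
  exact Prod.ext (Fin.ext h.1) (Fin.ext h.2)

theorem IsRooted.isTree (h : IsRooted I r) {E : List (ℕ × ℕ)} (hE : E.Nodup)
    (hEm : ∀ e, e ∈ E ↔ e ∈ (arcs I r).map valPair) :
    IsTree I.n I.k r E fun v => if hv : v < I.n then I.graph.dist r ⟨v, hv⟩ else 0 := by
  have hE' : ∀ e ∈ E, ∃ x ∈ arcs I r, e = ((x.1 : ℕ), (x.2 : ℕ)) := by
    intro e he
    obtain ⟨x, hx, rfl⟩ := List.mem_map.1 ((hEm e).1 he)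
    exact ⟨x, hx, rfl⟩
  refine ⟨r.2, hE, ?_, ?_, ?_, ?_, ?_, ?_⟩
  · intro e he
    obtain ⟨x, hx, rfl⟩ := hE' e he
    exact x.1.2
  · have hnd : (E.map Prod.snd).Nodup := by
      refine List.Nodup.map_on ?_ hE
      intro e he f hf hef
      obtain ⟨x, hx, rfl⟩ := hE' e he
      obtain ⟨y, hy, rfl⟩ := hE' f hf
      rw [h.eq_of_snd hx hy (Fin.ext hef)]
    refine (List.perm_ext_iff_of_nodup hnd (List.nodup_range.filter _)).2 fun v => ?_
    simp only [List.mem_filter, List.mem_range, decide_eq_true_eq]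
    constructor
    · intro hv
      obtain ⟨e, he, rfl⟩ := List.mem_map.1 hv
      obtain ⟨x, hx, rfl⟩ := hE' e he
      exact ⟨x.2.2, fun hc => h.snd_ne hx (Fin.ext hc)⟩
    · rintro ⟨hv, hvr⟩
      obtain ⟨a, ha⟩ := h.exists_arc (v := ⟨v, hv⟩) fun hc => hvr (congrArg Fin.val hc)
      exact List.mem_map.2 ⟨((a : ℕ), v), (hEm _).2 (List.mem_map.2 ⟨_, ha, rfl⟩), rfl⟩
  · intro v hv
    -- The children of v are among its neighbours, so the surplus colour of the instance gives the
    -- bound.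
    refine le_trans (Nat.add_le_add_right ?_ 1) (I.degree_lt ⟨v, hv⟩)
    have hnd : ((E.filter fun e => decide (e.1 = v)).map Prod.snd).Nodup := by
      refine List.Nodup.map_on ?_ (hE.filter _)
      intro e he f hf hef
      have he := (List.mem_filter.1 he).2
      have hf := (List.mem_filter.1 hf).2
      simp only [decide_eq_true_eq] at he hf
      exact Prod.ext (he.trans hf.symm) hef
    rw [← List.length_map (f := Prod.snd), ← List.toFinset_card_of_nodup hnd,
      ← Set.ncard_coe_finset]
    refine le_trans (Set.ncard_le_ncard (t := Fin.val '' (I.graph.neighborSet ⟨v, hv⟩)) ?_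
      (Set.toFinite _)) (Set.ncard_image_le (Set.toFinite _))
    intro c hc
    simp only [List.coe_toFinset, Set.mem_ofPred_eq, List.mem_map, List.mem_filter,
      decide_eq_true_eq] at hc
    obtain ⟨e, ⟨he, hev⟩, rfl⟩ := hc
    obtain ⟨x, hx, rfl⟩ := hE' e he
    refine ⟨x.2, ?_, rfl⟩
    have := h.adj hx
    rwa [show x.1 = ⟨v, hv⟩ from Fin.ext hev] at this
  · intro e he
    obtain ⟨x, hx, rfl⟩ := hE' e he
    simp [h.dist hx]
  · simp
  · intro v hv
    rw [dif_pos hv]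
    obtain ⟨p, hp, hpl⟩ := h.tree.connected.exists_path_of_dist r ⟨v, hv⟩
    rw [← hpl]
    simpa using hp.length_lt

/-- The colours `χ` of the vertices other than the root are the colours that `X` gives to the edges
that lead to them; the root has the extra colour `k`. -/
structure Rel (X : I.Coloring) (r : Fin I.n) (χ : ℕ → ℕ) : Prop where
  root : χ r = I.k
  arc : ∀ e ∈ arcs I r, ((X s(e.1, e.2) : Fin I.k) : ℕ) = χ e.2

/-- In a rooted tree, two edges with a common endpoint are siblings or parent and child. `Proper`
forbids equal colours in exactly these cases; its condition at the root is void, since the colour k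
is not in use. -/
theorem Rel.isProper_iff (h : IsRooted I r) {X : I.Coloring} {χ : ℕ → ℕ} (hX : Rel X r χ)
    {E : List (ℕ × ℕ)} (hE : E.Nodup) (hEm : ∀ e, e ∈ E ↔ e ∈ (arcs I r).map valPair) :
    I.IsProper X ↔ IsColoring I.n I.k r E χ := by
  have hmem : ∀ {v c : ℕ}, c ∈ heads E v ↔ ∃ x ∈ arcs I r, (x.1 : ℕ) = v ∧ (x.2 : ℕ) = c := by
    intro v c
    rw [mem_heads, hEm, List.mem_map]
    simp [valPair]
  have hT := h.isTree hE hEm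
  constructor
  · intro hp
    refine ⟨hX.root, fun v hv => ⟨fun c hc => ?_, ?_⟩⟩
    · obtain ⟨x, hx, rfl, rfl⟩ := hmem.1 hc
      refine ⟨by rw [← hX.arc x hx]; exact Fin.is_lt _, ?_⟩
      by_cases hr : x.1 = r
      · rw [hr, hX.root, ← hX.arc x hx]
        exact (Fin.is_lt _).ne
      · obtain ⟨a, ha⟩ := h.exists_arc hr
        have h1 := hp _ (h.mem_edgeSet.2 ⟨x, hx, rfl⟩) _ (h.mem_edgeSet.2 ⟨_, ha, rfl⟩)
          (fun hc => ?_) ⟨x.1, by simp, by simp⟩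
        · have h2 := hX.arc _ ha
          simp only at h2 h1
          rw [← h2, ← hX.arc x hx]
          exact fun hc => h1 (Fin.ext hc)
        · have h1 := h.eq_of_edge hx ha hc
          have h2 := h.dist hx
          have h3 : x.2 = x.1 := congrArg Prod.snd h1
          rw [h3] at h2
          omega
    · refine List.Nodup.map_on ?_ (hT.heads_nodup v)
      intro c hc c' hc' hcc
      obtain ⟨x, hx, h1, rfl⟩ := hmem.1 hc
      obtain ⟨y, hy, h2, rfl⟩ := hmem.1 hc'
      by_contra hne
      refine hp _ (h.mem_edgeSet.2 ⟨x, hx, rfl⟩) _ (h.mem_edgeSet.2 ⟨y, hy, rfl⟩) (fun hc => ?_)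
        ⟨x.1, by simp, ?_⟩ ?_
      · exact hne (by rw [h.eq_of_edge hx hy hc])
      · rw [show x.1 = y.1 from Fin.ext (h1.trans h2.symm)]
        simp
      · exact Fin.ext (by rw [hX.arc x hx, hX.arc y hy, hcc])
  · rintro ⟨-, hc⟩ e he f hf hef ⟨w, hwe, hwf⟩ hXef
    obtain ⟨x, hx, rfl⟩ := h.mem_edgeSet.1 he
    obtain ⟨y, hy, rfl⟩ := h.mem_edgeSet.1 hf
    have hval : χ x.2 = χ y.2 := by rw [← hX.arc x hx, ← hX.arc y hy, hXef]
    have hxy : x ≠ y := fun hc => hef (by rw [hc])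
    have key : ∀ x ∈ arcs I r, ∀ y ∈ arcs I r, x.2 = y.1 → χ y.2 ≠ χ x.2 := by
      intro x hx y hy hxy
      have := ((hc y.1 y.1.2).1 y.2 (hmem.2 ⟨y, hy, rfl, rfl⟩)).2
      rwa [← hxy] at this
    -- The common endpoint is the tail of both arcs, the tail of one and the head of the other (two
    -- cases), or the head of both; the last forces the arcs to be equal.
    rcases Sym2.mem_iff.1 hwe with rfl | rfl <;> rcases Sym2.mem_iff.1 hwf with h1 | h1
    · have hnd := (hc x.1 x.1.2).2
      have := List.inj_on_of_nodup_map hnd (hmem.2 ⟨x, hx, rfl, rfl⟩)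
        (hmem.2 ⟨y, hy, by rw [h1], rfl⟩) hval
      exact hxy (h.eq_of_snd hx hy (Fin.ext this))
    · exact key y hy x hx h1.symm hval
    · exact key x hx y hy h1 hval.symm
    · exact hxy (h.eq_of_snd hx hy h1)

theorem IsRooted.exists_rel (h : IsRooted I r) (X : I.Coloring) : ∃ χ, Rel X r χ := by
  classical
  let par (v : Fin I.n) : Fin I.n := if hv : ∃ a, (a, v) ∈ arcs I r then hv.choose else v
  have hpar : ∀ e ∈ arcs I r, par e.2 = e.1 := by
    intro e he
    have hv : ∃ a, (a, e.2) ∈ arcs I r := ⟨e.1, he⟩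
    simp only [par, dif_pos hv]
    exact congrArg Prod.fst (h.eq_of_snd hv.choose_spec he rfl)
  refine ⟨fun v => if hv : v < I.n then if v = r then I.k else X s(par ⟨v, hv⟩, ⟨v, hv⟩) else 0,
    by simp, fun e he => ?_⟩
  have := h.snd_ne he
  rw [dif_pos e.2.2, if_neg fun hc => this (Fin.ext hc)]
  simp [hpar e he]

theorem IsRooted.exists_rel_of_isColoring (h : IsRooted I r) {E : List (ℕ × ℕ)}
    (hEm : ∀ e, e ∈ E ↔ e ∈ (arcs I r).map valPair) {χ : ℕ → ℕ}
    (hχ : IsColoring I.n I.k r E χ) : ∃ X : I.Coloring, Rel X r χ := by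
  classical
  have hk : 0 < I.k := by have := I.degree_lt r; omega
  -- The bound χ x.2 < k is part of the condition in order to provide an element of `Fin I.k`.
  -- Colour 0 off the graph is irrelevant.
  refine ⟨fun e => if he : ∃ x ∈ arcs I r, e = s(x.1, x.2) ∧ χ x.2 < I.k then
    ⟨χ he.choose.2, he.choose_spec.2.2⟩ else ⟨0, hk⟩, hχ.1, fun e he => ?_⟩
  have hlt : χ e.2 < I.k :=
    ((hχ.2 e.1 e.1.2).1 e.2 (mem_heads.2 ((hEm _).2 (List.mem_map.2 ⟨e, he, rfl⟩)))).1
  have hex : ∃ x ∈ arcs I r, s(e.1, e.2) = s(x.1, x.2) ∧ χ x.2 < I.k := ⟨e, he, rfl, hlt⟩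
  rw [dif_pos hex]
  simp only
  rw [← h.eq_of_edge he hex.choose_spec.1 hex.choose_spec.2.1]

end SingleSource

/-! ### Costs in terms of arcs, and the output. -/

namespace SingleSource

open RAM EdgeColoring

variable {I : PathInstance} {r : Fin I.n}

/-- A path visits r only at its start, so exactly its first arc leaves r. -/
theorem IsRooted.filter_arcs (h : IsRooted I r) :
    (arcs I r).filter (fun e => decide (e.1 ≠ r)) =
      I.paths.flatMap fun p => steps (directed I r p).tail := by
  rw [arcs, List.filter_flatMap]
  refine List.flatMap_congr fun p hp => ?_
  obtain ⟨a, q, h1, h2⟩ := h.directed_eq hp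
  rw [h1, steps_cons_cons, List.tail_cons, List.filter_cons_of_neg (by simp), List.filter_eq_self]
  intro e he
  rw [decide_eq_true_eq]
  rintro rfl
  exact (List.nodup_cons.1 h2).1 (mem_of_mem_steps he).1

theorem IsRooted.exists_parent (h : IsRooted I r) :
    ∃ par : Fin I.n → Fin I.n, ∀ e ∈ arcs I r, par e.2 = e.1 := by
  classical
  refine ⟨fun v => if hv : ∃ a, (a, v) ∈ arcs I r then hv.choose else v, fun e he => ?_⟩
  have hv : ∃ a, (a, e.2) ∈ arcs I r := ⟨e.1, he⟩
  simp only [dif_pos hv]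
  exact congrArg Prod.fst (h.eq_of_snd hv.choose_spec he rfl)

/-- This is where the common endpoint is used: every arc of a path other than its first completes
exactly one traversal of that path, so multiplicities agree. -/
theorem IsRooted.traversals_perm (h : IsRooted I r) {par : Fin I.n → Fin I.n}
    (hpar : ∀ e ∈ arcs I r, par e.2 = e.1) :
    (I.paths.flatMap traversals).Perm
      (((arcs I r).filter fun e => decide (e.1 ≠ r)).map (turn par)) := by
  rw [h.filter_arcs, List.map_flatMap]
  refine List.Perm.flatMap_left _ fun p hp => ?_
  obtain ⟨a, q, h1, h2⟩ := h.directed_eq hp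
  have h3 : traversals (directed I r p) = (steps (directed I r p).tail).map (turn par) := by
    rw [h1]
    refine traversals_eq par _ r fun e he => hpar e ?_
    exact List.mem_flatMap.2 ⟨p, hp, by rwa [h1]⟩
  rw [← h3]
  rcases directed_eq_or (r := r) p with h | h <;> rw [h]
  rw [traversals_reverse]
  exact (List.reverse_perm _).symm

theorem reloadCost_eq (X : I.Coloring) :
    I.reloadCost X = ((I.paths.flatMap traversals).map (I.traversalCost X)).sum := by
  rw [PathInstance.reloadCost, List.map_flatMap]
  induction I.paths with
  | nil => rfl
  | cons p l ih => rw [List.map_cons, List.sum_cons, ih, List.flatMap_cons, List.sum_append]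

variable {b : Bd} {C : List ℕ} {P : ℕ}

/-- `C` is a table of the traversal costs, scaled by `P`. -/
def IsScaled (b : Bd) (I : PathInstance) (C : List ℕ) (P : ℕ) : Prop :=
  ∀ i j : Fin I.k, (tcost b I.k C i j : ℚ≥0) = P * I.tc i j

/-- An arc that leaves r closes no traversal; on the left it costs 0, because r has the colour k. -/
theorem total_map_eq (h : IsRooted I r) {par : Fin I.n → Fin I.n}
    (hpar : ∀ e ∈ arcs I r, par e.2 = e.1) (hC : IsScaled b I C P) {X : I.Coloring} {χ : ℕ → ℕ}
    (hX : Rel X r χ) (L : List (Fin I.n × Fin I.n)) (hL : ∀ e ∈ L, e ∈ arcs I r) :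
    (total b I.k C (L.map valPair) χ : ℚ≥0) =
      P * (((L.filter fun e => decide (e.1 ≠ r)).map (turn par)).map (I.traversalCost X)).sum := by
  induction L with
  | nil => simp [total]
  | cons e L ih =>
    have ih := ih fun x hx => hL x (List.mem_cons_of_mem _ hx)
    have he := hL e List.mem_cons_self
    have h1 : total b I.k C ((e :: L).map valPair) χ =
        tcost b I.k C (χ e.1) (χ e.2) + total b I.k C (L.map valPair) χ := by
      simp [total, valPair]
    rw [h1, Nat.cast_add, ih]
    by_cases hr : e.1 = r
    · rw [List.filter_cons_of_neg (by simp [hr]), hr, hX.root, tcost_of_le le_rfl]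
      simp
    · rw [List.filter_cons_of_pos (by simp [hr])]
      obtain ⟨a, ha⟩ := h.exists_arc hr
      have h2 : par e.1 = a := hpar _ ha
      have h3 := hX.arc _ ha
      simp only at h3
      have h4 : I.traversalCost X (turn par e) = I.tc (X s(a, e.1)) (X s(e.1, e.2)) := by
        rw [turn, h2]; rfl
      rw [List.map_cons, List.map_cons, List.sum_cons, h4, mul_add, ← hC, h3, hX.arc e he]

theorem total_arcs (h : IsRooted I r) (hC : IsScaled b I C P) {X : I.Coloring} {χ : ℕ → ℕ}
    (hX : Rel X r χ) :
    (total b I.k C ((arcs I r).map valPair) χ : ℚ≥0) = P * I.reloadCost X := by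
  obtain ⟨par, hpar⟩ := h.exists_parent
  rw [total_map_eq h hpar hC hX _ fun _ => id, reloadCost_eq,
    ((h.traversals_perm hpar).map (I.traversalCost X)).sum_eq]

/-- Different arcs complete different traversals, so removing repeated arcs amounts to paying once
for each traversal. -/
theorem total_edges (h : IsRooted I r) (hC : IsScaled b I C P) {X : I.Coloring} {χ : ℕ → ℕ}
    (hX : Rel X r χ) {E : List (ℕ × ℕ)} (hE : E.Nodup)
    (hEm : ∀ e, e ∈ E ↔ e ∈ (arcs I r).map valPair) :
    (total b I.k C E χ : ℚ≥0) = P * I.changeoverCost X := by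
  obtain ⟨par, hpar⟩ := h.exists_parent
  have hp : E.Perm ((arcs I r).dedup.map valPair) := by
    refine (List.perm_ext_iff_of_nodup hE ((List.nodup_dedup _).map valPair_injective)).2 fun e => ?_
    rw [hEm]
    simp
  have h1 : total b I.k C E χ = total b I.k C ((arcs I r).dedup.map valPair) χ :=
    (hp.map _).sum_eq
  rw [h1, total_map_eq h hpar hC hX _ fun e he => List.mem_dedup.1 he, PathInstance.changeoverCost]
  congr 1
  have hnd : (((arcs I r).dedup.filter fun e => decide (e.1 ≠ r)).map (turn par)).Nodup := by
    refine List.Nodup.map_on ?_ ((List.nodup_dedup _).filter _)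
    intro e he f hf hef
    simp only [List.mem_filter, List.mem_dedup, decide_eq_true_eq] at he hf
    obtain ⟨a, ha⟩ := h.exists_arc he.2
    obtain ⟨c, hc⟩ := h.exists_arc hf.2
    have h2 : par e.1 = a := hpar _ ha
    have h3 : par f.1 = c := hpar _ hc
    rw [turn, turn, h2, h3] at hef
    rcases Sym2.eq_iff.1 hef with ⟨-, h4⟩ | ⟨h4, h5⟩
    · exact h.eq_of_edge he.1 hf.1 h4
    -- If the two edges were interchanged, f would be the arc before e and e the arc before f,
    -- against the growth of distances.
    · have h6 := h.eq_of_edge ha hf.1 h4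
      have h7 := h.eq_of_edge he.1 hc h5
      have h8 := h.dist ha
      have h9 := h.dist he.1
      have h10 := h.dist hc
      have h11 : e.1 = f.2 := congrArg Prod.snd h6
      have h12 : e.2 = f.1 := congrArg Prod.snd h7
      have h13 := h.dist hf.1
      simp only at h8 h10
      rw [h11, h12] at h9
      omega
  rw [← List.sum_toFinset _ hnd]
  refine Finset.sum_congr ?_ fun _ _ => rfl
  ext t
  simp only [List.mem_toFinset, (h.traversals_perm hpar).mem_iff, List.mem_map, List.mem_filter,
    List.mem_dedup]

/-- The paths as lists of numbers. -/
def natPaths (I : PathInstance) : List (List ℕ) := I.paths.map fun p => p.map fun v : Fin I.n => (v : ℕ)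

theorem head_natPath {r : Fin I.n} {p : List (Fin I.n)} (hp : p ≠ []) :
    (p.map fun v : Fin I.n => (v : ℕ)).headD 0 = r ↔ p.head? = some r := by
  cases p with
  | nil => exact absurd rfl hp
  | cons a p => simp [Fin.ext_iff]

theorem orient_natPath {p : List (Fin I.n)} (hp : p ∈ I.paths) (hb : p.length ≤ b.n) :
    orient b r (p.map fun v : Fin I.n => (v : ℕ)) = (directed I r p).map fun v : Fin I.n => (v : ℕ) := by
  have hne : p ≠ [] := by
    rintro rfl; simpa using I.paths_length _ hp
  rw [orient, directed, Bd.cut_eq (by simpa using hb)]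
  simp only [head_natPath hne]
  split <;> simp

theorem length_directed (p : List (Fin I.n)) : (directed I r p).length = p.length := by
  rcases directed_eq_or (r := r) p with h | h <;> rw [h]
  simp

theorem rawEdges_natPaths (hm : I.paths.length ≤ b.n) (hp : ∀ p ∈ I.paths, p.length ≤ b.n) :
    rawEdges b r (natPaths I) = (arcs I r).map valPair := by
  rw [rawEdges, natPaths, Bd.cut_eq (by simpa using hm), arcs, List.map_flatMap, List.flatMap_map]
  refine List.flatMap_congr fun p hpI => ?_
  rw [orient_natPath hpI (hp p hpI), 
    Bd.cut_eq (l := List.map _ _) (by rw [List.length_map, length_directed]; exact hp p hpI),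
    pairs_map, Bd.cut_eq]
  · rfl
  · rw [List.length_map]
    exact (length_steps_le _).trans ((length_directed p).trans_le (hp p hpI))

theorem length_arcs_le : (arcs I r).length ≤ I.paths.flatten.length := by
  rw [arcs, List.length_flatMap, List.length_flatten]
  exact List.sum_le_sum fun p hp => (length_steps_le _).trans (length_directed p).le

theorem n_le_length : I.n ≤ I.paths.flatten.length := by
  have h : (Finset.univ : Finset (Fin I.n)) ⊆ I.paths.flatten.toFinset := by
    intro v _
    obtain ⟨p, hp, hv⟩ := I.paths_cover v
    simp only [List.mem_toFinset, List.mem_flatten]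
    exact ⟨p, hp, hv⟩
  have := (Finset.card_le_card h).trans (List.toFinset_card_le _)
  simpa using this

theorem answers_eq (h : IsRooted I r) (hm : I.paths.length ≤ b.n)
    (hp : ∀ p ∈ I.paths, p.length ≤ b.n) {E : List (ℕ × ℕ)}
    (hEm : ∀ e, e ∈ E ↔ e ∈ (arcs I r).map valPair) {F : Table} {χ : ℕ → ℕ}
    (hχ : Follows b I.k r E F χ) {X : I.Coloring} (hX : Rel X r χ) :
    (answers b I.k r F (natPaths I)).map Nat.cast = I.encodeColoring X := by
  have hans : ∀ p ∈ I.paths, (b.cut (answer b I.k r F (p.map fun v : Fin I.n => (v : ℕ)))).map Nat.cast =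
      (pathEdges p).map fun e => ((X e : ℕ) : ℤ) := by
    intro p hpI
    obtain ⟨a, q, h1, h2⟩ := h.directed_eq hpI
    have hne : p ≠ [] := by
      rintro rfl; simpa using I.paths_length _ hpI
    have hlen := length_directed (r := r) p
    have hb := hp p hpI
    rw [h1] at hlen
    have hcol : ∀ l : List (Fin I.n), (∀ e ∈ steps l, e ∈ arcs I r) →
        (pathEdges l).map (fun e => ((X e : ℕ) : ℤ)) =
          (l.tail.map fun v : Fin I.n => χ v).map Nat.cast := by
      intro l hl
      rw [pathEdges_eq, List.map_map, List.map_map]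
      have h3 : (steps l).map Prod.snd = l.tail := List.map_snd_zip (by simp)
      conv_rhs => rw [← h3, List.map_map]
      refine List.map_congr_left fun e he => ?_
      simp only [Function.comp_apply]
      rw [hX.arc e (hl e he)]
    have hsteps : ∀ e ∈ steps (r :: a :: q), e ∈ arcs I r := fun e he =>
      List.mem_flatMap.2 ⟨p, hpI, by rwa [h1]⟩
    have hpath : pathColors b I.k F ((r :: a :: q).map fun v : Fin I.n => (v : ℕ)) =
        ((a :: q).map fun v : Fin I.n => χ v).reverse := by
      rw [List.map_cons, hχ.pathColors]
      · simp
      · simp at hlen ⊢; omega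
      · intro e he
        rw [← List.map_cons (f := fun v : Fin I.n => (v : ℕ)), pairs_map, List.mem_map] at he
        obtain ⟨x, hx, rfl⟩ := he
        exact (hEm _).2 (List.mem_map.2 ⟨x, hsteps x hx, rfl⟩)
    rw [answer]
    simp only [head_natPath hne]
    by_cases hd : p.head? = some r
    · have hpd : p = r :: a :: q := by rw [← h1, directed, if_pos hd]
      rw [if_pos hd, hpd, hpath, hcol _ hsteps, Bd.cut_eq (l := List.reverse (Bd.cut _ _)),
        Bd.cut_eq, List.reverse_reverse]
      · rfl
      · simp at hlen ⊢; omega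
      · rw [List.length_reverse]
        refine (List.length_take_le _ _).trans ?_
        omega
    · have hpd : p.reverse = r :: a :: q := by rw [← h1, directed, if_neg hd]
      rw [if_neg hd, Bd.cut_eq (l := p.map _) (by simpa using hb), ← List.map_reverse, hpd, hpath,
        Bd.cut_eq (by simp at hlen ⊢; omega)]
      have hp' : p = (r :: a :: q).reverse := by rw [← hpd, List.reverse_reverse]
      rw [hp', pathEdges_reverse, List.map_reverse, List.map_reverse, hcol _ hsteps]
      rfl
  rw [answers, natPaths, Bd.cut_eq (by simpa using hm), List.flatMap_map, List.map_flatMap]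
  exact List.flatMap_congr hans

/-! ### The encoding -/

/-- Numerators and denominators of the traversal costs. -/
def costPairs (I : PathInstance) : List (ℕ × ℕ) :=
  (List.finRange I.k).flatMap fun i => (List.finRange I.k).map fun j =>
    ((I.tc i j).num, (I.tc i j).den)

/-- The encoding, in natural numbers. -/
def encodeNat (I : PathInstance) : List ℕ :=
  I.n :: I.k :: (natPaths I).length :: ((natPaths I).flatMap (fun p => p.length :: p) ++
    (costPairs I).flatMap fun x => [x.1, x.2])

theorem encode_eq (I : PathInstance) : I.encode = (encodeNat I).map Nat.cast := by
  simp [PathInstance.encode, encodeNat, natPaths, costPairs, List.map_flatMap, List.flatMap_map,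
    List.flatMap_assoc, ← List.map_eq_flatMap]

/-- All quantities are bounded by the size of the input. -/
structure Fits (b : Bd) (I : PathInstance) : Prop where
  m_le : I.paths.length ≤ b.n
  path_le : ∀ p ∈ I.paths, p.length ≤ b.n
  flatten_le : I.paths.flatten.length ≤ b.n
  kk_le : I.k * I.k ≤ b.n
  k_lt : I.k + 1 ≤ b.n
  lt_pow : ∀ x ∈ encodeNat I, x < 2 ^ b.n

/-- The encoding lists three numbers, one per path, one per vertex of each path and two per pair of
colours. Each number adds at least one to `bitLength`, and at least its own binary length. -/
theorem fits (I : PathInstance) : Fits ⟨bitLength I.encode⟩ I := by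
  have hB : bitLength I.encode = ((encodeNat I).map fun z => z.size + 1).sum := by
    simp [encode_eq, bitLength, Function.comp_def]
  have hlen : (encodeNat I).length ≤ bitLength I.encode := by
    rw [hB]
    simp
  have h1 : (encodeNat I).length =
      3 + (I.paths.length + I.paths.flatten.length) + I.k * I.k * 2 := by
    have e1 : ∀ l : List (List (Fin I.n)), (List.map (List.length ∘ fun p => p.length :: p)
        (l.map fun p => p.map fun v : Fin I.n => (v : ℕ))).sum = l.length + l.flatten.length := by
      intro l
      induction l with
      | nil => rfl
      | cons p l ih => simp at ih ⊢; omega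
    have e2 : ((costPairs I).flatMap fun x => [x.1, x.2]).length = I.k * I.k * 2 := by
      simp [costPairs, List.length_flatMap]
    have e3 := e1 I.paths
    rw [encodeNat]
    simp only [List.length_cons, List.length_append, e2]
    rw [List.length_flatMap]
    simp only [natPaths] at e3 ⊢
    rw [show (List.map (fun a : List ℕ => (a.length :: a).length)) =
      List.map (List.length ∘ fun p : List ℕ => p.length :: p) from rfl, e3]
    omega
  have h2 := Nat.le_mul_self I.k
  have h3 : ∀ p ∈ I.paths, p.length ≤ I.paths.flatten.length := by
    intro p hp
    rw [List.length_flatten]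
    exact List.le_sum_of_mem (List.mem_map.2 ⟨p, hp, rfl⟩)
  refine ⟨?_, fun p hp => (h3 p hp).trans ?_, ?_, ?_, ?_, fun x hx => ?_⟩
  · dsimp only; omega
  · dsimp only; omega
  · dsimp only; omega
  · dsimp only; omega
  · dsimp only; omega
  have h4 : x.size + 1 ≤ bitLength I.encode := by
    rw [hB]
    exact List.le_sum_of_mem (List.mem_map.2 ⟨x, hx, rfl⟩)
  exact (Nat.lt_size_self x).trans_le (Nat.pow_le_pow_right (by omega) (by dsimp only; omega))

theorem scale_costPairs (hb : Fits b I) : ∃ P, 0 < P ∧ IsScaled b I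
    (b.cut (scale b ((costPairs I).flatMap fun x => [x.1, x.2])).2.2).reverse P := by
  have hlen : (costPairs I).length ≤ b.n := by
    have := hb.kk_le
    simpa [costPairs, List.length_flatMap] using this
  have hlt : ∀ x ∈ costPairs I, x.1 < 2 ^ b.n ∧ x.2 < 2 ^ b.n ∧ 0 < x.2 := by
    intro x hx
    have hmem : x.1 ∈ encodeNat I ∧ x.2 ∈ encodeNat I := by
      simp only [encodeNat, List.mem_cons, List.mem_append, List.mem_flatMap]
      exact ⟨.inr (.inr (.inr (.inr ⟨x, hx, by simp⟩))), .inr (.inr (.inr (.inr ⟨x, hx, by simp⟩)))⟩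
    refine ⟨hb.lt_pow _ hmem.1, hb.lt_pow _ hmem.2, ?_⟩
    simp only [costPairs, List.mem_flatMap, List.mem_map] at hx
    obtain ⟨i, -, j, -, rfl⟩ := hx
    exact (I.tc i j).den_pos
  obtain ⟨P, hP, h⟩ := scale_spec (costPairs I) hlen hlt
  refine ⟨P, hP, fun i j => tcost_spec ?_ hb.kk_le i j⟩
  rw [h]
  simp [costPairs, List.map_flatMap, Function.comp_def, NNRat.num_div_den]

theorem parse_natPaths (hb : Fits b I) :
    parse b (natPaths I).length ((natPaths I).flatMap (fun p => p.length :: p) ++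
      (costPairs I).flatMap fun x => [x.1, x.2]) =
    (0, (costPairs I).flatMap fun x => [x.1, x.2], (natPaths I).reverse) := by
  refine parse_eq _ _ (by simpa [natPaths] using hb.m_le) fun p hp => ?_
  obtain ⟨q, hq, rfl⟩ := List.mem_map.1 hp
  simpa using hb.path_le q hq

/-- The vertex found need not be the one promised, for instance if there is a single path; any
common endpoint will do. -/
theorem exists_root (hb : Fits b I) (h : I.IsSingleSourceTree) :
    ∃ r : Fin I.n, IsRooted I r ∧ root b I.n (natPaths I) = r := by
  have hiff : ∀ r : Fin I.n, (∀ p ∈ natPaths I, p.headD 0 = r ∨ p.reverse.headD 0 = r) ↔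
      I.IsCommonEndpoint r := by
    intro r
    simp only [natPaths, List.mem_map, forall_exists_index, and_imp, forall_apply_eq_imp_iff₂]
    refine forall₂_congr fun p hp => ?_
    have hne : p ≠ [] := by
      rintro rfl; simpa using I.paths_length _ hp
    rw [head_natPath hne, ← List.map_reverse, head_natPath (by simpa using hne),
      List.head?_reverse]
  obtain ⟨htree, r, hr⟩ := h
  obtain ⟨h1, h2⟩ := root_spec (b := b) (paths := natPaths I) (by simpa [natPaths] using hb.m_le)
    (fun p hp => by
      obtain ⟨q, hq, rfl⟩ := List.mem_map.1 hp
      simpa using hb.path_le q hq)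
    (n_le_length.trans hb.flatten_le) ⟨r, r.2, (hiff r).2 hr⟩
  exact ⟨⟨_, h1⟩, ⟨htree, (hiff ⟨_, h1⟩).1 h2⟩, rfl⟩

/-- The objective function: changeover costs if `cc` holds, reload costs otherwise. -/
def objective (cc : Bool) (I : PathInstance) (X : I.Coloring) : ℚ≥0 :=
  if cc = true then I.changeoverCost X else I.reloadCost X

theorem algorithm_spec (cc : Bool) (h : I.IsSingleSourceTree) (hb : Fits b I) :
    ∃ X : I.Coloring, I.IsOptimal (objective cc I) X ∧
      (algorithm cc (b, encodeNat I)).map Nat.cast = I.encodeColoring X := by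
  obtain ⟨P, hP, hC⟩ := scale_costPairs hb
  obtain ⟨r, hr, hroot⟩ := exists_root hb h
  have halg : algorithm cc (b, encodeNat I) = fromPaths cc b I.n I.k
      (b.cut (scale b ((costPairs I).flatMap fun x => [x.1, x.2])).2.2).reverse (natPaths I) := by
    simp only [algorithm, encodeNat, List.headD_cons, List.tail_cons, parse_natPaths hb, fromParsed]
    rw [Bd.cut_eq (l := (natPaths I).reverse) (by simpa [natPaths] using hb.m_le),
      List.reverse_reverse]
  rw [halg, fromPaths, hroot, fromRoot, rawEdges_natPaths hb.m_le hb.path_le, fromEdges]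
  generalize (b.cut (scale b ((costPairs I).flatMap fun x => [x.1, x.2])).2.2).reverse = C at hC ⊢
  have hraw : ((arcs I r).map valPair).length ≤ b.n := by
    rw [List.length_map]; exact length_arcs_le.trans hb.flatten_le
  obtain ⟨hE, hEl, hEm⟩ := nub_spec hraw
  generalize nub b ((arcs I r).map valPair) = E at hE hEl hEm ⊢
  have hT := hr.isTree hE hEm
  have hW : ∀ e, e ∈ E ↔ e ∈ (if cc = true then E else (arcs I r).map valPair) := by
    intro e
    split
    · rfl
    · exact hEm e
  have hbd : Bounds b I.n I.k E (if cc = true then E else (arcs I r).map valPair) := by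
    refine ⟨n_le_length.trans hb.flatten_le, hb.k_lt, hb.kk_le, hEl.trans hraw, ?_⟩
    split
    · exact hEl.trans hraw
    · exact hraw
  have htotal : ∀ {X : I.Coloring} {χ : ℕ → ℕ}, Rel X r χ →
      (total b I.k C (if cc = true then E else (arcs I r).map valPair) χ : ℚ≥0) =
        P * objective cc I X := by
    intro X χ hX
    unfold objective
    split
    · exact total_edges hr hC hX hE hEm
    · exact total_arcs hr hC hX
  generalize (if cc = true then E else (arcs I r).map valPair) = W at hW hbd htotal ⊢
  obtain ⟨χ, hχ⟩ := exists_follows (b := b) hT (table b I.n I.k C E W)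
  have hcol := hχ.isColoring hbd hT
  obtain ⟨X, hX⟩ := hr.exists_rel_of_isColoring hEm hcol
  refine ⟨X, ⟨(hX.isProper_iff hr hE hEm).2 hcol, fun X' hX' => ?_⟩,
    answers_eq hr hb.m_le hb.path_le hEm hχ hX⟩
  obtain ⟨χ', hχ'⟩ := hr.exists_rel X'
  have h1 := hχ.optimal hbd hT hW ((hχ'.isProper_iff hr hE hEm).1 hX')
  -- Optimality was shown for the integer costs, which are the true ones multiplied by `P` > 0.
  have h2 : (P : ℚ≥0) * objective cc I X ≤ P * objective cc I X' := by
    rw [← htotal hX, ← htotal hχ']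
    exact_mod_cast h1
  exact le_of_mul_le_mul_left h2 (by exact_mod_cast hP)

theorem length_encodeColoring_le (X : I.Coloring) :
    (I.encodeColoring X).length ≤ I.paths.flatten.length := by
  rw [PathInstance.encodeColoring, List.length_flatMap, List.length_flatten]
  refine List.sum_le_sum fun p hp => ?_
  rw [List.length_map, pathEdges_eq, List.length_map]
  exact length_steps_le p

theorem polyTimeSolvable (cc : Bool) : PolyTimeSolvable PathInstance.encode
    PathInstance.IsSingleSourceTree fun I w =>
      ∃ X : I.Coloring, I.IsOptimal (objective cc I) X ∧ w = I.encodeColoring X := by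
  refine polyTimeSolvable_of_FP (fp_algorithm cc) fun I hI => ⟨encodeNat I, by simp [encodeNat],
    encode_eq I, ?_, ?_⟩
  · obtain ⟨X, -, hX⟩ := algorithm_spec cc hI (fits I)
    have h1 := congrArg List.length hX
    rw [List.length_map] at h1
    rw [h1]
    exact (length_encodeColoring_le X).trans (fits I).flatten_le
  · exact algorithm_spec cc hI (fits I)

end SingleSource

theorem mainTheorem5 :
    RAM.PolyTimeSolvable EdgeColoring.PathInstance.encode
        EdgeColoring.PathInstance.IsSingleSourceTree
        EdgeColoring.PathInstance.IsMinCCSolution ∧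
      RAM.PolyTimeSolvable EdgeColoring.PathInstance.encode
        EdgeColoring.PathInstance.IsSingleSourceTree
        EdgeColoring.PathInstance.IsMinRCSolution :=
  ⟨SingleSource.polyTimeSolvable true, SingleSource.polyTimeSolvable false⟩
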